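/- Let $(X,d)$ be a compact metric space. An adjusted approximative sequence of $X$ consists of positive reals $\varepsilon_n$ decreasing to $0$ and finite sets $A_n\subset X$ such that every point of $X$ is at distance less than $\varepsilon_n$ from some point of $A_n$, and $\varepsilon_{n+1}<(\varepsilon_n-\gamma_n)/2$, where $\gamma_n=\sup_{x\in X}d(x,A_n)$. Put $q_n(x)=\{a\in A_n: d(x,a)=d(x,A_n)\}$, let $U_n$ be the set of nonempty $C\subset A_n$ with $\operatorname{diam} C<2\varepsilon_n$, put $p_n(C)=\bigcup_{c\in C}q_n(c)$, and let $B_n$ be the covering of $X$ by the open balls $B(a,\varepsilon_n)$, $a\in A_n$. A polyhedral approximative sequence of $X$ is an inverse sequence $K=\{|K_n|,|\varphi_n|\}$, $\varphi_n:K_{n+1}\to K_n$ simplicial, of one of the following kinds, for some adjusted approximative sequence (the choices involved affect $|\varphi_n|$ only up to homotopy): 1. (Alexandroff–McCord) $K_n$ has as simplices the nonempty finite chains of $(U_n,\subset)$; $\varphi_n=p_n$. 2. (Vietoris–Rips on $A_n$) the simplices of $K_n$ are the nonempty subsets of $A_n$ of diameter $<2\varepsilon_n$; $\varphi_n(a)\in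 q_n(a)$. 3. (Vietoris) the simplices of $K_n$ are the nonempty finite subsets of $X$ of diameter $<2\varepsilon_n$; $\varphi_n$ is the inclusion. 4. (Čech) $K_n$ is the nerve of $B_n$; $\varphi_n(B(a,\varepsilon_{n+1}))=B(b,\varepsilon_n)$ with $b\in q_n(a)$; or, more generally, $\varphi_n$ sends each member of $B_{n+1}$ to a member of $B_n$ containing it. 5. (Witness) the simplices of $K_n$ are the nonempty $\sigma\subset A_n$ such that for every nonempty $\tau\subset\sigma$ there is $x\in X$ with $\sum_{a\in\tau}d(x,a)<|\tau|\,\varepsilon_n$; $\varphi_n(a)\in q_n(a)$. 6. (Upper, respectively lower, Dowker) the simplices of $K_n$ are the nonempty finite sets of elements of $U_n$ that are all contained in (respectively, all contain) a common element of $U_n$; $\varphi_n=p_n$. An HPol-expansion of $X$ is an inverse system $(X_\lambda,p_{\lambda\lambda'})$, over a nonempty directed set, of spaces of the homotopy type of polyhedra and homotopy classes of maps, with compatible homotopy classes $X\to X_\lambda$ inducing a bijection $\varinjlim_\lambda[X_\lambda,Q]\to[X,Q]$ for every space $Q$ of the homotopy type of a polyhedron; pointed HPol-expansions of $(X,x)$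 are defined in the same way with pointed spaces, maps and homotopies. The $p$-th Čech homology group of $X$ with coefficients in an abelian group $G$ is $\varprojlim_\lambda H_p(X_\lambda;G)$ for any HPol-expansion of $X$, and the $p$-th shape group of $(X,x)$ is $\varprojlim_\lambda\pi_p(X_\lambda)$ for any pointed HPol-expansion of $(X,x)$ (singular homology and homotopy groups). Let $K$ be a polyhedral approximative sequence of $X$. Then: (a) For every abelian group $G$ and every $p\ge 0$, $X$ has HPol-expansions, and for each of them the Čech homology group that it defines is isomorphic to $\varprojlim_n H_p(|K_n|;G)$. (b) Let $x\in X$. There are base vertices $v_n$ of $K_n$ with $\varphi_n(v_{n+1})=v_n$ that are near $x$, i.e. such that $d(x,v_n)<\varepsilon_n$ in kinds 2, 3, 5, $x\in v_n$ in kind 4, and $d(x,c)<\varepsilon_n$ for all $c\in v_n$ in kinds 1 and 6. For every such choice and every $p\ge1$, $(X,x)$ has pointed HPol-expansions, and for each of them the shape group that it defines is isomorphic to $\varprojlim_n\pi_p(|K_n|,v_n)$. -/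

import Mathlib

open CategoryTheory CategoryTheory.Limits
open scoped Topology unitInterval

universe u v w

namespace ShapeTheory

noncomputable section

/-! ### Polyhedra: geometric realizations of abstract simplicial complexes -/

/-- The points of the geometric realization `|K|`: finitely supported barycentric coordinates whose
support is a simplex of `K`. The vertices of `K` are the `v` with `{v}` a simplex of `K`. -/
def Realization {V : Type u} (K : PreAbstractSimplicialComplex V) : Type u :=
  {c : V →₀ ℝ // (∀ v, 0 ≤ c v) ∧ (c.sum fun _ r => r) = 1 ∧ c.support ∈ K.faces}

lemma extend_mem {V : Type u} (K : PreAbstractSimplicialComplex V) (s : K.faces)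
    (c : stdSimplex ℝ s.1) :
    (∀ v, 0 ≤ (Finsupp.equivFunOnFinite.symm c.1).mapDomain (Subtype.val : s.1 → V) v) ∧
      (((Finsupp.equivFunOnFinite.symm c.1).mapDomain (Subtype.val : s.1 → V)).sum
        fun _ r => r) = 1 ∧
      ((Finsupp.equivFunOnFinite.symm c.1).mapDomain (Subtype.val : s.1 → V)).support
        ∈ K.faces := by
  classical
  have hsum : (((Finsupp.equivFunOnFinite.symm c.1).mapDomain (Subtype.val : s.1 → V)).sum
        fun _ r => r) = 1 := by
    rw [Finsupp.sum_mapDomain_index (by simp) (by simp), Finsupp.sum_fintype _ _ (by simp)]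
    simpa using c.2.2
  refine ⟨fun v => ?_, hsum, ?_⟩
  · by_cases hv : v ∈ s.1
    · have := Finsupp.mapDomain_apply (f := (Subtype.val : s.1 → V)) Subtype.val_injective
        (Finsupp.equivFunOnFinite.symm c.1) ⟨v, hv⟩
      simp only at this
      rw [this]
      simpa using c.2.1 ⟨v, hv⟩
    · rw [Finsupp.mapDomain_of_notMem_range]
      simpa using hv
  · refine (K.isRelLowerSet_faces s.2).2 ?_ ?_
    · refine Finsupp.mapDomain_support.trans ?_
      intro v hv
      obtain ⟨a, -, rfl⟩ := Finset.mem_image.1 hv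
      exact a.2
    · rw [Finset.nonempty_iff_ne_empty]
      intro h
      rw [Finsupp.support_eq_empty] at h
      rw [h] at hsum
      simp at hsum

/-- The closed simplex of `|K|` spanned by the simplex `s`. -/
def closedSimplex {V : Type u} (K : PreAbstractSimplicialComplex V) (s : K.faces)
    (c : stdSimplex ℝ s.1) : Realization K :=
  ⟨(Finsupp.equivFunOnFinite.symm c.1).mapDomain Subtype.val, extend_mem K s c⟩

/-- The weak topology: a set is closed (open) iff it meets each closed simplex in a closed (open)
set. -/
instance {V : Type u} (K : PreAbstractSimplicialComplex V) : TopologicalSpace (Realization K) :=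
  ⨆ s : K.faces, TopologicalSpace.coinduced (closedSimplex K s) inferInstance

/-- A vertex of `K`, as a point of `|K|`. -/
def vertexPoint {V : Type u} (K : PreAbstractSimplicialComplex V) (v : V) (hv : {v} ∈ K.faces) :
    Realization K :=
  ⟨Finsupp.single v 1, by
    classical
    refine ⟨fun x => ?_, by simp, ?_⟩
    · by_cases h : v = x <;> simp [h]
    · rwa [Finsupp.support_single v (one_ne_zero : (1 : ℝ) ≠ 0)]⟩

/-- A vertex map sends simplices of `K` to simplices of `L`. -/
def IsSimplicial {V : Type u} {W : Type v} (K : PreAbstractSimplicialComplex V)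
    (L : PreAbstractSimplicialComplex W) (f : V → W) : Prop :=
  ∀ s ∈ K.faces, ∃ t ∈ L.faces, (t : Set W) = f '' s

lemma mapDomain_support_of_nonneg {V : Type u} {W : Type v} (f : V → W) (c : V →₀ ℝ)
    (hc : ∀ v, 0 ≤ c v) : ((c.mapDomain f).support : Set W) = f '' c.support := by
  classical
  apply Set.Subset.antisymm
  · have := Finsupp.mapDomain_support (f := f) (s := c)
    intro x hx
    simpa using this hx
  · rintro _ ⟨v, hv, rfl⟩
    have hpos : 0 < c v := lt_of_le_of_ne (hc v) (Ne.symm (Finsupp.mem_support_iff.1 hv))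
    have hle : c v ≤ c.mapDomain f (f v) := by
      rw [Finsupp.mapDomain, Finsupp.sum, Finsupp.finsetSum_apply]
      refine le_trans (by simp) (Finset.single_le_sum
        (f := fun a => (Finsupp.single (f a) (c a)) (f v)) (fun a _ => ?_) hv)
      by_cases h : f a = f v <;> simp [h, hc]
    exact Finsupp.mem_support_iff.2 (ne_of_gt (lt_of_lt_of_le hpos hle))

/-- The realization `|f| : |K| → |L|` of a simplicial map, linear on each simplex. -/
def realizeFun {V : Type u} {W : Type v} {K : PreAbstractSimplicialComplex V}
    {L : PreAbstractSimplicialComplex W} (f : V → W) (hf : IsSimplicial K L f)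
    (c : Realization K) : Realization L :=
  ⟨c.1.mapDomain f, by
    classical
    refine ⟨fun x => ?_, ?_, ?_⟩
    · rw [Finsupp.mapDomain, Finsupp.sum, Finsupp.finsetSum_apply]
      refine Finset.sum_nonneg fun a _ => ?_
      by_cases h : f a = x <;> simp [h, c.2.1]
    · rw [Finsupp.sum_mapDomain_index (by simp) (by simp)]
      exact c.2.2.1
    · obtain ⟨t, ht, hts⟩ := hf _ c.2.2.2
      rw [← mapDomain_support_of_nonneg f c.1 c.2.1] at hts
      rwa [← Finset.coe_injective hts]⟩

lemma continuous_realizeFun {V : Type u} {W : Type v} {K : PreAbstractSimplicialComplex V}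
    {L : PreAbstractSimplicialComplex W} (f : V → W) (hf : IsSimplicial K L f) :
    Continuous (realizeFun f hf) := by
  refine continuous_iSup_dom.2 fun s => continuous_coinduced_dom.2 ?_
  obtain ⟨t, ht, hts⟩ := hf _ s.2
  let g : s.1 → t := fun a => ⟨f a.1, by
    have : f a.1 ∈ (t : Set W) := by rw [hts]; exact ⟨a.1, a.2, rfl⟩
    exact this⟩
  have key : realizeFun f hf ∘ closedSimplex K s =
      closedSimplex L ⟨t, ht⟩ ∘ stdSimplex.map g := by
    funext c
    apply Subtype.ext
    simp only [Function.comp_apply, realizeFun, closedSimplex, stdSimplex.map,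
      FunOnFinite.linearMap]
    have : Finsupp.equivFunOnFinite.symm (FunOnFinite.map g c.1) =
        (Finsupp.equivFunOnFinite.symm c.1).mapDomain g := by
      simp [FunOnFinite.map]
    change _ = Finsupp.mapDomain Subtype.val
      (Finsupp.equivFunOnFinite.symm (FunOnFinite.map g c.1))
    rw [this, ← Finsupp.mapDomain_comp, ← Finsupp.mapDomain_comp]
    rfl
  rw [key]
  refine Continuous.comp ?_ (stdSimplex.continuous_map g)
  exact continuous_iff_coinduced_le.2
    (le_iSup (fun s : L.faces => TopologicalSpace.coinduced (closedSimplex L s) inferInstance)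
      ⟨t, ht⟩)

/-- The realization of a simplicial map, as a continuous map. -/
def realize {V : Type u} {W : Type v} {K : PreAbstractSimplicialComplex V}
    {L : PreAbstractSimplicialComplex W} (f : V → W) (hf : IsSimplicial K L f) :
    C(Realization K, Realization L) :=
  ⟨realizeFun f hf, continuous_realizeFun f hf⟩

lemma realize_vertexPoint {V : Type u} {W : Type v} {K : PreAbstractSimplicialComplex V}
    {L : PreAbstractSimplicialComplex W} (f : V → W) (hf : IsSimplicial K L f) (v : V)
    (hv : {v} ∈ K.faces) (w : W) (hw : {w} ∈ L.faces) (h : f v = w) :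
    realize f hf (vertexPoint K v hv) = vertexPoint L w hw := by
  apply Subtype.ext
  subst h
  exact Finsupp.mapDomain_single

/-! ### The homotopy categories of spaces and of pointed spaces -/

/-- Homotopy of continuous maps. -/
def homotopyRel : HomRel TopCat.{u} := fun _ _ f g => f.hom.Homotopic g.hom

instance : Congruence homotopyRel.{u} where
  equivalence := ⟨fun f => .refl f.hom, fun h => h.symm, fun h h' => h.trans h'⟩
  comp_left f _ _ h := h.comp (.refl f.hom)
  comp_right g h := ContinuousMap.Homotopic.comp (.refl g.hom) h

/-- `HTop`: topological spaces and homotopy classes of continuous maps. -/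
abbrev HTop : Type (u + 1) := CategoryTheory.Quotient homotopyRel.{u}

/-- A topological space, as an object of `HTop`. -/
abbrev HTop.of (X : Type u) [TopologicalSpace X] : HTop.{u} :=
  (CategoryTheory.Quotient.functor homotopyRel).obj (TopCat.of X)

/-- The homotopy class of a continuous map. -/
abbrev HTop.ofMap {X Y : Type u} [TopologicalSpace X] [TopologicalSpace Y] (f : C(X, Y)) :
    HTop.of X ⟶ HTop.of Y :=
  (CategoryTheory.Quotient.functor homotopyRel).map (TopCat.ofHom f)

/-- Pointed topological spaces. -/
structure PTop : Type (u + 1) where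
  carrier : Type u
  [top : TopologicalSpace carrier]
  pt : carrier

attribute [instance] PTop.top

/-- Pointed topological spaces and continuous maps preserving the base points. -/
instance : Category PTop.{u} where
  Hom X Y := {f : C(X.carrier, Y.carrier) // f X.pt = Y.pt}
  id X := ⟨.id _, rfl⟩
  comp f g := ⟨g.1.comp f.1, by simp [f.2, g.2]⟩

/-- Homotopy of pointed maps, relative to the base point. -/
def pointedHomotopyRel : HomRel PTop.{u} := fun X _ f g => f.1.HomotopicRel g.1 {X.pt}

lemma HomotopicRel.comp_right {X Y Z : Type*} [TopologicalSpace X] [TopologicalSpace Y]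
    [TopologicalSpace Z] {S : Set Y} {g g' : C(Y, Z)} (h : g.HomotopicRel g' S) (f : C(X, Y))
    {T : Set X} (hT : Set.MapsTo f T S) : (g.comp f).HomotopicRel (g'.comp f) T := by
  obtain ⟨H⟩ := h
  exact ⟨⟨⟨H.toContinuousMap.comp (ContinuousMap.prodMap (.id _) f),
    fun x => H.apply_zero (f x), fun x => H.apply_one (f x)⟩,
    fun t x hx => H.prop' t (f x) (hT hx)⟩⟩

instance : Congruence pointedHomotopyRel.{u} where
  equivalence := ⟨fun f => .refl f.1, fun h => ContinuousMap.HomotopicRel.symm h,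
    fun h h' => ContinuousMap.HomotopicRel.trans h h'⟩
  comp_left f _ _ h := HomotopicRel.comp_right h f.1 (by rintro x rfl; exact f.2)
  comp_right g h := ContinuousMap.HomotopicRel.comp_continuousMap h g.1

/-- `HTop_*`: pointed spaces and pointed homotopy classes of pointed maps. -/
abbrev HPTop : Type (u + 1) := CategoryTheory.Quotient pointedHomotopyRel.{u}

/-- A pointed space `(X, x)`, as an object of `HTop_*`. -/
abbrev HPTop.of (X : Type u) [TopologicalSpace X] (x : X) : HPTop.{u} :=
  (CategoryTheory.Quotient.functor pointedHomotopyRel).obj ⟨X, x⟩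

/-- The pointed homotopy class of a pointed map. -/
abbrev HPTop.ofMap {X Y : Type u} [TopologicalSpace X] [TopologicalSpace Y] {x : X} {y : Y}
    (f : C(X, Y)) (hf : f x = y) : HPTop.of X x ⟶ HPTop.of Y y :=
  (CategoryTheory.Quotient.functor pointedHomotopyRel).map
    (X := PTop.mk X x) (Y := PTop.mk Y y) ⟨f, hf⟩

/-- `HPol`: the objects of `HTop` with the homotopy type of a polyhedron. -/
def HPol : ObjectProperty HTop.{u} := fun Y =>
  ∃ (V : Type u) (K : PreAbstractSimplicialComplex V), Nonempty (Y ≅ HTop.of (Realization K))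

/-- `HPol_*`: the objects of `HTop_*` with the pointed homotopy type of a polyhedron based at a
vertex. -/
def HPPol : ObjectProperty HPTop.{u} := fun Y =>
  ∃ (V : Type u) (K : PreAbstractSimplicialComplex V) (v : V) (hv : {v} ∈ K.faces),
    Nonempty (Y ≅ HPTop.of (Realization K) (vertexPoint K v hv))

/-! ### The homology and homotopy functors -/

/-- Singular `p`-th homology with coefficients in the abelian group `G`, on `HTop`. -/
def homologyFunctor (G : AddCommGrpCat.{u}) (p : ℕ) : HTop.{u} ⥤ AddCommGrpCat.{u} :=
  CategoryTheory.Quotient.lift homotopyRel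
    ((AlgebraicTopology.singularHomologyFunctor AddCommGrpCat.{u} p).obj G)
    (fun _ _ _ _ h =>
      TopCat.Homotopy.congr_homologyMap_singularChainComplexFunctor (Classical.choice h) G p)

/-- Composition of a generalized loop with a pointed map. -/
def genLoopMap {N : Type} {X Y : Type u} [TopologicalSpace X] [TopologicalSpace Y] {x : X} {y : Y}
    (f : C(X, Y)) (hf : f x = y) (γ : GenLoop N X x) : GenLoop N Y y :=
  ⟨f.comp γ.1, fun t ht => by
    rw [ContinuousMap.comp_apply, γ.2 t ht, hf]⟩

/-- The homomorphism `π_{p+1}(X, x) → π_{p+1}(Y, y)` induced by a pointed map. -/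
def homotopyGroupMap (p : ℕ) {X Y : Type u} [TopologicalSpace X] [TopologicalSpace Y] {x : X}
    {y : Y} (f : C(X, Y)) (hf : f x = y) :
    HomotopyGroup.Pi (p + 1) X x →* HomotopyGroup.Pi (p + 1) Y y :=
  MonoidHom.mk' (Quotient.map' (genLoopMap f hf)
    (fun _ _ h => ContinuousMap.HomotopicRel.comp_continuousMap h f)) (by
      intro a b
      refine Quotient.inductionOn₂ a b fun γ δ => ?_
      have h₁ := HomotopyGroup.mul_spec (i := (0 : Fin (p + 1))) (p := γ) (q := δ)
      have h₂ := HomotopyGroup.mul_spec (i := (0 : Fin (p + 1))) (p := genLoopMap f hf γ)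
        (q := genLoopMap f hf δ)
      refine (congrArg _ h₁).trans (Eq.trans ?_ h₂.symm)
      refine congrArg (Quotient.mk _) ?_
      ext t
      simp only [genLoopMap, GenLoop.transAt, GenLoop.copy, GenLoop.mk_apply,
        ContinuousMap.comp_apply, ContinuousMap.coe_mk]
      split_ifs <;> rfl)

/-- The homotopy group functor `π_{p+1}` on `HTop_*`. -/
def homotopyFunctor (p : ℕ) : HPTop.{u} ⥤ GrpCat.{u} :=
  CategoryTheory.Quotient.lift pointedHomotopyRel
    { obj := fun X => GrpCat.of (HomotopyGroup.Pi (p + 1) X.carrier X.pt)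
      map := fun f => GrpCat.ofHom (homotopyGroupMap p f.1 f.2)
      map_id := fun X => by
        ext a
        refine Quotient.inductionOn a fun γ => ?_
        rfl
      map_comp := fun f g => by
        ext a
        refine Quotient.inductionOn a fun γ => ?_
        rfl }
    (fun X Y f g h => by
      ext a
      refine Quotient.inductionOn a fun γ => ?_
      exact Quotient.sound (HomotopicRel.comp_right h γ.1 (fun t ht => γ.2 t ht)))

/-! ### Expansions, Čech homology groups and shape groups -/

/-- A `P`-expansion of an object `X` of the category `T`: a morphism `X → (X_l)` in pro-`T` to an
inverse system in `P` over a directed set, such that for every object `Q` of `P` the induced map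
`colim_l T(X_l, Q) → T(X, Q)` is surjective (`factor`) and injective (`unique`). -/
structure Expansion {T : Type v} [Category.{w} T] (P : ObjectProperty T) (X : T) where
  Idx : Type u
  [preorder : Preorder Idx]
  [directed : IsDirectedOrder Idx]
  [nonempty : Nonempty Idx]
  sys : Idxᵒᵖ ⥤ T
  proj : (Functor.const Idxᵒᵖ).obj X ⟶ sys
  sys_mem : ∀ l : Idx, P (sys.obj (.op l))
  factor : ∀ Q : T, P Q → ∀ h : X ⟶ Q,
    ∃ (l : Idx) (f : sys.obj (.op l) ⟶ Q), proj.app (.op l) ≫ f = h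
  unique : ∀ Q : T, P Q → ∀ (l : Idx) (f f' : sys.obj (.op l) ⟶ Q),
    proj.app (.op l) ≫ f = proj.app (.op l) ≫ f' →
      ∃ (l' : Idx) (hl : l ≤ l'), sys.map (homOfLE hl).op ≫ f = sys.map (homOfLE hl).op ≫ f'

attribute [instance] Expansion.preorder Expansion.directed Expansion.nonempty

/-- `L` is the `p`-th Čech homology group of `X` with coefficients in `G`: HPol-expansions of `X`
exist, and for each of them `L` is the inverse limit of the induced homology pro-group. -/
def IsCechHomologyGroup (X : Type u) [TopologicalSpace X] (G : AddCommGrpCat.{u}) (p : ℕ)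
    (L : AddCommGrpCat.{u}) : Prop :=
  Nonempty (Expansion.{u} HPol.{u} (HTop.of X)) ∧
    ∀ E : Expansion.{u} HPol.{u} (HTop.of X), Nonempty (L ≅ limit (E.sys ⋙ homologyFunctor G p))

/-- `L` is the `(p+1)`-st shape group of `(X, x)`: HPol_*-expansions of `(X, x)` exist, and for each
of them `L` is the inverse limit of the induced homotopy pro-group. -/
def IsShapeGroup (X : Type u) [TopologicalSpace X] (x : X) (p : ℕ) (L : GrpCat.{u}) : Prop :=
  Nonempty (Expansion.{u} HPPol.{u} (HPTop.of X x)) ∧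
    ∀ E : Expansion.{u} HPPol.{u} (HPTop.of X x), Nonempty (L ≅ limit (E.sys ⋙ homotopyFunctor p))

/-! ### Adjusted approximative sequences -/

/-- An adjusted approximative sequence of a (compact) metric space `X`. -/
structure AdjustedSequence (X : Type u) [MetricSpace X] where
  ε : ℕ → ℝ
  A : ℕ → Finset X
  pos : ∀ n, 0 < ε n
  anti : Antitone ε
  tendsto_zero : Filter.Tendsto ε Filter.atTop (𝓝 0)
  approx : ∀ n x, ∃ a ∈ A n, dist x a < ε n
  adjusted : ∀ n, ε (n + 1) < (ε n - ⨆ x : X, Metric.infDist x (A n : Set X)) / 2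

namespace AdjustedSequence

variable {X : Type u} [MetricSpace X] (S : AdjustedSequence X)

/-- `γ_n = sup {d(x, A_n) : x ∈ X}`. -/
def γ (n : ℕ) : ℝ := ⨆ x : X, Metric.infDist x (S.A n : Set X)

open Classical in
/-- `q_{A_n}(x)`, the set of points of `A_n` nearest to `x`. -/
def nearest (n : ℕ) (x : X) : Finset X :=
  (S.A n).filter fun a => Metric.infDist x (S.A n : Set X) = dist x a

open Classical in
/-- `p_{n,n+1}(C) = q_{A_n}(C)`, the union of the `q_{A_n}(c)` over `c ∈ C`. -/
def push (n : ℕ) (C : Finset X) : Finset X :=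
  (S.A n).filter fun b => ∃ c ∈ C, b ∈ S.nearest n c

/-- The elements of `U_{2ε_n}(A_n)`: the nonempty subsets of `A_n` of diameter less than `2ε_n`. -/
def IsSmall (n : ℕ) (C : Finset X) : Prop :=
  C.Nonempty ∧ C ⊆ S.A n ∧ Metric.diam (C : Set X) < 2 * S.ε n

/-- The members of the covering `B_n` of `X` by the open balls of radius `ε_n` centred in `A_n`. -/
def IsBall (n : ℕ) (U : Set X) : Prop := ∃ a ∈ S.A n, U = Metric.ball a (S.ε n)

lemma infDist_le_γ (n : ℕ) (x : X) : Metric.infDist x (S.A n : Set X) ≤ S.γ n := by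
  refine le_ciSup (f := fun x : X => Metric.infDist x (S.A n : Set X)) ⟨S.ε n, ?_⟩ x
  rintro _ ⟨y, rfl⟩
  obtain ⟨a, ha, h⟩ := S.approx n y
  exact (Metric.infDist_le_dist_of_mem (Finset.mem_coe.2 ha)).trans h.le

lemma γ_nonneg (n : ℕ) : 0 ≤ S.γ n := Real.iSup_nonneg fun _ => Metric.infDist_nonneg

lemma adjusted' (n : ℕ) : 2 * S.ε (n + 1) + S.γ n < S.ε n := by
  have := S.adjusted n
  change _ < (S.ε n - S.γ n) / 2 at this
  linarith

lemma nearest_subset (n : ℕ) (x : X) : S.nearest n x ⊆ S.A n := Finset.filter_subset _ _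

lemma dist_le_of_mem_nearest {n : ℕ} {x b : X} (h : b ∈ S.nearest n x) : dist x b ≤ S.γ n := by
  rw [← (Finset.mem_filter.1 h).2]
  exact S.infDist_le_γ n x

lemma nearest_nonempty (n : ℕ) (x : X) : (S.nearest n x).Nonempty := by
  obtain ⟨a, ha, -⟩ := S.approx n x
  obtain ⟨b, hb, h⟩ := (S.A n).finite_toSet.isCompact.exists_infDist_eq_dist ⟨a, ha⟩ x
  exact ⟨b, Finset.mem_filter.2 ⟨hb, h⟩⟩

lemma push_subset (n : ℕ) (C : Finset X) : S.push n C ⊆ S.A n := by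
  classical exact Finset.filter_subset _ _

lemma mem_push {n : ℕ} {C : Finset X} {b : X} :
    b ∈ S.push n C ↔ ∃ c ∈ C, b ∈ S.nearest n c := by
  simp only [push, Finset.mem_filter, and_iff_right_iff_imp]
  rintro ⟨c, -, hb⟩
  exact S.nearest_subset n c hb

lemma push_mono (n : ℕ) {C D : Finset X} (h : C ⊆ D) : S.push n C ⊆ S.push n D := fun b hb => by
  obtain ⟨c, hc, hb⟩ := S.mem_push.1 hb
  exact S.mem_push.2 ⟨c, h hc, hb⟩

lemma isSmall_push {n : ℕ} {C : Finset X} (h : S.IsSmall (n + 1) C) : S.IsSmall n (S.push n C) := by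
  obtain ⟨⟨c, hc⟩, -, hd⟩ := h
  refine ⟨?_, S.push_subset n C, ?_⟩
  · obtain ⟨b, hb⟩ := S.nearest_nonempty n c
    exact ⟨b, S.mem_push.2 ⟨c, hc, hb⟩⟩
  · have h1 := S.adjusted' n
    have h2 := S.γ_nonneg n
    have h3 := S.pos (n + 1)
    refine lt_of_le_of_lt (b := 2 * S.γ n + 2 * S.ε (n + 1)) ?_ (by linarith)
    refine Metric.diam_le_of_forall_dist_le (by linarith) fun b hb b' hb' => ?_
    obtain ⟨c, hc, hb⟩ := S.mem_push.1 hb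
    obtain ⟨c', hc', hb'⟩ := S.mem_push.1 hb'
    have e1 := S.dist_le_of_mem_nearest hb
    have e2 := S.dist_le_of_mem_nearest hb'
    have e3 := Metric.dist_le_diam_of_mem C.finite_toSet.isBounded (Finset.mem_coe.2 hc)
      (Finset.mem_coe.2 hc')
    have e4 := dist_triangle4 b c c' b'
    rw [dist_comm b c] at e4
    linarith

end AdjustedSequence

/-! ### Polyhedral approximative sequences -/

/-- The kinds of inverse sequences of polyhedra attached to an adjusted approximative sequence. -/
inductive PASKind
  | alexandroffMcCord
  | finiteRips
  | vietoris
  | cech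
  | cechRefinement
  | witness
  | upperDowker
  | lowerDowker

/-- The type in which the vertices live: finite subsets of `X`, points of `X`, or subsets of `X`. -/
def PASKind.Vertex (X : Type u) : PASKind → Type u
  | .alexandroffMcCord => Finset X
  | .finiteRips => X
  | .vietoris => X
  | .cech => Set X
  | .cechRefinement => Set X
  | .witness => X
  | .upperDowker => Finset X
  | .lowerDowker => Finset X

section complexes

variable {X : Type u} [MetricSpace X] (S : AdjustedSequence X)

/-- `𝒦(U_{2ε_n}(A_n))`: the chains of `U_{2ε_n}(A_n)`, ordered by inclusion. -/
def mcCordComplex (n : ℕ) : PreAbstractSimplicialComplex (Finset X) where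
  faces := {s | s.Nonempty ∧ (∀ C ∈ s, S.IsSmall n C) ∧ ∀ C ∈ s, ∀ D ∈ s, C ⊆ D ∨ D ⊆ C}
  isRelLowerSet_faces := fun _ h => ⟨h.1, fun _ hts ht =>
    ⟨ht, fun C hC => h.2.1 C (hts hC), fun C hC D hD => h.2.2 C (hts hC) D (hts hD)⟩⟩

/-- The Vietoris–Rips complex `R_{2ε_n}(A_n)`. -/
def finiteRipsComplex (n : ℕ) : PreAbstractSimplicialComplex X where
  faces := {s | s.Nonempty ∧ s ⊆ S.A n ∧ Metric.diam (s : Set X) < 2 * S.ε n}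
  isRelLowerSet_faces := fun s h => ⟨h.1, fun _ hts ht =>
    ⟨ht, subset_trans hts h.2.1, lt_of_le_of_lt
      (Metric.diam_mono (Finset.coe_subset.2 hts) s.finite_toSet.isBounded) h.2.2⟩⟩

/-- The Vietoris–Rips complex `R_{2ε_n}(X)`. -/
def vietorisComplex (n : ℕ) : PreAbstractSimplicialComplex X where
  faces := {s | s.Nonempty ∧ Metric.diam (s : Set X) < 2 * S.ε n}
  isRelLowerSet_faces := fun s h => ⟨h.1, fun _ hts ht =>
    ⟨ht, lt_of_le_of_lt
      (Metric.diam_mono (Finset.coe_subset.2 hts) s.finite_toSet.isBounded) h.2⟩⟩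

/-- The nerve `N(B_n)` of the covering `B_n`. -/
def cechComplex (n : ℕ) : PreAbstractSimplicialComplex (Set X) where
  faces := {s | s.Nonempty ∧ (∀ U ∈ s, S.IsBall n U) ∧ ∃ x : X, ∀ U ∈ s, x ∈ U}
  isRelLowerSet_faces := fun _ h => ⟨h.1, fun _ hts ht =>
    ⟨ht, fun U hU => h.2.1 U (hts hU), h.2.2.imp fun _ hx U hU => hx U (hts hU)⟩⟩

/-- The witness complex `W_n`. -/
def witnessComplex (n : ℕ) : PreAbstractSimplicialComplex X where
  faces := {s | s.Nonempty ∧ s ⊆ S.A n ∧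
    ∀ t ⊆ s, t.Nonempty → ∃ x : X, ∑ a ∈ t, dist x a < t.card * S.ε n}
  isRelLowerSet_faces := fun _ h => ⟨h.1, fun _ hts ht =>
    ⟨ht, subset_trans hts h.2.1, fun r hr hne => h.2.2 r (subset_trans hr hts) hne⟩⟩

/-- The complex `K^{X_n}` of the relation `C ⊆ D` on `X_n = U_{2ε_n}(A_n)`. -/
def upperDowkerComplex (n : ℕ) : PreAbstractSimplicialComplex (Finset X) where
  faces := {s | s.Nonempty ∧ (∀ C ∈ s, S.IsSmall n C) ∧ ∃ D, S.IsSmall n D ∧ ∀ C ∈ s, C ⊆ D}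
  isRelLowerSet_faces := fun _ h => ⟨h.1, fun _ hts ht =>
    ⟨ht, fun C hC => h.2.1 C (hts hC), h.2.2.imp fun _ hD => ⟨hD.1, fun C hC => hD.2 C (hts hC)⟩⟩⟩

/-- The complex `L^{X_n}` of the relation `C ⊆ D` on `X_n = U_{2ε_n}(A_n)`. -/
def lowerDowkerComplex (n : ℕ) : PreAbstractSimplicialComplex (Finset X) where
  faces := {s | s.Nonempty ∧ (∀ D ∈ s, S.IsSmall n D) ∧ ∃ C, S.IsSmall n C ∧ ∀ D ∈ s, C ⊆ D}
  isRelLowerSet_faces := fun _ h => ⟨h.1, fun _ hts ht =>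
    ⟨ht, fun C hC => h.2.1 C (hts hC), h.2.2.imp fun _ hD => ⟨hD.1, fun C hC => hD.2 C (hts hC)⟩⟩⟩

/-- The `n`-th simplicial complex of the sequence of the given kind. -/
def pasComplex : (k : PASKind) → ℕ → PreAbstractSimplicialComplex (k.Vertex X)
  | .alexandroffMcCord, n => mcCordComplex S n
  | .finiteRips, n => finiteRipsComplex (X := X) S n
  | .vietoris, n => vietorisComplex (X := X) S n
  | .cech, n => cechComplex S n
  | .cechRefinement, n => cechComplex S n
  | .witness, n => witnessComplex (X := X) S n
  | .upperDowker, n => upperDowkerComplex S n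
  | .lowerDowker, n => lowerDowkerComplex S n

/-- `AdmissibleImage S k n v w`: the vertex `w` of the `n`-th complex is an admissible image of the
vertex `v` of the `(n+1)`-st complex under the bonding map. -/
def AdmissibleImage : (k : PASKind) → ℕ → k.Vertex X → k.Vertex X → Prop
  | .alexandroffMcCord, n, (C : Finset X), (D : Finset X) => D = S.push n C
  | .finiteRips, n, (a : X), (b : X) => b ∈ S.nearest n a
  | .vietoris, _, (x : X), (y : X) => y = x
  | .cech, n, (U : Set X), (W : Set X) => ∃ a ∈ S.A (n + 1), ∃ b ∈ S.nearest n a,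
      U = Metric.ball a (S.ε (n + 1)) ∧ W = Metric.ball b (S.ε n)
  | .cechRefinement, n, (U : Set X), (W : Set X) => S.IsBall n W ∧ U ⊆ W
  | .witness, n, (a : X), (b : X) => b ∈ S.nearest n a
  | .upperDowker, n, (C : Finset X), (D : Finset X) => D = S.push n C
  | .lowerDowker, n, (C : Finset X), (D : Finset X) => D = S.push n C

/-- The vertex `v` of the `n`-th complex is near the point `x` of `X`. -/
def IsNear : (k : PASKind) → ℕ → k.Vertex X → X → Prop
  | .alexandroffMcCord, n, (C : Finset X), x => ∀ c ∈ C, dist x c < S.ε n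
  | .finiteRips, n, (a : X), x => dist (α := X) x a < S.ε n
  | .vietoris, n, (a : X), x => dist (α := X) x a < S.ε n
  | .cech, _, (U : Set X), x => x ∈ U
  | .cechRefinement, _, (U : Set X), x => x ∈ U
  | .witness, n, (a : X), x => dist (α := X) x a < S.ε n
  | .upperDowker, n, (C : Finset X), x => ∀ c ∈ C, dist x c < S.ε n
  | .lowerDowker, n, (C : Finset X), x => ∀ c ∈ C, dist x c < S.ε n

lemma ball_subset_ball_of_mem_nearest {n : ℕ} {a b : X} (h : b ∈ S.nearest n a) :
    Metric.ball a (S.ε (n + 1)) ⊆ Metric.ball b (S.ε n) := by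
  refine Metric.ball_subset_ball' ?_
  have := S.dist_le_of_mem_nearest h
  have := S.adjusted' n
  have := S.pos (n + 1)
  linarith

section

variable {n : ℕ}

lemma mcCord_image {s t : Finset (Finset X)} {f : Finset X → Finset X}
    (ht : ∀ w, w ∈ t ↔ ∃ v ∈ s, f v = w) (hne : t.Nonempty)
    (hs : s ∈ (mcCordComplex S (n + 1)).faces) (hadm : ∀ v ∈ s, f v = S.push n v) :
    t ∈ (mcCordComplex S n).faces := by
  obtain ⟨-, hsm, hch⟩ := hs
  refine ⟨hne, ?_, ?_⟩
  · intro D hD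
    obtain ⟨C, hC, rfl⟩ := (ht D).1 hD
    rw [hadm C hC]
    exact S.isSmall_push (hsm C hC)
  · intro D hD D' hD'
    obtain ⟨C, hC, rfl⟩ := (ht D).1 hD
    obtain ⟨C', hC', rfl⟩ := (ht D').1 hD'
    rw [hadm C hC, hadm C' hC']
    exact (hch C hC C' hC').imp (S.push_mono n) (S.push_mono n)

lemma finiteRips_image {s t : Finset X} {f : X → X}
    (ht : ∀ w, w ∈ t ↔ ∃ v ∈ s, f v = w) (hne : t.Nonempty)
    (hs : s ∈ (finiteRipsComplex S (n + 1)).faces) (hadm : ∀ v ∈ s, f v ∈ S.nearest n v) :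
    t ∈ (finiteRipsComplex S n).faces := by
  have h1 := S.adjusted' n
  have h2 := S.γ_nonneg n
  have h3 := S.pos (n + 1)
  obtain ⟨-, -, hd⟩ := hs
  refine ⟨hne, ?_, ?_⟩
  · intro b hb
    obtain ⟨a, ha, rfl⟩ := (ht b).1 hb
    exact S.nearest_subset n a (hadm a ha)
  · refine lt_of_le_of_lt (b := 2 * S.γ n + 2 * S.ε (n + 1)) ?_ (by linarith)
    refine Metric.diam_le_of_forall_dist_le (by linarith) fun b hb b' hb' => ?_
    obtain ⟨c, hc, rfl⟩ := (ht b).1 hb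
    obtain ⟨c', hc', rfl⟩ := (ht b').1 hb'
    have e1 := S.dist_le_of_mem_nearest (hadm c hc)
    have e2 := S.dist_le_of_mem_nearest (hadm c' hc')
    have e3 := Metric.dist_le_diam_of_mem s.finite_toSet.isBounded (Finset.mem_coe.2 hc)
      (Finset.mem_coe.2 hc')
    have e4 := dist_triangle4 (f c) c c' (f c')
    rw [dist_comm (f c) c] at e4
    linarith

lemma vietoris_image {s t : Finset X} {f : X → X}
    (ht : ∀ w, w ∈ t ↔ ∃ v ∈ s, f v = w) (hne : t.Nonempty)
    (hs : s ∈ (vietorisComplex S (n + 1)).faces) (hadm : ∀ v ∈ s, f v = v) :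
    t ∈ (vietorisComplex S n).faces := by
  have h1 := S.adjusted' n
  have h2 := S.γ_nonneg n
  have h3 := S.pos (n + 1)
  obtain ⟨-, hd⟩ := hs
  have hst : t = s := by
    ext w
    rw [ht]
    exact ⟨fun ⟨v, hv, h⟩ => by rwa [← h, hadm v hv], fun hw => ⟨w, hw, hadm w hw⟩⟩
  rw [hst] at hne ⊢
  exact ⟨hne, hd.trans_le (by linarith)⟩

lemma cech_image {s t : Finset (Set X)} {f : Set X → Set X}
    (ht : ∀ w, w ∈ t ↔ ∃ v ∈ s, f v = w) (hne : t.Nonempty)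
    (hs : s ∈ (cechComplex S (n + 1)).faces) (hadm : ∀ U ∈ s, S.IsBall n (f U) ∧ U ⊆ f U) :
    t ∈ (cechComplex S n).faces := by
  obtain ⟨-, -, x, hx⟩ := hs
  refine ⟨hne, ?_, x, ?_⟩
  · intro W hW
    obtain ⟨U, hU, rfl⟩ := (ht W).1 hW
    exact (hadm U hU).1
  · intro W hW
    obtain ⟨U, hU, rfl⟩ := (ht W).1 hW
    exact (hadm U hU).2 (hx U hU)

lemma witness_image {s t : Finset X} {f : X → X}
    (ht : ∀ w, w ∈ t ↔ ∃ v ∈ s, f v = w) (hne : t.Nonempty)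
    (hs : s ∈ (witnessComplex S (n + 1)).faces) (hadm : ∀ v ∈ s, f v ∈ S.nearest n v) :
    t ∈ (witnessComplex S n).faces := by
  classical
  have h1 := S.adjusted' n
  have h3 := S.pos (n + 1)
  obtain ⟨-, -, hw⟩ := hs
  refine ⟨hne, ?_, ?_⟩
  · intro b hb
    obtain ⟨a, ha, rfl⟩ := (ht b).1 hb
    exact S.nearest_subset n a (hadm a ha)
  · intro t' ht' htne
    have hch : ∀ w, ∃ v, w ∈ t' → v ∈ s ∧ f v = w := fun w => by
      by_cases h : w ∈ t'
      · obtain ⟨v, hv⟩ := (ht w).1 (ht' h)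
        exact ⟨v, fun _ => hv⟩
      · exact ⟨w, fun h' => absurd h' h⟩
    choose g hg using hch
    have hinj : Set.InjOn g t' := fun a ha b hb hab => by
      rw [← (hg a ha).2, hab, (hg b hb).2]
    obtain ⟨x, hx⟩ := hw (t'.image g) (by
      intro v hv
      obtain ⟨w, hw, rfl⟩ := Finset.mem_image.1 hv
      exact (hg w hw).1) (htne.image g)
    refine ⟨x, ?_⟩
    rw [Finset.sum_image hinj, Finset.card_image_of_injOn hinj] at hx
    have hcard : (0 : ℝ) ≤ t'.card := Nat.cast_nonneg _
    calc ∑ b ∈ t', dist x b ≤ ∑ b ∈ t', (dist x (g b) + S.γ n) := by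
          refine Finset.sum_le_sum fun b hb => ?_
          have h := S.dist_le_of_mem_nearest (hadm _ (hg b hb).1)
          rw [(hg b hb).2] at h
          exact (dist_triangle x (g b) b).trans (add_le_add le_rfl h)
      _ = ∑ b ∈ t', dist x (g b) + t'.card * S.γ n := by
          rw [Finset.sum_add_distrib, Finset.sum_const, nsmul_eq_mul]
      _ < t'.card * S.ε (n + 1) + t'.card * S.γ n := by linarith
      _ ≤ t'.card * S.ε n := by
          rw [← mul_add]
          exact mul_le_mul_of_nonneg_left (by linarith) hcard

lemma upperDowker_image {s t : Finset (Finset X)} {f : Finset X → Finset X}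
    (ht : ∀ w, w ∈ t ↔ ∃ v ∈ s, f v = w) (hne : t.Nonempty)
    (hs : s ∈ (upperDowkerComplex S (n + 1)).faces) (hadm : ∀ v ∈ s, f v = S.push n v) :
    t ∈ (upperDowkerComplex S n).faces := by
  obtain ⟨-, hsm, D, hD, hCD⟩ := hs
  refine ⟨hne, ?_, S.push n D, S.isSmall_push hD, ?_⟩
  · intro W hW
    obtain ⟨C, hC, rfl⟩ := (ht W).1 hW
    rw [hadm C hC]
    exact S.isSmall_push (hsm C hC)
  · intro W hW
    obtain ⟨C, hC, rfl⟩ := (ht W).1 hW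
    rw [hadm C hC]
    exact S.push_mono n (hCD C hC)

lemma lowerDowker_image {s t : Finset (Finset X)} {f : Finset X → Finset X}
    (ht : ∀ w, w ∈ t ↔ ∃ v ∈ s, f v = w) (hne : t.Nonempty)
    (hs : s ∈ (lowerDowkerComplex S (n + 1)).faces) (hadm : ∀ v ∈ s, f v = S.push n v) :
    t ∈ (lowerDowkerComplex S n).faces := by
  obtain ⟨-, hsm, C, hC, hCD⟩ := hs
  refine ⟨hne, ?_, S.push n C, S.isSmall_push hC, ?_⟩
  · intro W hW
    obtain ⟨D, hD, rfl⟩ := (ht W).1 hW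
    rw [hadm D hD]
    exact S.isSmall_push (hsm D hD)
  · intro W hW
    obtain ⟨D, hD, rfl⟩ := (ht W).1 hW
    rw [hadm D hD]
    exact S.push_mono n (hCD D hD)

end

/-- Every admissible choice of images of the vertices is a simplicial map. -/
lemma isSimplicial_of_admissible (k : PASKind) (n : ℕ) (f : k.Vertex X → k.Vertex X)
    (hf : ∀ v, {v} ∈ (pasComplex S k (n + 1)).faces → AdmissibleImage S k n v (f v)) :
    IsSimplicial (pasComplex S k (n + 1)) (pasComplex S k n) f := by
  intro s hs
  have hadm : ∀ v ∈ s, AdmissibleImage S k n v (f v) := fun v hv => hf v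
    (((pasComplex S k (n + 1)).isRelLowerSet_faces hs).2 (Finset.singleton_subset_iff.2 hv)
      (Finset.singleton_nonempty v))
  obtain ⟨t, ht⟩ : ∃ t : Finset (k.Vertex X), ∀ w, w ∈ t ↔ ∃ v ∈ s, f v = w := by
    classical
    exact ⟨s.image f, fun w => Finset.mem_image⟩
  have hne : t.Nonempty := by
    obtain ⟨v, hv⟩ := ((pasComplex S k (n + 1)).isRelLowerSet_faces hs).1
    exact ⟨f v, (ht _).2 ⟨v, hv, rfl⟩⟩
  refine ⟨t, ?_, by ext w; simp [ht]⟩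
  cases k with
  | alexandroffMcCord => exact mcCord_image S ht hne hs hadm
  | finiteRips => exact @finiteRips_image X _ S n s t f ht hne hs hadm
  | vietoris => exact @vietoris_image X _ S n s t f ht hne hs hadm
  | cech =>
    refine cech_image S ht hne hs fun U hU => ?_
    obtain ⟨a, -, b, hb, hUa, hW⟩ := hadm U hU
    rw [hW]
    refine ⟨⟨b, S.nearest_subset n a hb, rfl⟩, ?_⟩
    rw [hUa]
    exact ball_subset_ball_of_mem_nearest S hb
  | cechRefinement => exact cech_image S ht hne hs hadm
  | witness => exact @witness_image X _ S n s t f ht hne hs hadm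
  | upperDowker => exact upperDowker_image S ht hne hs hadm
  | lowerDowker => exact lowerDowker_image S ht hne hs hadm

end complexes

/-- A polyhedral approximative sequence of `X`: an adjusted approximative sequence, one of the kinds
of sequences, and admissible choices of the images of the vertices under the bonding maps. -/
structure PAS (X : Type u) [MetricSpace X] where
  seq : AdjustedSequence X
  kind : PASKind
  vmap : ℕ → kind.Vertex X → kind.Vertex X
  vmap_admissible : ∀ n v, {v} ∈ (pasComplex seq kind (n + 1)).faces →
    AdmissibleImage seq kind n v (vmap n v)

namespace PAS

variable {X : Type u} [MetricSpace X] (K : PAS X)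

/-- The `n`-th simplicial complex. -/
def complex (n : ℕ) : PreAbstractSimplicialComplex (K.kind.Vertex X) := pasComplex K.seq K.kind n

lemma isSimplicial_vmap (n : ℕ) : IsSimplicial (K.complex (n + 1)) (K.complex n) (K.vmap n) :=
  isSimplicial_of_admissible K.seq K.kind n (K.vmap n) (K.vmap_admissible n)

/-- The bonding map `|K_{n+1}| → |K_n|`. -/
def bond (n : ℕ) : C(Realization (K.complex (n + 1)), Realization (K.complex n)) :=
  realize (K.vmap n) (K.isSimplicial_vmap n)

/-- The inverse sequence `{|K_n|, p_{n,n+1}}` in `HTop`. -/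
def system : ℕᵒᵖ ⥤ HTop.{u} :=
  Functor.ofOpSequence (X := fun n => HTop.of (Realization (K.complex n)))
    fun n => HTop.ofMap (K.bond n)

/-- Base vertices of the complexes, compatible with the bonding maps and near (hence converging to)
the base point `x` of `X`. -/
structure BaseThread (x : X) where
  vert : ℕ → K.kind.Vertex X
  mem : ∀ n, {vert n} ∈ (K.complex n).faces
  compat : ∀ n, K.vmap n (vert (n + 1)) = vert n
  near : ∀ n, IsNear K.seq K.kind n (vert n) x

/-- The inverse sequence of pointed polyhedra in `HTop_*` given by base vertices. -/
def pointedSystem {x : X} (b : K.BaseThread x) : ℕᵒᵖ ⥤ HPTop.{u} :=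
  Functor.ofOpSequence
    (X := fun n => HPTop.of (Realization (K.complex n))
      (vertexPoint (K.complex n) (b.vert n) (b.mem n)))
    fun n => HPTop.ofMap (K.bond n)
      (realize_vertexPoint (K.vmap n) (K.isSimplicial_vmap n) _ _ _ (b.mem n) (b.compat n))

end PAS

end

end ShapeTheory

/-! The Vietoris–Rips complexes of `X` at all scales `r > 0`, with their inclusions, form an
expansion of `X`, and every polyhedral approximative sequence is interleaved with this system up to
homotopy, hence is itself an expansion. An expansion is an initial functor into the category of
arrows from `X` to objects of `P` (`IsExpansion.initial_toStructuredArrow`), so the limit of a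
functor along it does not depend on the expansion. This settles the homology and the homotopy groups
at once, for every expansion.

That the Rips complexes form an expansion is simplicial approximation. For `h : X → |L|`, a Lebesgue
number of the pulled back open stars gives a vertex map `φ` such that `φ w` is a vertex of the
carrier of `h z` whenever `z` is near `w` (`IsApprox`). Such a `φ` is simplicial on a Rips complex,
and its composite with a partition of unity is contiguous to `h`; this gives factorization. For
uniqueness, a map on a Rips complex becomes homotopic to such a `φ` at a smaller scale
(`exists_isApprox_of_ripsComplex`), and a homotopy on `X` is approximated by a chain of contiguous
vertex maps (`exists_isApprox_of_homotopy`).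

For the interleaving, `β` maps points to nearby vertices of `K_n` and `α` maps vertices to nearby
points. The inequality `2 ε_{n+1} + γ_n < ε_n` makes the displacements of the bonding maps telescope
to less than `γ_n + ε_{n+1}`, so there is room in `K_n` for one simplex containing both the image of
a simplex of `K_{n+k}` and its image by way of the Rips complex. `interleaved_of_near` isolates what
is needed; it covers complexes on points, on balls and the Dowker complexes. In the
Alexandroff–McCord complexes the images of nearby points rarely form a chain, and superlevel sets of
barycentric functions replace vertex maps (`exists_chainMap`).

All homotopies are relative to a set `P` with at most one point: `P = ∅` gives the free statement
and `P = {x}` the pointed one. To fix base points, `β` is altered at `x` and compared with the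
bonding maps through an unaltered map `θ` (`homotopicRel_of_contiguous_of_contiguous`). Compatible
base vertices come from Kőnig's lemma, or are constant in the Vietoris complexes. -/

namespace ShapeTheory

noncomputable section

/-! ### The topology of realizations -/

namespace Realization

variable {V : Type u} {W : Type v} {K : PreAbstractSimplicialComplex V}
  {L : PreAbstractSimplicialComplex W}

lemma subset_mem_faces {s t : Finset V} (ht : t ∈ K.faces) (hst : s ⊆ t) (hs : s.Nonempty) :
    s ∈ K.faces :=
  (K.isRelLowerSet_faces ht).2 hst hs

lemma sum_eq_linearCombination (c : V →₀ ℝ) :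
    (c.sum fun _ r => r) = Finsupp.linearCombination ℝ (fun _ : V => (1 : ℝ)) c := by
  simp [Finsupp.linearCombination_apply]

lemma linearCombination_one (c : Realization K) :
    Finsupp.linearCombination ℝ (fun _ : V => (1 : ℝ)) c.1 = 1 := by
  rw [← sum_eq_linearCombination]
  exact c.2.2.1

lemma support_nonempty_of_sum {c : V →₀ ℝ}
    (h : Finsupp.linearCombination ℝ (fun _ : V => (1 : ℝ)) c = 1) : c.support.Nonempty := by
  rw [Finset.nonempty_iff_ne_empty]
  intro h'
  rw [Finsupp.support_eq_empty] at h'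
  simp [h'] at h

lemma support_nonempty (c : Realization K) : c.1.support.Nonempty :=
  support_nonempty_of_sum (linearCombination_one c)

/-- A point of the realization from its coordinates, supported in a simplex. -/
def mk' (c : V →₀ ℝ) (h0 : ∀ v, 0 ≤ c v)
    (h1 : Finsupp.linearCombination ℝ (fun _ : V => (1 : ℝ)) c = 1)
    (h : ∃ t ∈ K.faces, c.support ⊆ t) : Realization K :=
  ⟨c, h0, by rw [sum_eq_linearCombination, h1],
    let ⟨_, ht, hct⟩ := h
    subset_mem_faces ht hct (support_nonempty_of_sum h1)⟩

lemma closedSimplex_apply (s : K.faces) (c : stdSimplex ℝ s.1) (v : V) (hv : v ∈ s.1) :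
    (closedSimplex K s c).1 v = c.1 ⟨v, hv⟩ := by
  have := Finsupp.mapDomain_apply (f := (Subtype.val : s.1 → V)) Subtype.val_injective
        (Finsupp.equivFunOnFinite.symm c.1) ⟨v, hv⟩
  exact this

lemma support_closedSimplex (s : K.faces) (c : stdSimplex ℝ s.1) :
    (closedSimplex K s c).1.support ⊆ s.1 := by
  classical
  refine Finsupp.mapDomain_support.trans ?_
  intro v hv
  obtain ⟨a, -, rfl⟩ := Finset.mem_image.1 hv
  exact a.2

lemma continuous_closedSimplex (s : K.faces) : Continuous (closedSimplex K s) :=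
  continuous_iff_coinduced_le.2
    (le_iSup (fun s : K.faces => TopologicalSpace.coinduced (closedSimplex K s) inferInstance) s)

lemma continuous_of_closedSimplex {Z : Type*} [TopologicalSpace Z] {f : Realization K → Z}
    (h : ∀ s, Continuous (f ∘ closedSimplex K s)) : Continuous f :=
  continuous_iSup_dom.2 fun s => continuous_coinduced_dom.2 (h s)

lemma linearCombination_eq_sum {c : V →₀ ℝ} {s : Finset V} (h : c.support ⊆ s) (l : V → ℝ) :
    Finsupp.linearCombination ℝ l c = ∑ v ∈ s, c v * l v := by
  rw [Finsupp.linearCombination_apply, Finsupp.sum_of_support_subset _ h _ (by simp)]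
  rfl

/-- Every function on the vertices extends linearly to a continuous function. -/
lemma continuous_linearCombination (l : V → ℝ) :
    Continuous fun c : Realization K => Finsupp.linearCombination ℝ l c.1 := by
  refine continuous_of_closedSimplex fun s => ?_
  have : ((fun c : Realization K => Finsupp.linearCombination ℝ l c.1) ∘ closedSimplex K s) =
      fun c => ∑ v : s.1, c.1 v * l v := by
    funext c
    rw [Function.comp_apply, linearCombination_eq_sum (support_closedSimplex s c),
      ← Finset.sum_coe_sort]
    exact Finset.sum_congr rfl fun v _ => by rw [closedSimplex_apply s c v v.2]
  rw [this]
  exact continuous_finsetSum _ fun v _ =>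
    ((continuous_apply v).comp continuous_subtype_val).mul continuous_const

lemma continuous_coord (v : V) : Continuous fun c : Realization K => c.1 v := by
  classical
  convert continuous_linearCombination (K := K) (Pi.single v 1) using 2 with c
  rw [Finsupp.linearCombination_apply, Finsupp.sum, Finset.sum_eq_single v]
  · simp
  · intro b _ hb
    simp [hb]
  · intro h
    simpa using h

/-- The open star of a vertex is open. -/
lemma isOpen_star (v : V) : IsOpen {c : Realization K | v ∈ c.1.support} := by
  simp only [Finsupp.mem_support_iff]
  exact isOpen_ne_fun (continuous_coord v) continuous_const

/-- A map whose values have coordinates in a fixed finite set of vertices is continuous if its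
coordinates are. -/
lemma continuous_of_finite_support {T : Type*} [TopologicalSpace T] {F : T → Realization K}
    (S : Finset V) (hS : ∀ t, (F t).1.support ⊆ S) (hF : ∀ v, Continuous fun t => (F t).1 v) :
    Continuous F := by
  classical
  -- The finitely many faces inside `S` give a finite closed cover of `T`, and over each member the
  -- map factors through a closed simplex.
  let J := {s : K.faces // s.1 ⊆ S}
  have : Finite J := Finite.of_injective
    (fun i : J => (⟨i.1.1, Finset.mem_powerset.2 i.2⟩ : S.powerset))
    fun i j h => Subtype.ext (Subtype.ext (congrArg (fun s : S.powerset => s.1) h))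
  have hcl : ∀ i : J, IsClosed {t | (F t).1.support ⊆ i.1.1} := fun i => by
    have : {t | (F t).1.support ⊆ i.1.1} = ⋂ v ∈ {v | v ∉ i.1.1}, {t | (F t).1 v = 0} := by
      ext t
      simp only [Set.mem_ofPred_eq, Set.mem_iInter]
      constructor
      · intro h v hv
        by_contra h0
        exact hv (h (Finsupp.mem_support_iff.2 h0))
      · intro h v hv
        by_contra h0
        exact Finsupp.mem_support_iff.1 hv (h v h0)
    rw [this]
    exact isClosed_biInter fun v _ => isClosed_eq (hF v) continuous_const
  refine (locallyFinite_of_finite fun i : J => {t | (F t).1.support ⊆ i.1.1}).continuous ?_ hcl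
    fun i => ?_
  · rw [Set.eq_univ_iff_forall]
    intro t
    exact Set.mem_iUnion.2 ⟨⟨⟨_, (F t).2.2.2⟩, hS t⟩, fun _ h => h⟩
  · rw [continuousOn_iff_continuous_domRestrict]
    let g : {t | (F t).1.support ⊆ i.1.1} → stdSimplex ℝ i.1.1 := fun t =>
      ⟨fun v => (F t.1).1 v, fun v => (F t.1).2.1 v, by
        have h := linearCombination_one (F t.1)
        rw [linearCombination_eq_sum t.2, ← Finset.sum_coe_sort] at h
        simpa using h⟩
    have hg : Continuous g := by
      refine Continuous.subtype_mk (continuous_pi fun v => ?_) _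
      exact (hF v).comp continuous_subtype_val
    have : Set.domRestrict {t | (F t).1.support ⊆ i.1.1} F = closedSimplex K i.1 ∘ g := by
      funext t
      refine Subtype.ext (Finsupp.ext fun v => ?_)
      by_cases hv : v ∈ i.1.1
      · exact (closedSimplex_apply i.1 (g t) v hv).symm
      · exact (Finsupp.notMem_support_iff.1 fun h => hv (t.2 h)).trans
          (Finsupp.notMem_support_iff.1 fun h => hv (support_closedSimplex i.1 (g t) h)).symm
    rw [this]
    exact (continuous_closedSimplex i.1).comp hg

/-- A compact set meets only finitely many open stars. -/
lemma exists_finite_support {C : Type*} [TopologicalSpace C] [CompactSpace C]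
    (F : C(C, Realization K)) : ∃ S : Finset V, ∀ t, (F t).1.support ⊆ S := by
  by_contra hS
  have hinf : {v | ∃ t, v ∈ (F t).1.support}.Infinite := fun hfin =>
    hS ⟨hfin.toFinset, fun t v hv => hfin.mem_toFinset.2 ⟨t, hv⟩⟩
  let e := hinf.natEmbedding
  choose t ht using fun n => (e n).2
  have hpos : ∀ n, 0 < (F (t n)).1 (e n) := fun n =>
    lt_of_le_of_ne ((F (t n)).2.1 _) (Ne.symm (Finsupp.mem_support_iff.1 (ht n)))
  have hinj : Function.Injective fun n => (e n).1 := fun a b h => e.injective (Subtype.ext h)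
  -- These weights make the linear functional at least `n` at `t n`, although it is continuous and
  -- so bounded on a compact space.
  let l : V → ℝ := Function.extend (fun n => (e n).1) (fun n => n / (F (t n)).1 (e n)) 0
  have hl : ∀ v, 0 ≤ l v := fun v => by
    by_cases h : ∃ n, (e n).1 = v
    · obtain ⟨n, rfl⟩ := h
      rw [show l (e n).1 = _ from hinj.extend_apply _ _ n]
      exact div_nonneg (Nat.cast_nonneg _) (hpos n).le
    · rw [show l v = _ from Function.extend_apply' _ _ v h]
      rfl
  obtain ⟨M, hM⟩ := (isCompact_range ((continuous_linearCombination l).comp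
    F.continuous)).bddAbove
  obtain ⟨n, hn⟩ := exists_nat_gt M
  have h1 : Finsupp.linearCombination ℝ l (F (t n)).1 ≤ M := hM ⟨t n, rfl⟩
  have h2 : (F (t n)).1 (e n) * l (e n) ≤ Finsupp.linearCombination ℝ l (F (t n)).1 := by
    rw [linearCombination_eq_sum subset_rfl]
    exact Finset.single_le_sum (f := fun v => (F (t n)).1 v * l v)
      (fun v _ => mul_nonneg ((F (t n)).2.1 v) (hl v)) (ht n)
  rw [show l (e n).1 = _ from hinj.extend_apply _ _ n, mul_div_cancel₀ _ (hpos n).ne'] at h2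
  linarith

/-! ### Contiguous maps -/

/-- Two maps into a realization are contiguous if corresponding values lie in a common simplex. -/
def Contiguous {T : Type*} (F G : T → Realization K) : Prop :=
  ∀ t, ∃ s ∈ K.faces, (F t).1.support ⊆ s ∧ (G t).1.support ⊆ s

lemma Contiguous.comp {T T' : Type*} {F G : T → Realization K} (h : Contiguous F G)
    (g : T' → T) : Contiguous (F ∘ g) (G ∘ g) := fun t => h (g t)

/-- The point `(1 - μ) c + μ d` of a closed simplex containing `c` and `d`. -/
def lineMap (c d : Realization K) (h : ∃ s ∈ K.faces, c.1.support ⊆ s ∧ d.1.support ⊆ s)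
    (μ : I) : Realization K :=
  mk' ((1 - μ : ℝ) • c.1 + (μ : ℝ) • d.1)
    (fun v => add_nonneg (mul_nonneg (sub_nonneg.2 μ.2.2) (c.2.1 v))
      (mul_nonneg μ.2.1 (d.2.1 v)))
    (by simp [map_add, map_smul, linearCombination_one])
    (by
      classical
      obtain ⟨s, hs, hc, hd⟩ := h
      refine ⟨s, hs, Finsupp.support_add.trans (Finset.union_subset ?_ ?_)⟩
      · exact Finsupp.support_smul.trans hc
      · exact Finsupp.support_smul.trans hd)

lemma lineMap_apply (c d : Realization K) (h) (μ : I) (v : V) :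
    (lineMap c d h μ).1 v = (1 - μ : ℝ) * c.1 v + μ * d.1 v := rfl

lemma support_lineMap (c d : Realization K) (h) (μ : I) {v : V}
    (hv : v ∈ (lineMap c d h μ).1.support) : v ∈ c.1.support ∨ v ∈ d.1.support ∧ (μ : ℝ) ≠ 0 := by
  simp only [Finsupp.mem_support_iff, lineMap_apply] at hv ⊢
  by_contra! h0
  obtain ⟨h1, h2⟩ := h0
  by_cases hd : d.1 v = 0
  · simp [h1, hd] at hv
  · simp [h1, h2 hd] at hv

lemma lineMap_zero (c d : Realization K) (h) : lineMap c d h 0 = c :=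
  Subtype.ext (Finsupp.ext fun v => by simp [lineMap_apply])

lemma lineMap_one (c d : Realization K) (h) : lineMap c d h 1 = d :=
  Subtype.ext (Finsupp.ext fun v => by simp [lineMap_apply])

/-- Compactness confines both maps to finitely many vertices, and there continuity can be checked
coordinate by coordinate. -/
lemma continuous_lineMap_of_compact {T : Type*} [TopologicalSpace T] [CompactSpace T]
    (F G : C(T, Realization K)) (h : Contiguous F G) (μ : C(T, I)) :
    Continuous fun t => lineMap (F t) (G t) (h t) (μ t) := by
  classical
  obtain ⟨S, hS⟩ := exists_finite_support F
  obtain ⟨S', hS'⟩ := exists_finite_support G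
  refine continuous_of_finite_support (S ∪ S') (fun t v hv => ?_) fun v => ?_
  · rcases support_lineMap _ _ _ _ hv with hv | hv
    · exact Finset.mem_union_left _ (hS t hv)
    · exact Finset.mem_union_right _ (hS' t hv.1)
  · simp only [lineMap_apply]
    have h1 := (continuous_coord v).comp F.continuous
    have h2 := (continuous_coord v).comp G.continuous
    have h3 : Continuous fun t => (μ t : ℝ) := by fun_prop
    exact ((continuous_const.sub h3).mul h1).add (h3.mul h2)

end Realization

/-- Spaces whose topology is determined by the maps from compact spaces into them. -/
class CompactlyDetermined (T : Type u) [TopologicalSpace T] : Prop where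
  continuous_of_compact : ∀ {Z : Type u} [TopologicalSpace Z] (f : T → Z),
    (∀ (C : Type u) [TopologicalSpace C] [CompactSpace C] (g : C(C, T)), Continuous (f ∘ g)) →
      Continuous f

instance (T : Type u) [TopologicalSpace T] [CompactSpace T] : CompactlyDetermined T where
  continuous_of_compact _ h := h T (.id T)

/-- The weak topology is final for the closed simplices, which are compact. -/
instance {V : Type u} (K : PreAbstractSimplicialComplex V) :
    CompactlyDetermined (Realization K) where
  continuous_of_compact _ h := Realization.continuous_of_closedSimplex fun s =>
    h (stdSimplex ℝ s.1) ⟨_, Realization.continuous_closedSimplex s⟩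

namespace Realization

variable {V : Type u} {K : PreAbstractSimplicialComplex V} {T : Type u} [TopologicalSpace T]
  [CompactlyDetermined T]

/-- Contiguous maps are homotopic, relative to the set where they agree. -/
theorem Contiguous.homotopicRel {F G : C(T, Realization K)} (h : Contiguous F G) {P : Set T}
    (hP : ∀ t ∈ P, F t = G t) : F.HomotopicRel G P := by
  have key : ∀ (C : Type u) [TopologicalSpace C] [CompactSpace C] (g : C(C, T)),
      Continuous fun x : C × I => lineMap (F (g x.1)) (G (g x.1)) (h (g x.1)) x.2 :=
    fun C _ _ g => continuous_lineMap_of_compact ((F.comp g).comp .fst) ((G.comp g).comp .fst)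
      (h.comp (g ∘ Prod.fst)) .snd
  -- The homotopy is built in curried form because compact test maps detect continuity on `T`, while
  -- nothing of the kind is assumed for `T × I`; uncurrying uses that `I` is locally compact.
  obtain ⟨Φ, hΦ⟩ : ∃ Φ : C(T, C(I, Realization K)), ∀ t μ, Φ t μ = lineMap (F t) (G t) (h t) μ :=
    ⟨⟨fun t => ⟨fun μ => lineMap (F t) (G t) (h t) μ,
      continuous_lineMap_of_compact (.const I (F t)) (.const I (G t)) (fun _ => h t) (.id I)⟩,
      CompactlyDetermined.continuous_of_compact _ fun C _ _ g =>
        (ContinuousMap.curry ⟨_, key C g⟩).continuous⟩, fun _ _ => rfl⟩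
  refine ⟨⟨⟨⟨fun x => Φ x.2 x.1, ?_⟩, fun t => ?_, fun t => ?_⟩, fun μ t ht => ?_⟩⟩
  · exact (ContinuousMap.continuous_uncurry_of_continuous Φ).comp continuous_swap
  · exact (hΦ t 0).trans (lineMap_zero _ _ _)
  · exact (hΦ t 1).trans (lineMap_one _ _ _)
  have ht' := hP t ht
  refine (hΦ t μ).trans ?_
  refine Subtype.ext (Finsupp.ext fun v => ?_)
  change (1 - μ : ℝ) * (F t).1 v + μ * (G t).1 v = (F t).1 v
  rw [← ht']
  ring

/-- Two maps contiguous to a third one are homotopic relative to a set that both send to the same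
vertex. -/
theorem homotopicRel_of_contiguous_of_contiguous {F G M : C(T, Realization K)}
    (hF : Contiguous F M) (hG : Contiguous G M) {P : Set T}
    (hP : ∀ t ∈ P, ∀ t' ∈ P, ∃ v, (F t).1 = Finsupp.single v 1 ∧ (G t).1 = Finsupp.single v 1 ∧
      (F t').1 = Finsupp.single v 1) : F.HomotopicRel G P := by
  rcases P.eq_empty_or_nonempty with rfl | ⟨t₀, ht₀⟩
  · exact (hF.homotopicRel (by simp)).trans (hG.homotopicRel (by simp)).symm
  obtain ⟨v, hFv, -, -⟩ := hP t₀ ht₀ t₀ ht₀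
  have hv : {v} ∈ K.faces := by
    have := (F t₀).2.2.2
    rwa [hFv, Finsupp.support_single _ one_ne_zero] at this
  have hPF : ∀ t ∈ P, (F t).1 = Finsupp.single v 1 ∧ (G t).1 = Finsupp.single v 1 := by
    intro t ht
    obtain ⟨w, h1, h2, h3⟩ := hP t ht t₀ ht₀
    have : w = v := by
      rw [h3] at hFv
      exact (Finsupp.single_left_inj one_ne_zero).1 hFv
    subst this
    exact ⟨h1, h2⟩
  have hle : ∀ c : Realization K, c.1 v ≤ 1 := fun c => by
    by_cases hc : v ∈ c.1.support
    · have h := linearCombination_one c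
      rw [linearCombination_eq_sum subset_rfl] at h
      refine le_of_le_of_eq ?_ h
      simpa using Finset.single_le_sum (f := fun v => c.1 v * 1)
        (fun v _ => by simpa using c.2.1 v) hc
    · rw [Finsupp.notMem_support_iff.1 hc]
      exact zero_le_one
  -- `M` is pushed towards `v` by the amount `μ`. On `P` this amount is 1, so the new map agrees
  -- there with `F` and `G`. Where it is nonzero, `v` is a vertex of the carriers of both `F t` and
  -- `G t`, so the simplices witnessing contiguity with `M` still serve.
  let μ : C(T, I) := ⟨fun t => ⟨min ((F t).1 v) ((G t).1 v),
    le_min ((F t).2.1 v) ((G t).2.1 v), (min_le_left _ _).trans (hle _)⟩,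
    Continuous.subtype_mk (((continuous_coord v).comp F.continuous).min
      ((continuous_coord v).comp G.continuous)) _⟩
  -- `M` may not be contiguous to the vertex `v`, so cut it off where `μ` vanishes
  have hmem : ∀ t, (μ t : ℝ) ≠ 0 → v ∈ (F t).1.support ∧ v ∈ (G t).1.support := by
    intro t ht
    refine ⟨Finsupp.mem_support_iff.2 fun h0 => ht ?_, Finsupp.mem_support_iff.2 fun h0 => ht ?_⟩
    · exact (min_eq_left (by rw [h0]; exact (G t).2.1 v)).trans h0
    · exact (min_eq_right (by rw [h0]; exact (F t).2.1 v)).trans h0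
  let M' : T → Realization K := fun t =>
    mk' ((1 - μ t : ℝ) • (M t).1 + (μ t : ℝ) • Finsupp.single v 1)
      (fun w => add_nonneg (mul_nonneg (sub_nonneg.2 (μ t).2.2) ((M t).2.1 w))
        (mul_nonneg (μ t).2.1 (by
          classical
          rw [Finsupp.single_apply]
          split_ifs <;> simp)))
      (by simp [map_add, map_smul, linearCombination_one])
      (by
        classical
        obtain ⟨s, hs, h1, h2⟩ := hF t
        refine ⟨s, hs, fun w hw => ?_⟩
        by_cases h0 : (μ t : ℝ) = 0
        · rw [h0] at hw
          exact h2 (by simpa using hw)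
        · rcases Finset.mem_union.1 (Finsupp.support_add hw) with hw | hw
          · exact h2 (Finsupp.support_smul hw)
          · have := Finsupp.support_single_subset (Finsupp.support_smul hw)
            rw [Finset.mem_singleton.1 this]
            exact h1 (hmem t h0).1)
  have hM'supp : ∀ t w, w ∈ (M' t).1.support →
      w ∈ (M t).1.support ∨ w = v ∧ (μ t : ℝ) ≠ 0 := by
    classical
    intro t w hw
    by_cases h0 : (μ t : ℝ) = 0
    · left
      change w ∈ ((1 - μ t : ℝ) • (M t).1 + (μ t : ℝ) • Finsupp.single v 1).support at hw
      rw [h0] at hw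
      simpa using hw
    · rcases Finset.mem_union.1 (Finsupp.support_add hw) with hw | hw
      · exact Or.inl (Finsupp.support_smul hw)
      · exact Or.inr ⟨Finset.mem_singleton.1
          (Finsupp.support_single_subset (Finsupp.support_smul hw)), h0⟩
  have hM' : Continuous M' := CompactlyDetermined.continuous_of_compact _ fun C _ _ g => by
    classical
    obtain ⟨S, hS⟩ := exists_finite_support (M.comp g)
    refine continuous_of_finite_support (insert v S) (fun t w hw => ?_) fun w => ?_
    · rcases hM'supp _ _ hw with hw | hw
      · exact Finset.mem_insert_of_mem (hS t hw)
      · exact Finset.mem_insert.2 (Or.inl hw.1)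
    · have h3 : Continuous fun t => (μ t : ℝ) := by fun_prop
      exact (((continuous_const.sub h3).mul ((continuous_coord w).comp M.continuous)).add
        (h3.mul continuous_const)).comp g.continuous
  have hval : ∀ t ∈ P, (M' t).1 = Finsupp.single v 1 := fun t ht => by
    have : (μ t : ℝ) = 1 := by
      change min ((F t).1 v) ((G t).1 v) = 1
      rw [(hPF t ht).1, (hPF t ht).2]
      simp
    change ((1 - μ t : ℝ) • (M t).1 + (μ t : ℝ) • Finsupp.single v 1) = _
    simp [this]
  have h1 : Contiguous F (⟨M', hM'⟩ : C(T, Realization K)) := fun t => by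
    obtain ⟨s, hs, h1, h2⟩ := hF t
    refine ⟨s, hs, h1, fun w hw => ?_⟩
    rcases hM'supp _ _ hw with hw | ⟨rfl, hw⟩
    · exact h2 hw
    · exact h1 (hmem t hw).1
  have h2 : Contiguous G (⟨M', hM'⟩ : C(T, Realization K)) := fun t => by
    obtain ⟨s, hs, hs1, hs2⟩ := hG t
    refine ⟨s, hs, hs1, fun w hw => ?_⟩
    rcases hM'supp _ _ hw with hw | ⟨rfl, hw⟩
    · exact hs2 hw
    · exact hs1 (hmem t hw).2
  exact (h1.homotopicRel fun t ht => Subtype.ext ((hPF t ht).1.trans (hval t ht).symm)).trans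
    (h2.homotopicRel fun t ht => Subtype.ext ((hPF t ht).2.trans (hval t ht).symm)).symm

end Realization

/-! ### Maps between realizations: weights, simplicial maps, linear extensions. -/

namespace Realization

variable {V : Type u} {W : Type v} {K : PreAbstractSimplicialComplex V}
  {L : PreAbstractSimplicialComplex W}

open Classical in
/-- The point of a realization whose barycentric coordinates are proportional to given weights. -/
def ofWeights (S : Finset V) (w : V → ℝ) (h0 : ∀ v ∈ S, 0 ≤ w v) (hpos : 0 < ∑ v ∈ S, w v)
    (hf : ∃ t ∈ K.faces, ∀ v ∈ S, w v ≠ 0 → v ∈ t) : Realization K :=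
  mk' (Finsupp.onFinset S (fun v => if v ∈ S then w v / ∑ v ∈ S, w v else 0) (fun v hv => by
      by_contra h
      simp [h] at hv))
    (fun v => by
      rw [Finsupp.onFinset_apply]
      split_ifs with h
      · exact div_nonneg (h0 v h) hpos.le
      · exact le_rfl)
    (by
      rw [linearCombination_eq_sum Finsupp.support_onFinset_subset]
      simp only [Finsupp.onFinset_apply, mul_one]
      rw [Finset.sum_congr rfl fun v hv => if_pos hv, ← Finset.sum_div, div_self hpos.ne'])
    (by
      obtain ⟨t, ht, h⟩ := hf
      refine ⟨t, ht, fun v hv => ?_⟩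
      rw [Finsupp.mem_support_iff, Finsupp.onFinset_apply] at hv
      split_ifs at hv with hS
      · exact h v hS fun h' => hv (by rw [h', zero_div])
      · exact absurd rfl hv)

open Classical in
lemma ofWeights_apply (S : Finset V) (w : V → ℝ) (h0) (hpos) (hf) (v : V) :
    (ofWeights (K := K) S w h0 hpos hf).1 v = if v ∈ S then w v / ∑ v ∈ S, w v else 0 := rfl

lemma mem_support_ofWeights {S : Finset V} {w : V → ℝ} {h0} {hpos} {hf} {v : V} :
    v ∈ (ofWeights (K := K) S w h0 hpos hf).1.support ↔ v ∈ S ∧ w v ≠ 0 := by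
  classical
  rw [Finsupp.mem_support_iff, ofWeights_apply]
  split_ifs with h
  · simp [h, hpos.ne']
  · simp [h]

lemma continuous_ofWeights {T : Type*} [TopologicalSpace T] (S : Finset V) (w : T → V → ℝ)
    (h0 : ∀ t, ∀ v ∈ S, 0 ≤ w t v) (hpos : ∀ t, 0 < ∑ v ∈ S, w t v)
    (hf : ∀ t, ∃ s ∈ K.faces, ∀ v ∈ S, w t v ≠ 0 → v ∈ s)
    (hw : ∀ v ∈ S, Continuous fun t => w t v) :
    Continuous fun t => ofWeights (K := K) S (w t) (h0 t) (hpos t) (hf t) := by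
  classical
  refine continuous_of_finite_support S (fun t v hv => (mem_support_ofWeights.1 hv).1) fun v => ?_
  simp only [ofWeights_apply]
  by_cases hv : v ∈ S
  · simp only [hv, if_true]
    exact (hw v hv).div (continuous_finsetSum _ hw) fun t => (hpos t).ne'
  · simp only [hv, if_false]
    exact continuous_const

lemma eq_single_of_support_subset {c : Realization K} {q : V} (h : c.1.support ⊆ {q}) :
    c.1 = Finsupp.single q 1 := by
  have h1 := linearCombination_one c
  rw [linearCombination_eq_sum h, Finset.sum_singleton, mul_one] at h1
  exact (Finsupp.support_subset_singleton.1 h).trans (congrArg _ h1)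

lemma support_eq_of_eq_single {c : Realization K} {q : V} (h : c.1 = Finsupp.single q 1) :
    c.1.support = {q} := by
  rw [h, Finsupp.support_single _ one_ne_zero]

lemma mem_support_realize {f : V → W} {hf : IsSimplicial K L f} {c : Realization K} {w : W} :
    w ∈ (realize f hf c).1.support ↔ ∃ v ∈ c.1.support, f v = w := by
  have : ((realize f hf c).1.support : Set W) = f '' c.1.support :=
    mapDomain_support_of_nonneg f c.1 c.2.1
  rw [← Finset.mem_coe, this]
  rfl

lemma isSimplicial_of_image_mem [DecidableEq W] {f : V → W}
    (h : ∀ s ∈ K.faces, s.image f ∈ L.faces) : IsSimplicial K L f :=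
  fun s hs => ⟨_, h s hs, Finset.coe_image⟩

lemma image_mem [DecidableEq W] {f : V → W} (hf : IsSimplicial K L f) {s : Finset V}
    (hs : s ∈ K.faces) : s.image f ∈ L.faces := by
  obtain ⟨t, ht, h⟩ := hf s hs
  rw [← Finset.coe_image, Finset.coe_inj] at h
  rwa [← h]

lemma realize_single {f : V → W} {hf : IsSimplicial K L f} {c : Realization K} {v : V}
    (h : c.1 = Finsupp.single v 1) : (realize f hf c).1 = Finsupp.single (f v) 1 := by
  change c.1.mapDomain f = _
  rw [h, Finsupp.mapDomain_single]

lemma realize_comp_realize {U : Type*} {M : PreAbstractSimplicialComplex U} {f : V → W} {g : W → U}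
    (hf : IsSimplicial K L f) (hg : IsSimplicial L M g) (hgf : IsSimplicial K M (g ∘ f)) :
    (realize g hg).comp (realize f hf) = realize (g ∘ f) hgf :=
  ContinuousMap.ext fun c => Subtype.ext (Finsupp.mapDomain_comp (v := c.1)).symm

/-- The linear extension of a map from the vertices of `K` to `|L|` that sends the vertices of a
simplex into a simplex. -/
def linearExtension (ν : V → Realization L)
    (hν : ∀ s ∈ K.faces, ∃ t ∈ L.faces, ∀ v ∈ s, (ν v).1.support ⊆ t) (c : Realization K) :
    Realization L :=
  mk' (Finsupp.linearCombination ℝ (fun v => (ν v).1) c.1)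
    (fun w => by
      rw [Finsupp.linearCombination_apply, Finsupp.sum, Finsupp.finsetSum_apply]
      exact Finset.sum_nonneg fun v _ => mul_nonneg (c.2.1 v) ((ν v).2.1 w))
    (by
      rw [Finsupp.linearCombination_apply (R := ℝ) (v := fun v => (ν v).1), Finsupp.sum, map_sum]
      simp only [map_smul, linearCombination_one]
      have := linearCombination_one c
      rwa [Finsupp.linearCombination_apply, Finsupp.sum] at this)
    (by
      obtain ⟨t, ht, h⟩ := hν _ c.2.2.2
      refine ⟨t, ht, fun w hw => ?_⟩
      rw [Finsupp.mem_support_iff, Finsupp.linearCombination_apply, Finsupp.sum,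
        Finsupp.finsetSum_apply] at hw
      obtain ⟨v, hv, hvw⟩ := Finset.exists_ne_zero_of_sum_ne_zero hw
      exact h v hv (Finsupp.mem_support_iff.2 (right_ne_zero_of_mul hvw)))

lemma linearExtension_apply (ν : V → Realization L) (hν) (c : Realization K) (w : W) :
    (linearExtension ν hν c).1 w = ∑ v ∈ c.1.support, c.1 v * (ν v).1 w := by
  change (Finsupp.linearCombination ℝ (fun v => (ν v).1) c.1) w = _
  rw [Finsupp.linearCombination_apply, Finsupp.sum, Finsupp.finsetSum_apply]
  rfl

lemma mem_support_linearExtension {ν : V → Realization L} {hν} {c : Realization K} {w : W}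
    (h : w ∈ (linearExtension ν hν c).1.support) : ∃ v ∈ c.1.support, w ∈ (ν v).1.support := by
  rw [Finsupp.mem_support_iff, linearExtension_apply] at h
  obtain ⟨v, hv, hvw⟩ := Finset.exists_ne_zero_of_sum_ne_zero h
  exact ⟨v, hv, Finsupp.mem_support_iff.2 (right_ne_zero_of_mul hvw)⟩

lemma linearExtension_single {ν : V → Realization L} {hν} {c : Realization K} {v : V}
    (h : c.1 = Finsupp.single v 1) : linearExtension ν hν c = ν v := by
  refine Subtype.ext ?_
  change (Finsupp.linearCombination ℝ (fun v => (ν v).1) c.1) = _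
  rw [h, Finsupp.linearCombination_single, one_smul]

lemma continuous_linearExtension (ν : V → Realization L) (hν)
    (S : Finset W) (hS : ∀ v, (ν v).1.support ⊆ S) :
    Continuous (linearExtension (K := K) ν hν) := by
  refine continuous_of_finite_support S (fun c w hw => ?_) fun w => ?_
  · obtain ⟨v, -, hv⟩ := mem_support_linearExtension hw
    exact hS v hv
  · convert continuous_linearCombination (K := K) fun v => (ν v).1 w using 2 with c
    rw [linearExtension_apply, linearCombination_eq_sum subset_rfl]

end Realization

open Realization

/-! ### Vietoris–Rips complexes of a compact metric space -/

/-- A finite set attains its diameter, so the strict inequality survives. -/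
lemma diam_lt_iff {X : Type u} [MetricSpace X] {s : Finset X} (hs : s.Nonempty) {r : ℝ} :
    Metric.diam (s : Set X) < r ↔ ∀ a ∈ s, ∀ b ∈ s, dist a b < r := by
  constructor
  · intro h a ha b hb
    exact (Metric.dist_le_diam_of_mem s.finite_toSet.isBounded (Finset.mem_coe.2 ha)
      (Finset.mem_coe.2 hb)).trans_lt h
  · intro h
    obtain ⟨⟨a, b⟩, hab, hmax⟩ := Finset.exists_max_image (s ×ˢ s) (fun x => dist x.1 x.2)
      (hs.product hs)
    rw [Finset.mem_product] at hab
    refine (Metric.diam_le_of_forall_dist_le dist_nonneg fun x hx y hy => ?_).trans_lt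
      (h a hab.1 b hab.2)
    exact hmax (x, y) (Finset.mem_product.2 ⟨hx, hy⟩)

/-- The Vietoris–Rips complex of `X` with parameter `r`. -/
def ripsComplex (X : Type u) [MetricSpace X] (r : ℝ) : PreAbstractSimplicialComplex X where
  faces := {s | s.Nonempty ∧ Metric.diam (s : Set X) < r}
  isRelLowerSet_faces := fun s h => ⟨h.1, fun _ hts ht =>
    ⟨ht, lt_of_le_of_lt
      (Metric.diam_mono (Finset.coe_subset.2 hts) s.finite_toSet.isBounded) h.2⟩⟩

section rips

variable {X : Type u} [MetricSpace X]

lemma mem_ripsComplex {r : ℝ} {s : Finset X} (hs : s.Nonempty) :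
    s ∈ (ripsComplex X r).faces ↔ ∀ a ∈ s, ∀ b ∈ s, dist a b < r :=
  ⟨fun h => (diam_lt_iff hs).1 h.2, fun h => ⟨hs, (diam_lt_iff hs).2 h⟩⟩

lemma dist_lt_of_mem_support {r : ℝ} (c : Realization (ripsComplex X r)) {a b : X}
    (ha : a ∈ c.1.support) (hb : b ∈ c.1.support) : dist a b < r :=
  (mem_ripsComplex (support_nonempty c)).1 c.2.2.2 a ha b hb

lemma singleton_mem_ripsComplex {r : ℝ} (hr : 0 < r) (x : X) : {x} ∈ (ripsComplex X r).faces :=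
  (mem_ripsComplex (Finset.singleton_nonempty x)).2 (by simpa using hr)

lemma isSimplicial_ripsComplex_of_le {r s : ℝ} (h : r ≤ s) :
    IsSimplicial (ripsComplex X r) (ripsComplex X s) id :=
  fun t ht => ⟨t, ⟨ht.1, ht.2.trans_le h⟩, by simp⟩

/-- The inclusion of Vietoris–Rips complexes. -/
def ripsIncl {r s : ℝ} (h : r ≤ s) :
    C(Realization (ripsComplex X r), Realization (ripsComplex X s)) :=
  realize id (isSimplicial_ripsComplex_of_le h)

lemma ripsIncl_val {r s : ℝ} (h : r ≤ s) (c : Realization (ripsComplex X r)) :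
    (ripsIncl h c).1 = c.1 :=
  Finsupp.mapDomain_id

/-- The vertices of a complex on a given set, as points of the realization. -/
def verticesIn {V : Type u} (K : PreAbstractSimplicialComplex V) (P : Set V) :
    Set (Realization K) :=
  {c | ∃ p ∈ P, c.1 = Finsupp.single p 1}

/-- `φ w` is a vertex of the carrier of `h z` as soon as `z` is near `w`. -/
def IsApprox {W : Type u} {L : PreAbstractSimplicialComplex W} (h : X → Realization L)
    (φ : X → W) (r : ℝ) : Prop :=
  ∀ z w, dist z w < r → φ w ∈ (h z).1.support

namespace IsApprox

variable {W : Type u} {L : PreAbstractSimplicialComplex W} {h : X → Realization L}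
    {φ ψ : X → W} {r s : ℝ}

lemma mono (H : IsApprox h φ r) (hs : s ≤ r) : IsApprox h φ s :=
  fun z w hzw => H z w (hzw.trans_le hs)

/-- For any one vertex `z` of a simplex, the images of all its vertices lie in the carrier of `h z`.
-/
lemma isSimplicial (H : IsApprox h φ r) : IsSimplicial (ripsComplex X r) L φ := by
  classical
  refine isSimplicial_of_image_mem fun s hs => ?_
  obtain ⟨z, hz⟩ := hs.1
  refine subset_mem_faces (h z).2.2.2 (Finset.image_subset_iff.2 fun w hw => ?_) (hs.1.image φ)
  exact H z w ((mem_ripsComplex hs.1).1 hs z hz w hw)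

lemma apply_eq {q : W} {p : X} (H : IsApprox h φ r) (hr : 0 < r)
    (hp : (h p).1 = Finsupp.single q 1) : φ p = q := by
  have := H p p (by simpa using hr)
  rw [support_eq_of_eq_single hp] at this
  simpa using this

/-- Two approximations of the same map are contiguous: for a vertex `z` of the carrier of a point,
both images lie in the carrier of `h z`. Where `h p` is a vertex, that vertex is the only possible
value of either. -/
lemma homotopicRel (H : IsApprox h φ r) (H' : IsApprox h ψ r) (hr : 0 < r) {P : Set X}
    (hP : ∀ p ∈ P, ∃ q, (h p).1 = Finsupp.single q 1) :
    (realize φ H.isSimplicial).HomotopicRel (realize ψ H'.isSimplicial) (verticesIn _ P) := by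
  refine Contiguous.homotopicRel (fun c => ?_) fun c hc => ?_
  · obtain ⟨z, hz⟩ := support_nonempty c
    refine ⟨_, (h z).2.2.2, fun w hw => ?_, fun w hw => ?_⟩
    all_goals
      obtain ⟨v, hv, rfl⟩ := mem_support_realize.1 hw
    · exact H z v (dist_lt_of_mem_support c hz hv)
    · exact H' z v (dist_lt_of_mem_support c hz hv)
  · obtain ⟨p, hp, hc⟩ := hc
    obtain ⟨q, hq⟩ := hP p hp
    refine Subtype.ext ?_
    rw [realize_single hc, realize_single hc, H.apply_eq hr hq, H'.apply_eq hr hq]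

/-- The carrier of `ν z` consists of points within `r` of `z`, so `φ` takes it into the carrier of
`h z`, and the composite is contiguous to `h`. -/
lemma comp_homotopicRel [CompactSpace X] {h : C(X, Realization L)} (H : IsApprox h φ r) (hr : 0 < r)
    (ν : C(X, Realization (ripsComplex X r)))
    (hν : ∀ z, ∀ a ∈ (ν z).1.support, dist z a < r) {P : Set X}
    (hP : ∀ p ∈ P, (ν p).1 = Finsupp.single p 1 ∧ ∃ q, (h p).1 = Finsupp.single q 1) :
    ((realize φ H.isSimplicial).comp ν).HomotopicRel h P := by
  refine Contiguous.homotopicRel (fun z => ⟨_, (h z).2.2.2, fun w hw => ?_, subset_rfl⟩)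
    fun p hp => ?_
  · obtain ⟨v, hv, rfl⟩ := (mem_support_realize (hf := H.isSimplicial)).1 hw
    exact H z v (hν z v hv)
  · obtain ⟨h1, q, hq⟩ := hP p hp
    refine Subtype.ext ?_
    rw [hq, ← H.apply_eq hr hq]
    exact realize_single (hf := H.isSimplicial) h1

end IsApprox

variable [CompactSpace X]

/-- `r` is a Lebesgue number for the preimages of the open stars, and `φ w` is a vertex whose star
contains the image of the ball of radius `r` about `w`. -/
theorem exists_isApprox {W : Type u} {L : PreAbstractSimplicialComplex W}
    (h : C(X, Realization L)) : ∃ r > 0, ∃ φ, IsApprox h φ r := by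
  obtain ⟨r, hr, H⟩ := lebesgue_number_lemma_of_metric (isCompact_univ (X := X))
    (c := fun w : W => {x | w ∈ (h x).1.support})
    (fun w => (isOpen_star w).preimage h.continuous) (fun x _ => by
      obtain ⟨w, hw⟩ := support_nonempty (h x)
      exact Set.mem_iUnion.2 ⟨w, hw⟩)
  choose φ hφ using fun x => H x trivial
  exact ⟨r, hr, φ, fun z w hzw => hφ w hzw⟩

/-- Simplicial approximation of a homotopy. -/
theorem exists_isApprox_of_homotopy {W : Type u} {L : PreAbstractSimplicialComplex W}
    (H : C(I × X, Realization L)) {P : Set X}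
    (hP : ∀ p ∈ P, ∃ q, ∀ t, (H (t, p)).1 = Finsupp.single q 1) :
    ∃ r > 0, ∃ (φ ψ : X → W) (hφ : IsApprox (fun z => H (0, z)) φ r)
      (hψ : IsApprox (fun z => H (1, z)) ψ r),
      (realize φ hφ.isSimplicial).HomotopicRel (realize ψ hψ.isSimplicial) (verticesIn _ P) := by
  obtain ⟨r, hr, hL⟩ := lebesgue_number_lemma_of_metric (isCompact_univ (X := I × X))
    (c := fun w : W => {x | w ∈ (H x).1.support})
    (fun w => (isOpen_star w).preimage H.continuous) (fun x _ => by
      obtain ⟨w, hw⟩ := support_nonempty (H x)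
      exact Set.mem_iUnion.2 ⟨w, hw⟩)
  choose φ hφ using fun x => hL x trivial
  -- One time slice of `φ` approximates `H` at all times less than `r` away. Along a subdivision of
  -- `I` of mesh below `r`, consecutive slices thus approximate a common map, and their realizations
  -- are homotopic.
  have key : ∀ t t' : I, dist t' t < r →
      IsApprox (fun z => H (t', z)) (fun z => φ (t, z)) r := fun t t' htt z w hzw =>
    hφ (t, w) (show dist (t', z) (t, w) < r from max_lt htt hzw)
  have key0 : ∀ t, IsApprox (fun z => H (t, z)) (fun z => φ (t, z)) r := fun t =>
    key t t (by simpa using hr)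
  obtain ⟨N, hN⟩ := exists_nat_one_div_lt hr
  let t : ℕ → I := fun i => Set.projIcc (0 : ℝ) 1 zero_le_one ((i : ℝ) / (N + 1))
  have hN0 : (0 : ℝ) < N + 1 := by positivity
  have ht : ∀ i, dist (t (i + 1)) (t i) < r := fun i => by
    refine lt_of_le_of_lt ((LipschitzWith.projIcc (zero_le_one (α := ℝ))).dist_le_mul _ _) ?_
    rw [NNReal.coe_one, one_mul, Real.dist_eq, ← sub_div, Nat.cast_add, Nat.cast_one,
      add_sub_cancel_left, abs_of_pos (by positivity)]
    exact hN
  have hP' : ∀ t, ∀ p ∈ P, ∃ q, (H (t, p)).1 = Finsupp.single q 1 := fun t p hp =>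
    (hP p hp).imp fun q hq => hq t
  have hchain : ∀ i, (realize _ (key0 (t 0)).isSimplicial).HomotopicRel
      (realize _ (key0 (t i)).isSimplicial) (verticesIn _ P) := by
    intro i
    induction i with
    | zero => exact .refl _
    | succ i ih =>
      exact ih.trans ((key (t i) (t (i + 1)) (ht i)).homotopicRel (key0 _) hr (hP' _))
  have h0 : t 0 = 0 := by
    simp [t]
  have h1 : t (N + 1) = 1 := by
    have : ((N + 1 : ℕ) : ℝ) / (N + 1) = 1 := by
      rw [Nat.cast_add, Nat.cast_one, div_self hN0.ne']
    simp only [t, this]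
    exact Set.projIcc_right _
  refine ⟨r, hr, _, _, key0 0, key0 1, ?_⟩
  have := hchain (N + 1)
  simp only [h0, h1] at this
  exact this

/-- Partitions of unity. -/
theorem exists_fine_map {r : ℝ} (hr : 0 < r) {P : Set X} (hP : P.Subsingleton) :
    ∃ ν : C(X, Realization (ripsComplex X r)),
      (∀ z, ∀ a ∈ (ν z).1.support, dist z a < r / 4) ∧ ∀ p ∈ P, (ν p).1 = Finsupp.single p 1 := by
  classical
  have hr4 : 0 < r / 4 := by positivity
  obtain ⟨A, hPA, hA⟩ : ∃ A : Finset X, (∀ p ∈ P, p ∈ A) ∧ ∀ x, ∃ a ∈ A, dist x a < r / 4 := by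
    obtain ⟨t, -, ht, h⟩ := Metric.finite_approx_of_totallyBounded
      (isCompact_univ (X := X)).totallyBounded (r / 4) hr4
    refine ⟨ht.toFinset ∪ hP.finite.toFinset, fun p hp => by simp [hp], fun x => ?_⟩
    obtain ⟨a, ha, hx⟩ := Set.mem_iUnion₂.1 (h (Set.mem_univ x))
    exact ⟨a, by simp [ha], hx⟩
  obtain ⟨k, hk, hk0, hkP, hkP'⟩ : ∃ k : X → ℝ, Continuous k ∧ (∀ z, 0 ≤ k z) ∧
      (∀ z, k z = 0 → z ∈ P) ∧ ∀ p ∈ P, k p = 0 := by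
    rcases P.eq_empty_or_nonempty with rfl | ⟨x, hx⟩
    · exact ⟨fun _ => 1, continuous_const, fun _ => zero_le_one, by simp, by simp⟩
    · refine ⟨fun z => dist z x, by fun_prop, fun _ => dist_nonneg, fun z hz => ?_, fun p hp => ?_⟩
      · rwa [dist_eq_zero.1 hz]
      · exact dist_eq_zero.2 (hP hp hx)
  -- The factor `k`, which vanishes exactly on `P`, removes from the value at a base point every
  -- vertex but the base point itself.
  let w : X → X → ℝ := fun z a => max 0 (r / 4 - dist z a) * if a ∈ P then 1 else k z
  have hw0 : ∀ z a, 0 ≤ w z a := fun z a => mul_nonneg (le_max_left _ _) (by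
    split_ifs
    · exact zero_le_one
    · exact hk0 z)
  have hne : ∀ z a, w z a ≠ 0 → dist z a < r / 4 := fun z a h => by
    by_contra hza
    refine h (mul_eq_zero_of_left (max_eq_left ?_) _)
    linarith
  have hpos : ∀ z, 0 < ∑ a ∈ A, w z a := fun z => by
    obtain ⟨a, ha, h⟩ : ∃ a ∈ A, 0 < w z a := by
      by_cases hz : z ∈ P
      · refine ⟨z, hPA z hz, ?_⟩
        simp [w, hz, hr]
      · obtain ⟨a, ha, hza⟩ := hA z
        refine ⟨a, ha, mul_pos (lt_max_of_lt_right (by linarith)) ?_⟩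
        split_ifs
        · exact zero_lt_one
        · exact lt_of_le_of_ne (hk0 z) fun h => hz (hkP z h.symm)
    exact Finset.sum_pos' (fun a _ => hw0 z a) ⟨a, ha, h⟩
  have hf : ∀ z, ∃ s ∈ (ripsComplex X r).faces, ∀ a ∈ A, w z a ≠ 0 → a ∈ s := fun z => by
    have hne' : (A.filter fun a => w z a ≠ 0).Nonempty := by
      obtain ⟨a, ha, h⟩ := Finset.exists_ne_zero_of_sum_ne_zero (hpos z).ne'
      exact ⟨a, Finset.mem_filter.2 ⟨ha, h⟩⟩
    refine ⟨_, (mem_ripsComplex hne').2 fun a ha b hb => ?_,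
      fun a ha h => Finset.mem_filter.2 ⟨ha, h⟩⟩
    have h1 := hne z a (Finset.mem_filter.1 ha).2
    have h2 := hne z b (Finset.mem_filter.1 hb).2
    have h3 := dist_triangle_left a b z
    linarith
  refine ⟨⟨fun z => ofWeights A (w z) (fun a _ => hw0 z a) (hpos z) (hf z),
    continuous_ofWeights A w (fun z a _ => hw0 z a) hpos hf fun a _ => ?_⟩, fun z a ha => ?_,
    fun p hp => eq_single_of_support_subset fun a ha => ?_⟩
  · refine Continuous.mul (by fun_prop) ?_
    split_ifs
    · exact continuous_const
    · exact hk
  · change a ∈ (ofWeights A (w z) (fun a _ => hw0 z a) (hpos z) (hf z)).1.support at ha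
    exact hne z a (mem_support_ofWeights.1 ha).2
  · change a ∈ (ofWeights A (w p) (fun a _ => hw0 p a) (hpos p) (hf p)).1.support at ha
    have h := (mem_support_ofWeights.1 ha).2
    by_cases haP : a ∈ P
    · exact Finset.mem_singleton.2 (hP haP hp)
    · simp [w, haP, hkP' p hp] at h

end rips

/-! ### Compact coordinate sets and simplicial approximation on Rips complexes. -/

section

variable {V : Type u} {K : PreAbstractSimplicialComplex V}

/-- The coordinates with respect to `A` of the points of `|K|` supported in `A`. -/
def coordSet (K : PreAbstractSimplicialComplex V) (A : Finset V) : Set (A → ℝ) :=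
  {c | c ∈ stdSimplex ℝ A ∧ ∃ s ∈ K.faces, ∀ a : A, c a ≠ 0 → a.1 ∈ s}

/-- The set is a finite union of closed faces of a standard simplex. It replaces a finite subcomplex
by a compact metric space, in which Lebesgue numbers are available. -/
lemma isCompact_coordSet (A : Finset V) : IsCompact (coordSet K A) := by
  classical
  have : coordSet K A = ⋃ s : {s : A.powerset // ∃ t ∈ K.faces, s.1 ⊆ t},
      stdSimplex ℝ A ∩ ⋂ a ∈ {a : A | a.1 ∉ s.1.1}, {c | c a = 0} := by
    ext c
    simp only [Set.mem_iUnion]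
    constructor
    · rintro ⟨hc, s, hs, h⟩
      refine ⟨⟨⟨A ∩ s, Finset.mem_powerset.2 Finset.inter_subset_left⟩, s, hs,
        Finset.inter_subset_right⟩, hc, Set.mem_iInter₂.2 fun a ha => ?_⟩
      by_contra h0
      exact ha (Finset.mem_inter.2 ⟨a.2, h a h0⟩)
    · rintro ⟨⟨s, t, ht, hst⟩, hc, h⟩
      refine ⟨hc, t, ht, fun a ha => ?_⟩
      by_contra hat
      exact ha (Set.mem_iInter₂.1 h a fun has => hat (hst has))
  rw [this]
  refine isCompact_iUnion fun s => (isCompact_stdSimplex ℝ A).inter_right ?_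
  exact isClosed_biInter fun a _ => isClosed_eq (continuous_apply a) continuous_const

open Classical in
lemma sum_dite_mem (A : Finset V) (f : A → ℝ) :
    (∑ v ∈ A, if h : v ∈ A then f ⟨v, h⟩ else 0) = ∑ a : A, f a :=
  (Finset.sum_coe_sort A fun v => if h : v ∈ A then f ⟨v, h⟩ else 0).symm.trans
    (Finset.sum_congr rfl fun a _ => dif_pos a.2)

open Classical in
/-- The point of `|K|` with given coordinates. -/
def ofCoord (A : Finset V) (c : coordSet K A) : Realization K :=
  ofWeights A (fun v => if h : v ∈ A then c.1 ⟨v, h⟩ else 0)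
    (fun v hv => by simpa [hv] using c.2.1.1 ⟨v, hv⟩)
    (by
      rw [sum_dite_mem, c.2.1.2]
      exact zero_lt_one)
    (by
      obtain ⟨s, hs, h⟩ := c.2.2
      exact ⟨s, hs, fun v hv h0 => h ⟨v, hv⟩ (by simpa [hv] using h0)⟩)

lemma continuous_ofCoord (A : Finset V) : Continuous (ofCoord (K := K) A) := by
  classical
  refine continuous_ofWeights A (fun (c : coordSet K A) v => if h : v ∈ A then c.1 ⟨v, h⟩ else 0)
    _ _ _ fun v hv => ?_
  simp only [hv, dif_pos]
  exact (continuous_apply _).comp continuous_subtype_val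

/-- The coordinates of a point of `|K|`. -/
def coord (A : Finset V) (c : Realization K) (h : c.1.support ⊆ A) : coordSet K A :=
  ⟨fun a => c.1 a, ⟨fun a => c.2.1 a, by
    have h1 := linearCombination_one c
    rw [linearCombination_eq_sum h, ← Finset.sum_coe_sort] at h1
    simpa using h1⟩, _, c.2.2.2, fun _ ha => Finsupp.mem_support_iff.2 ha⟩

lemma ofCoord_coord (A : Finset V) (c : Realization K) (h : c.1.support ⊆ A) :
    ofCoord A (coord A c h) = c := by
  classical
  refine Subtype.ext (Finsupp.ext fun v => ?_)
  refine (ofWeights_apply _ _ _ _ _ v).trans ?_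
  have hsum : (∑ v ∈ A, if h' : v ∈ A then (coord A c h).1 ⟨v, h'⟩ else 0) = 1 := by
    rw [sum_dite_mem, (coord A c h).2.1.2]
  rw [hsum, div_one]
  by_cases hv : v ∈ A
  · simp [hv, coord]
  · simp only [hv, if_false]
    exact (Finsupp.notMem_support_iff.1 fun h' => hv (h h')).symm

end

variable {X : Type u} [MetricSpace X] [CompactSpace X]

/-- Every map on a Vietoris–Rips complex is, on a smaller Vietoris–Rips complex, homotopic to a
simplicial map. -/
theorem exists_isApprox_of_ripsComplex {W : Type u} {L : PreAbstractSimplicialComplex W} {r : ℝ}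
    (hr : 0 < r) (f : C(Realization (ripsComplex X r), Realization L))
    (ν : C(X, Realization (ripsComplex X r)))
    (hν : ∀ z, ∀ a ∈ (ν z).1.support, dist z a < r / 4) {P : Set X}
    (hP : ∀ p ∈ P, (ν p).1 = Finsupp.single p 1 ∧ ∃ q, (f (ν p)).1 = Finsupp.single q 1) :
    ∃ r' > 0, ∃ (hr' : r' ≤ r) (φ : X → W) (hφ : IsApprox (fun z => f (ν z)) φ r'),
      (f.comp (ripsIncl hr')).HomotopicRel (realize φ hφ.isSimplicial) (verticesIn _ P) := by
  classical
  obtain ⟨A, hA⟩ := exists_finite_support ν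
  have : CompactSpace (coordSet (ripsComplex X r) A) :=
    isCompact_iff_compactSpace.1 (isCompact_coordSet A)
  -- Since `ν` involves only the vertices in `A`, it is enough to find a Lebesgue number `η` for `f`
  -- on the coordinates over `A`. Uniform continuity of the coordinates `N` of `ν` then turns `η`
  -- into a distance in `X`.
  let g : coordSet (ripsComplex X r) A → Realization L := fun c => f (ofCoord A c)
  have hg : Continuous g := f.continuous.comp (continuous_ofCoord A)
  obtain ⟨η, hη, hL⟩ := lebesgue_number_lemma_of_metric
    (isCompact_univ (X := coordSet (ripsComplex X r) A))
    (c := fun w : W => {x | w ∈ (g x).1.support})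
    (fun w => (isOpen_star w).preimage hg) (fun x _ => by
      obtain ⟨w, hw⟩ := support_nonempty (g x)
      exact Set.mem_iUnion.2 ⟨w, hw⟩)
  choose φ hφ using fun x => hL x trivial
  let N : X → coordSet (ripsComplex X r) A := fun z => coord A (ν z) (hA z)
  have hN : Continuous N := Continuous.subtype_mk (continuous_pi fun a : A =>
    (continuous_coord a.1).comp ν.continuous) _
  have hgN : ∀ z, g (N z) = f (ν z) := fun z => congrArg f (ofCoord_coord A (ν z) (hA z))
  obtain ⟨r₁, hr₁, hN'⟩ := Metric.uniformContinuous_iff.1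
    (CompactSpace.uniformContinuous_of_continuous hN) η hη
  have happ : IsApprox (fun z => f (ν z)) (fun z => φ (N z)) (min r₁ (r / 4)) :=
    fun z w hzw => by
      have h := hφ (N w) (hN' (hzw.trans_le (min_le_left _ _)))
      change φ (N w) ∈ (g (N z)).1.support at h
      rwa [hgN z] at h
  have hle : min r₁ (r / 4) ≤ r := (min_le_right _ _).trans (by linarith)
  refine ⟨min r₁ (r / 4), by positivity, hle, _, happ, ?_⟩
  -- `f` is compared with `f ∘ e`, where `e` is linear and agrees with `ν` on the vertices
  have hface : ∀ s ∈ (ripsComplex X (min r₁ (r / 4))).faces, ∃ t ∈ (ripsComplex X r).faces,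
      s ⊆ t ∧ ∀ z ∈ s, (ν z).1.support ⊆ t := by
    intro s hs
    have hne : (s ∪ s.biUnion fun z => (ν z).1.support).Nonempty :=
      hs.1.mono Finset.subset_union_left
    refine ⟨_, (mem_ripsComplex hne).2 ?_, Finset.subset_union_left, fun z hz =>
      (Finset.subset_biUnion_of_mem (fun z => (ν z).1.support) hz).trans
        Finset.subset_union_right⟩
    -- Vertices of `s` are less than `r / 4` apart and each point of the union is that close to one
    -- of them, so two points of the union are less than `3r / 4` apart.
    have key : ∀ a ∈ s ∪ s.biUnion fun z => (ν z).1.support, ∃ z ∈ s, dist z a < r / 4 := by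
      intro a ha
      rcases Finset.mem_union.1 ha with ha | ha
      · exact ⟨a, ha, by rw [dist_self]; positivity⟩
      · obtain ⟨z, hz, hza⟩ := Finset.mem_biUnion.1 ha
        exact ⟨z, hz, hν z a hza⟩
    intro a ha b hb
    obtain ⟨z, hz, hza⟩ := key a ha
    obtain ⟨z', hz', hzb⟩ := key b hb
    have h1 := ((mem_ripsComplex hs.1).1 hs z hz z' hz').trans_le (min_le_right _ _)
    have h2 := dist_triangle4_left z z' a b
    linarith
  have hface' : ∀ s ∈ (ripsComplex X (min r₁ (r / 4))).faces, ∃ t ∈ (ripsComplex X r).faces,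
      ∀ z ∈ s, (ν z).1.support ⊆ t := fun s hs =>
    let ⟨t, ht, h⟩ := hface s hs
    ⟨t, ht, h.2⟩
  let e : C(Realization (ripsComplex X (min r₁ (r / 4))), Realization (ripsComplex X r)) :=
    ⟨linearExtension ν hface', continuous_linearExtension _ _ A hA⟩
  have he : (ripsIncl hle).HomotopicRel e (verticesIn _ P) := by
    refine Contiguous.homotopicRel (fun c => ?_) fun c ⟨p, hp, hc⟩ => ?_
    · obtain ⟨t, ht, h1, h2⟩ := hface _ c.2.2.2
      refine ⟨t, ht, fun a ha => h1 ?_, fun a ha => ?_⟩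
      · rwa [ripsIncl_val] at ha
      · obtain ⟨z, hz, hza⟩ := mem_support_linearExtension (hν := hface') ha
        exact h2 z hz hza
    · refine Subtype.ext ?_
      rw [ripsIncl_val, hc, ← (hP p hp).1]
      exact (congrArg Subtype.val (linearExtension_single (hν := hface') hc)).symm
  have hcarrier : ∀ c : Realization (ripsComplex X (min r₁ (r / 4))), ∀ v ∈ c.1.support,
      φ (N v) ∈ (f (e c)).1.support := by
    intro c v hv
    have h1 : e c = ofCoord A (coord A (e c) fun a ha => by
        obtain ⟨z, -, hza⟩ := mem_support_linearExtension (hν := hface') ha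
        exact hA z hza) := (ofCoord_coord A _ _).symm
    rw [h1]
    refine hφ (N v) (Metric.mem_ball.2 (?_ : dist (fun a : A => (e c).1 a) (N v).1 < η))
    have h2 : (fun a : A => (e c).1 a) = ∑ z ∈ c.1.support, c.1 z • (N z).1 := by
      funext a
      refine (linearExtension_apply ν hface' c a).trans ?_
      rw [Finset.sum_apply]
      rfl
    rw [h2, ← Metric.mem_ball]
    -- The coordinates of `e c` are a convex combination of the vectors `N z` over the vertices `z`
    -- of `c`. All of these lie in the ball of radius `η` about `N v`, hence so does the
    -- combination.
    refine (convex_ball (N v).1 η).sum_mem (fun z _ => c.2.1 z) ?_ fun z hz => ?_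
    · have := linearCombination_one c
      rwa [linearCombination_eq_sum subset_rfl, Finset.sum_congr rfl fun _ _ => mul_one _] at this
    · exact hN' ((dist_lt_of_mem_support c hz hv).trans_le (min_le_left _ _))
  refine (he.comp_continuousMap f).trans (Contiguous.homotopicRel (fun c =>
    ⟨_, (f (e c)).2.2.2, subset_rfl, fun w hw => ?_⟩) fun c ⟨p, hp, hc⟩ => ?_)
  · obtain ⟨v, hv, rfl⟩ := (mem_support_realize (hf := happ.isSimplicial)).1 hw
    exact hcarrier c v hv
  · obtain ⟨-, q, hq⟩ := hP p hp
    have h1 : e c = ν p := linearExtension_single (hν := hface') hc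
    refine Subtype.ext ?_
    rw [realize_single (hf := happ.isSimplicial) hc, happ.apply_eq (by positivity) hq, ← hq, ← h1]
    rfl

/-- Maps on a Vietoris–Rips complex that become homotopic on `X` become homotopic on a smaller
Vietoris–Rips complex. -/
theorem exists_homotopicRel_ripsIncl {W : Type u} {L : PreAbstractSimplicialComplex W} {r : ℝ}
    (hr : 0 < r) (f f' : C(Realization (ripsComplex X r), Realization L))
    (ν : C(X, Realization (ripsComplex X r)))
    (hν : ∀ z, ∀ a ∈ (ν z).1.support, dist z a < r / 4) {P : Set X}
    (hP : ∀ p ∈ P, (ν p).1 = Finsupp.single p 1 ∧ ∃ q, (f (ν p)).1 = Finsupp.single q 1)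
    (h : (f.comp ν).HomotopicRel (f'.comp ν) P) :
    ∃ r' > 0, ∃ hr' : r' ≤ r,
      (f.comp (ripsIncl hr')).HomotopicRel (f'.comp (ripsIncl hr')) (verticesIn _ P) := by
  obtain ⟨H⟩ := h
  have hH : ∀ p ∈ P, ∃ q, ∀ t, (H.toContinuousMap (t, p)).1 = Finsupp.single q 1 := by
    intro p hp
    obtain ⟨-, q, hq⟩ := hP p hp
    refine ⟨q, fun t => ?_⟩
    rw [← hq]
    exact congrArg Subtype.val (H.eq_fst t hp)
  have hP' : ∀ p ∈ P, (ν p).1 = Finsupp.single p 1 ∧ ∃ q, (f' (ν p)).1 = Finsupp.single q 1 := by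
    intro p hp
    obtain ⟨h1, q, hq⟩ := hP p hp
    refine ⟨h1, q, ?_⟩
    rw [← hq]
    exact congrArg Subtype.val ((H.eq_snd 1 hp).symm.trans (H.eq_fst 1 hp))
  obtain ⟨r₁, hr₁, hle₁, φ₁, hφ₁, h₁⟩ := exists_isApprox_of_ripsComplex hr f ν hν hP
  obtain ⟨r₂, hr₂, hle₂, φ₂, hφ₂, h₂⟩ := exists_isApprox_of_ripsComplex hr f' ν hν hP'
  obtain ⟨r₃, hr₃, φ, ψ, hφ, hψ, h₃⟩ := exists_isApprox_of_homotopy H.toContinuousMap hH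
  have hφ' : IsApprox (fun z => f (ν z)) φ r₃ := by
    convert hφ using 2 with z
    exact (H.apply_zero z).symm
  have hψ' : IsApprox (fun z => f' (ν z)) ψ r₃ := by
    convert hψ using 2 with z
    exact (H.apply_one z).symm
  obtain ⟨s, hs, hs₁, hs₂, hs₃⟩ : ∃ s > 0, s ≤ r₁ ∧ s ≤ r₂ ∧ s ≤ r₃ :=
    ⟨min r₁ (min r₂ r₃), by positivity, min_le_left _ _,
      (min_le_right _ _).trans (min_le_left _ _), (min_le_right _ _).trans (min_le_right _ _)⟩
  refine ⟨s, hs, hs₁.trans hle₁, ?_⟩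
  have hmaps : ∀ {a b : ℝ} (hab : a ≤ b), Set.MapsTo (ripsIncl (X := X) hab)
      (verticesIn _ P) (verticesIn _ P) := fun hab c ⟨p, hp, hc⟩ =>
    ⟨p, hp, (ripsIncl_val hab c).trans hc⟩
  have hcomp : ∀ {a b : ℝ} (hab : a ≤ b) {χ : X → W}
      (hχ : IsSimplicial (ripsComplex X b) L χ) (hχ' : IsSimplicial (ripsComplex X a) L χ),
      (realize χ hχ).comp (ripsIncl hab) = realize χ hχ' := fun hab χ hχ hχ' =>
    realize_comp_realize _ hχ hχ'
  have hincl : ∀ {a b c : ℝ} (hab : a ≤ b) (hbc : b ≤ c),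
      (ripsIncl (X := X) hbc).comp (ripsIncl hab) = ripsIncl (hab.trans hbc) := fun hab hbc =>
    realize_comp_realize _ _ _
  have e₁ := HomotopicRel.comp_right h₁ (ripsIncl hs₁) (hmaps hs₁)
  have e₂ := HomotopicRel.comp_right h₂ (ripsIncl hs₂) (hmaps hs₂)
  have e₃ := HomotopicRel.comp_right h₃ (ripsIncl hs₃) (hmaps hs₃)
  rw [hcomp hs₁ _ (hφ₁.mono hs₁).isSimplicial, ContinuousMap.comp_assoc, hincl] at e₁
  rw [hcomp hs₂ _ (hφ₂.mono hs₂).isSimplicial, ContinuousMap.comp_assoc, hincl] at e₂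
  rw [hcomp hs₃ _ (hφ.mono hs₃).isSimplicial, hcomp hs₃ _ (hψ.mono hs₃).isSimplicial] at e₃
  -- At the common scale `s` the chain runs from `f` through `φ₁`, `φ`, `ψ`, `φ₂` to `f'`. The links
  -- `φ₁`–`φ` and `ψ`–`φ₂` join two approximations of the same map on `X`.
  have e₄ := (hφ₁.mono hs₁).homotopicRel (hφ'.mono hs₃) hs fun p hp => (hP p hp).2
  have e₅ := (hψ'.mono hs₃).homotopicRel (hφ₂.mono hs₂) hs fun p hp => (hP' p hp).2
  exact e₁.trans (e₄.trans (e₃.trans (e₅.trans e₂.symm)))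

/-! ### Expansions -/

open Opposite

/-- `proj` is a `P`-expansion of `X` indexed by a preorder in an arbitrary universe. -/
structure IsExpansion {T : Type v} [Category.{w} T] (P : ObjectProperty T) {X : T} {J : Type*}
    [Preorder J] (sys : Jᵒᵖ ⥤ T) (proj : (Functor.const Jᵒᵖ).obj X ⟶ sys) : Prop where
  sys_mem : ∀ l : J, P (sys.obj (.op l))
  factor : ∀ Q : T, P Q → ∀ h : X ⟶ Q,
    ∃ (l : J) (f : sys.obj (.op l) ⟶ Q), proj.app (.op l) ≫ f = h
  unique : ∀ Q : T, P Q → ∀ (l : J) (f f' : sys.obj (.op l) ⟶ Q),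
    proj.app (.op l) ≫ f = proj.app (.op l) ≫ f' →
      ∃ (l' : J) (hl : l ≤ l'), sys.map (homOfLE hl).op ≫ f = sys.map (homOfLE hl).op ≫ f'

lemma Expansion.isExpansion {T : Type v} [Category.{w} T] {P : ObjectProperty T} {X : T}
    (E : Expansion.{u} P X) : IsExpansion P E.sys E.proj :=
  ⟨E.sys_mem, E.factor, E.unique⟩

namespace IsExpansion

variable {T : Type v} [Category.{w} T] {P : ObjectProperty T} {X : T} {J : Type*}
    [Preorder J] {sys : Jᵒᵖ ⥤ T} {proj : (Functor.const Jᵒᵖ).obj X ⟶ sys}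

/-- An expansion as a functor to the category of morphisms from `X` to objects of `P`. -/
def toStructuredArrow (h : IsExpansion P sys proj) : Jᵒᵖ ⥤ StructuredArrow X P.ι where
  obj i := StructuredArrow.mk (Y := (⟨sys.obj i, h.sys_mem i.unop⟩ : P.FullSubcategory))
    (proj.app i)
  map f := StructuredArrow.homMk (P.homMk (sys.map f)) (by
    have := proj.naturality f
    simp only [Functor.const_obj_obj, Functor.const_obj_map, Category.id_comp] at this
    exact this.symm)
  map_id i := by
    ext
    simp
  map_comp f g := by
    ext
    simp

lemma proj_comp_map {l l' : J} (hl : l ≤ l') :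
    proj.app (op l') ≫ sys.map (homOfLE hl).op = proj.app (op l) := by
  have := proj.naturality (homOfLE hl).op
  simp only [Functor.const_obj_obj, Functor.const_obj_map, Category.id_comp] at this
  exact this.symm

lemma map_comp_map {l l' l'' : J} (hl : l ≤ l') (hl' : l' ≤ l'') :
    sys.map (homOfLE hl').op ≫ sys.map (homOfLE hl).op = sys.map (homOfLE (hl.trans hl')).op := by
  rw [← Functor.map_comp]
  rfl

/-- The factorization property says that the relevant comma categories are nonempty. Uniqueness,
with directedness, says that any two of their objects receive arrows from a third, so they are
connected. -/
lemma initial_toStructuredArrow [IsDirectedOrder J] (h : IsExpansion P sys proj) :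
    h.toStructuredArrow.Initial where
  out d := by
    let φ : ∀ a : CostructuredArrow h.toStructuredArrow d,
        sys.obj (op a.left.unop) ⟶ d.right.obj := fun a => a.hom.right.hom
    have hom : ∀ {a b : CostructuredArrow h.toStructuredArrow d} (g : b.left.unop ≤ a.left.unop),
        sys.map (homOfLE g).op ≫ φ b = φ a → Nonempty (a ⟶ b) := by
      intro a b g hg
      refine ⟨CostructuredArrow.homMk (homOfLE g).op ?_⟩
      ext
      exact hg
    have hw : ∀ a, proj.app (op a.left.unop) ≫ φ a = d.hom := fun a => StructuredArrow.w a.hom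
    have : Nonempty (CostructuredArrow h.toStructuredArrow d) := by
      obtain ⟨l, f, hf⟩ := h.factor _ d.right.2 d.hom
      exact ⟨CostructuredArrow.mk (Y := op l) (StructuredArrow.homMk (P.homMk f) hf)⟩
    refine zigzag_isConnected fun a b => ?_
    obtain ⟨k, hka, hkb⟩ := directed_of (· ≤ ·) a.left.unop b.left.unop
    obtain ⟨l, hl, hl'⟩ := h.unique _ d.right.2 k (sys.map (homOfLE hka).op ≫ φ a)
      (sys.map (homOfLE hkb).op ≫ φ b) (by
        rw [← Category.assoc, ← Category.assoc, proj_comp_map, proj_comp_map, hw, hw])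
    rw [← Category.assoc, ← Category.assoc, map_comp_map, map_comp_map] at hl'
    let c : CostructuredArrow h.toStructuredArrow d := CostructuredArrow.mk (Y := op l)
      (StructuredArrow.homMk (P.homMk (sys.map (homOfLE (hka.trans hl)).op ≫ φ a)) (by
        change proj.app (op l) ≫ _ ≫ φ a = _
        rw [← Category.assoc, proj_comp_map, hw]))
    obtain ⟨f⟩ : Nonempty (c ⟶ a) := hom (hka.trans hl) rfl
    obtain ⟨g⟩ : Nonempty (c ⟶ b) := hom (hkb.trans hl) hl'.symm
    exact (Zigzag.of_inv f).trans (Zigzag.of_hom g)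

/-- Functors to a category with limits take the same limit on all expansions of an object. -/
theorem nonempty_limit_iso [IsDirectedOrder J] (h : IsExpansion P sys proj) {J' : Type*}
    [Preorder J'] [IsDirectedOrder J'] {sys' : J'ᵒᵖ ⥤ T}
    {proj' : (Functor.const J'ᵒᵖ).obj X ⟶ sys'} (h' : IsExpansion P sys' proj') {C : Type*}
    [Category C] (F : T ⥤ C) [HasLimit (sys ⋙ F)] [HasLimit (sys' ⋙ F)] :
    Nonempty (limit (sys ⋙ F) ≅ limit (sys' ⋙ F)) := by
  let G : StructuredArrow X P.ι ⥤ C := StructuredArrow.proj X P.ι ⋙ P.ι ⋙ F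
  have := h.initial_toStructuredArrow
  have := h'.initial_toStructuredArrow
  let e : h.toStructuredArrow ⋙ G ≅ sys ⋙ F := NatIso.ofComponents (fun _ => Iso.refl _)
    fun f => (Category.comp_id _).trans (Category.id_comp _).symm
  let e' : h'.toStructuredArrow ⋙ G ≅ sys' ⋙ F := NatIso.ofComponents (fun _ => Iso.refl _)
    fun f => (Category.comp_id _).trans (Category.id_comp _).symm
  have : HasLimit (h.toStructuredArrow ⋙ G) := hasLimit_of_iso e.symm
  have : HasLimit (h'.toStructuredArrow ⋙ G) := hasLimit_of_iso e'.symm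
  -- The category of arrows out of `X` may be large; the limit of `G` exists because it can be
  -- computed along the initial functor.
  have : HasLimit G := Functor.Initial.hasLimit_of_comp h.toStructuredArrow
  exact ⟨(HasLimit.isoOfNatIso e).symm ≪≫ Functor.Initial.limitIso h.toStructuredArrow G ≪≫
    (Functor.Initial.limitIso h'.toStructuredArrow G).symm ≪≫ HasLimit.isoOfNatIso e'⟩

/-- An inverse sequence that is interleaved with an expansion is an expansion. -/
theorem of_interleaving [IsDirectedOrder J] (h : IsExpansion P sys proj) (Y : ℕᵒᵖ ⥤ T)
    (hY : ∀ n, P (Y.obj (op n))) (d : ℕ → J)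
    (β : ∀ n, sys.obj (op (d n)) ⟶ Y.obj (op n))
    (hβ : ∀ n, ∃ (i : J) (h₁ : d n ≤ i) (h₂ : d (n + 1) ≤ i),
      sys.map (homOfLE h₂).op ≫ β (n + 1) ≫ Y.map (homOfLE n.le_succ).op =
        sys.map (homOfLE h₁).op ≫ β n)
    (hα : ∀ n i, ∀ hi : d n ≤ i, ∃ (l : ℕ) (hl : n ≤ l) (α : Y.obj (op l) ⟶ sys.obj (op i)),
      α ≫ sys.map (homOfLE hi).op ≫ β n = Y.map (homOfLE hl).op ∧
        ∃ (k : J) (h₁ : d l ≤ k) (h₂ : i ≤ k),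
          sys.map (homOfLE h₁).op ≫ β l ≫ α = sys.map (homOfLE h₂).op) :
    ∃ proj' : (Functor.const ℕᵒᵖ).obj X ⟶ Y, IsExpansion P Y proj' := by
  -- The maps `β` commute with the bonding maps only at some later index `i`. This suffices, because
  -- the projections of `X` factor through that index.
  let proj' : (Functor.const ℕᵒᵖ).obj X ⟶ Y :=
    NatTrans.ofOpSequence (fun n => proj.app (op (d n)) ≫ β n) fun n => by
      obtain ⟨i, h₁, h₂, e⟩ := hβ n
      simp only [Functor.const_obj_obj, Functor.const_obj_map, Category.id_comp]
      rw [← proj_comp_map h₁, ← proj_comp_map h₂, Category.assoc, Category.assoc, ← e,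
        Category.assoc]
  have happ : ∀ n, proj'.app (op n) = proj.app (op (d n)) ≫ β n := fun n => rfl
  refine ⟨proj', hY, fun Q hQ g => ?_, fun Q hQ n f f' hff => ?_⟩
  -- A factorization through the given expansion, at an index beyond `d 0`, is carried to `Y` by
  -- composition with `α`.
  · obtain ⟨i, f, rfl⟩ := h.factor Q hQ g
    obtain ⟨j, hij, hj⟩ := directed_of (· ≤ ·) i (d 0)
    obtain ⟨l, -, α, -, k, h₁, h₂, e⟩ := hα 0 j hj
    refine ⟨l, α ≫ sys.map (homOfLE hij).op ≫ f, ?_⟩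
    rw [happ, ← proj_comp_map h₁]
    have := congrArg (fun m => proj.app (op k) ≫ m ≫ sys.map (homOfLE hij).op ≫ f) e
    simp only [Category.assoc] at this ⊢
    rw [this, ← Category.assoc, proj_comp_map, ← Category.assoc, proj_comp_map]
  -- The two maps agree after composition with `β n` at some later index `i`, and a bonding map of
  -- `Y` factors through that composite by way of `α`.
  · rw [happ, Category.assoc, Category.assoc] at hff
    obtain ⟨i, hi, e⟩ := h.unique Q hQ (d n) _ _ hff
    obtain ⟨l, hl, α, hα, -⟩ := hα n i hi
    refine ⟨l, hl, ?_⟩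
    rw [← hα]
    simp only [Category.assoc]
    rw [e]

end IsExpansion

/-! ### The expansion given by the Vietoris–Rips complexes -/

lemma Realization.ext {V : Type u} {K : PreAbstractSimplicialComplex V} {c d : Realization K}
    (h : c.1 = d.1) : c = d := Subtype.ext h

lemma homotopicRel_of_eq {X Y : Type*} [TopologicalSpace X] [TopologicalSpace Y] {f g : C(X, Y)}
    {S : Set X} (h : f = g) : f.HomotopicRel g S := h ▸ .refl f

/-- Free homotopy is expressed as homotopy relative to `∅`, so that the relative theorems serve the
free and the pointed case alike. -/
lemma HTop.ofMap_eq_iff {X Y : Type u} [TopologicalSpace X] [TopologicalSpace Y] {f g : C(X, Y)} :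
    HTop.ofMap f = HTop.ofMap g ↔ f.HomotopicRel g ∅ :=
  (Quotient.functor_map_eq_iff homotopyRel _ _).trans ContinuousMap.homotopicRel_empty.symm

lemma HTop.exists_ofMap {X Y : Type u} [TopologicalSpace X] [TopologicalSpace Y]
    (h : HTop.of X ⟶ HTop.of Y) : ∃ f : C(X, Y), HTop.ofMap f = h := by
  obtain ⟨f, rfl⟩ := (CategoryTheory.Quotient.functor homotopyRel).map_surjective h
  exact ⟨f.hom, rfl⟩

lemma HTop.ofMap_comp {X Y Z : Type u} [TopologicalSpace X] [TopologicalSpace Y]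
    [TopologicalSpace Z] (f : C(X, Y)) (g : C(Y, Z)) :
    HTop.ofMap f ≫ HTop.ofMap g = HTop.ofMap (g.comp f) := rfl

lemma HPTop.ofMap_eq_iff {X Y : Type u} [TopologicalSpace X] [TopologicalSpace Y] {x : X} {y : Y}
    {f g : C(X, Y)} {hf : f x = y} {hg : g x = y} :
    HPTop.ofMap f hf = HPTop.ofMap g hg ↔ f.HomotopicRel g {x} :=
  Quotient.functor_map_eq_iff pointedHomotopyRel _ _

lemma HPTop.exists_ofMap {X Y : Type u} [TopologicalSpace X] [TopologicalSpace Y] {x : X} {y : Y}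
    (h : HPTop.of X x ⟶ HPTop.of Y y) : ∃ (f : C(X, Y)) (hf : f x = y), HPTop.ofMap f hf = h := by
  obtain ⟨f, rfl⟩ := (CategoryTheory.Quotient.functor pointedHomotopyRel).map_surjective h
  exact ⟨f.1, f.2, rfl⟩

lemma HPTop.ofMap_comp {X Y Z : Type u} [TopologicalSpace X] [TopologicalSpace Y]
    [TopologicalSpace Z] {x : X} {y : Y} {z : Z} (f : C(X, Y)) (hf : f x = y) (g : C(Y, Z))
    (hg : g y = z) :
    HPTop.ofMap f hf ≫ HPTop.ofMap g hg =
      HPTop.ofMap (g.comp f) (by rw [ContinuousMap.comp_apply, hf, hg]) := rfl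

lemma verticesIn_empty {V : Type u} (K : PreAbstractSimplicialComplex V) :
    verticesIn K ∅ = ∅ := by
  ext
  simp [verticesIn]

lemma verticesIn_singleton {V : Type u} (K : PreAbstractSimplicialComplex V) (v : V)
    (hv : {v} ∈ K.faces) : verticesIn K {v} = {vertexPoint K v hv} := by
  ext c
  constructor
  · rintro ⟨p, rfl, hc⟩
    exact Subtype.ext hc
  · rintro rfl
    exact ⟨v, rfl, rfl⟩

/-- The scales of Vietoris–Rips complexes, smaller ones being later. -/
abbrev Scale : Type u := ULift.{u} {r : ℝ // 0 < r}ᵒᵈ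

/-- The positive number underlying a scale. -/
def Scale.val (l : Scale.{u}) : ℝ := (OrderDual.ofDual l.down).1

lemma Scale.val_pos (l : Scale.{u}) : 0 < l.val := (OrderDual.ofDual l.down).2

/-- A positive number, as a scale. -/
def Scale.mk (r : ℝ) (hr : 0 < r) : Scale.{u} := ⟨OrderDual.toDual ⟨r, hr⟩⟩

lemma Scale.val_le {l l' : Scale.{u}} (h : l ≤ l') : l'.val ≤ l.val := h

section

variable (X : Type u) [MetricSpace X]

lemma ripsIncl_refl (r : ℝ) : ripsIncl (X := X) (le_refl r) = .id _ :=
  ContinuousMap.ext fun c => Realization.ext (ripsIncl_val _ c)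

lemma ripsIncl_comp_ripsIncl {r s t : ℝ} (h : r ≤ s) (h' : s ≤ t) :
    (ripsIncl (X := X) h').comp (ripsIncl h) = ripsIncl (h.trans h') :=
  ContinuousMap.ext fun c => Realization.ext
    ((ripsIncl_val h' _).trans ((ripsIncl_val h c).trans (ripsIncl_val (h.trans h') c).symm))

/-- The inverse system of Vietoris–Rips complexes. -/
def ripsSystem : Scale.{u}ᵒᵖ ⥤ HTop.{u} where
  obj l := HTop.of (Realization (ripsComplex X l.unop.val))
  map f := HTop.ofMap (ripsIncl (Scale.val_le (leOfHom f.unop)))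
  map_id _ := (congrArg HTop.ofMap (ripsIncl_refl X _)).trans (CategoryTheory.Functor.map_id _ _)
  map_comp f g := (congrArg HTop.ofMap (ripsIncl_comp_ripsIncl X
    (Scale.val_le (leOfHom f.unop)) (Scale.val_le (leOfHom g.unop)))).symm

variable {X}

/-- The base point of a Vietoris–Rips complex. -/
abbrev ripsVertex (l : Scale.{u}) (x : X) : Realization (ripsComplex X l.val) :=
  vertexPoint _ x (singleton_mem_ripsComplex l.val_pos x)

/-- The inverse system of pointed Vietoris–Rips complexes. -/
def pointedRipsSystem (x : X) : Scale.{u}ᵒᵖ ⥤ HPTop.{u} where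
  obj l := HPTop.of (Realization (ripsComplex X l.unop.val)) (ripsVertex l.unop x)
  map f := HPTop.ofMap (ripsIncl (Scale.val_le (leOfHom f.unop)))
    (Realization.ext (ripsIncl_val _ _))
  map_id _ := (HPTop.ofMap_eq_iff (hg := rfl).2 (homotopicRel_of_eq (ripsIncl_refl X _))).trans
    (CategoryTheory.Functor.map_id (CategoryTheory.Quotient.functor pointedHomotopyRel) _)
  map_comp f g := HPTop.ofMap_eq_iff.2 (homotopicRel_of_eq (ripsIncl_comp_ripsIncl X
    (Scale.val_le (leOfHom f.unop)) (Scale.val_le (leOfHom g.unop))).symm)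

variable [CompactSpace X]

/-- A map from `X` to a Vietoris–Rips complex that moves points little and fixes `P`. -/
def fineMap {P : Set X} (hP : P.Subsingleton) (l : Scale.{u}) :
    C(X, Realization (ripsComplex X l.val)) :=
  (exists_fine_map l.val_pos hP).choose

lemma dist_lt_of_mem_support_fineMap {P : Set X} (hP : P.Subsingleton) (l : Scale.{u}) (z a : X)
    (ha : a ∈ (fineMap hP l z).1.support) : dist z a < l.val / 4 :=
  (exists_fine_map l.val_pos hP).choose_spec.1 z a ha

lemma fineMap_apply {P : Set X} (hP : P.Subsingleton) (l : Scale.{u}) {p : X} (hp : p ∈ P) :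
    (fineMap hP l p).1 = Finsupp.single p 1 :=
  (exists_fine_map l.val_pos hP).choose_spec.2 p hp

lemma fineMap_apply_singleton (x : X) (l : Scale.{u}) :
    fineMap (Set.subsingleton_singleton (a := x)) l x = ripsVertex l x :=
  Realization.ext (fineMap_apply _ l rfl)

/-- Both values at `z` are supported within a quarter of the larger scale from `z`, so their
supports span a common simplex at that scale. At a base point both values are the same vertex. -/
lemma ripsIncl_comp_fineMap {P : Set X} (hP : P.Subsingleton) {l l' : Scale.{u}} (h : l ≤ l') :
    ((ripsIncl (Scale.val_le h)).comp (fineMap hP l')).HomotopicRel (fineMap hP l) P := by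
  classical
  have h' := Scale.val_le h
  refine Contiguous.homotopicRel (fun z => ?_) fun p hp => Realization.ext ?_
  · have hne : ((fineMap hP l z).1.support ∪ (fineMap hP l' z).1.support).Nonempty :=
      (support_nonempty _).mono Finset.subset_union_left
    have key : ∀ a ∈ (fineMap hP l z).1.support ∪ (fineMap hP l' z).1.support,
        dist z a < l.val / 4 := fun a ha => by
      rcases Finset.mem_union.1 ha with ha | ha
      · exact dist_lt_of_mem_support_fineMap hP l z a ha
      · exact (dist_lt_of_mem_support_fineMap hP l' z a ha).trans_le (by linarith)
    refine ⟨_, (mem_ripsComplex hne).2 fun a ha b hb => ?_, fun a ha =>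
      Finset.mem_union_right _ ?_, Finset.subset_union_left⟩
    · have h1 := key a ha
      have h2 := key b hb
      have h3 := dist_triangle_left a b z
      have := l.val_pos
      linarith
    · have := ripsIncl_val (Scale.val_le h) (fineMap hP l' z)
      change a ∈ (ripsIncl (Scale.val_le h) (fineMap hP l' z)).1.support at ha
      rwa [this] at ha
  · exact (ripsIncl_val h' _).trans ((fineMap_apply hP l' hp).trans (fineMap_apply hP l hp).symm)

/-- The projections of `X` to its Vietoris–Rips complexes. -/
def ripsProj : (Functor.const Scale.{u}ᵒᵖ).obj (HTop.of X) ⟶ ripsSystem X where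
  app l := HTop.ofMap (fineMap (X := X) Set.subsingleton_empty l.unop)
  naturality l l' f := by
    refine (Category.id_comp _).trans ?_
    exact (HTop.ofMap_eq_iff.2 (ripsIncl_comp_fineMap _ (leOfHom f.unop))).symm

/-- The projections of a pointed space to its Vietoris–Rips complexes. -/
def pointedRipsProj (x : X) :
    (Functor.const Scale.{u}ᵒᵖ).obj (HPTop.of X x) ⟶ pointedRipsSystem x where
  app l := HPTop.ofMap (fineMap Set.subsingleton_singleton l.unop) (fineMap_apply_singleton x _)
  naturality l l' f := by
    refine (Category.id_comp _).trans ?_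
    exact (HPTop.ofMap_eq_iff.2 (ripsIncl_comp_fineMap _ (leOfHom f.unop))).symm

lemma exists_ripsComplex_factor {Q : HTop.{u}} (hQ : HPol Q) (h : HTop.of X ⟶ Q) :
    ∃ (l : Scale.{u}) (f : HTop.of (Realization (ripsComplex X l.val)) ⟶ Q),
      HTop.ofMap (fineMap Set.subsingleton_empty l) ≫ f = h := by
  obtain ⟨W, L, ⟨e⟩⟩ := hQ
  obtain ⟨g, hg⟩ := HTop.exists_ofMap (h ≫ e.hom)
  obtain ⟨r, hr, φ, hφ⟩ := exists_isApprox g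
  obtain ⟨l, rfl⟩ : ∃ l : Scale.{u}, l.val = r := ⟨Scale.mk r hr, rfl⟩
  refine ⟨l, HTop.ofMap (realize φ hφ.isSimplicial) ≫ e.inv, ?_⟩
  rw [← cancel_mono e.hom, Category.assoc, Category.assoc, Iso.inv_hom_id, Category.comp_id, ← hg]
  refine (HTop.ofMap_comp _ _).trans (HTop.ofMap_eq_iff.2 ?_)
  refine hφ.comp_homotopicRel hr _ (fun z a ha => ?_) (by simp)
  exact (dist_lt_of_mem_support_fineMap _ _ z a ha).trans (by linarith)

lemma exists_ripsIncl_comp_eq {Q : HTop.{u}} (hQ : HPol Q) (l : Scale.{u})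
    (f f' : HTop.of (Realization (ripsComplex X l.val)) ⟶ Q)
    (h : HTop.ofMap (fineMap Set.subsingleton_empty l) ≫ f =
      HTop.ofMap (fineMap Set.subsingleton_empty l) ≫ f') :
    ∃ (l' : Scale.{u}) (hl : l ≤ l'), HTop.ofMap (ripsIncl (Scale.val_le hl)) ≫ f =
      HTop.ofMap (ripsIncl (Scale.val_le hl)) ≫ f' := by
  obtain ⟨W, L, ⟨e⟩⟩ := hQ
  obtain ⟨g, hg⟩ := HTop.exists_ofMap (f ≫ e.hom)
  obtain ⟨g', hg'⟩ := HTop.exists_ofMap (f' ≫ e.hom)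
  have h1 : (g.comp (fineMap Set.subsingleton_empty l)).HomotopicRel
      (g'.comp (fineMap Set.subsingleton_empty l)) ∅ := by
    rw [← HTop.ofMap_eq_iff, ← HTop.ofMap_comp, ← HTop.ofMap_comp, hg, hg', ← Category.assoc,
      ← Category.assoc, h]
  obtain ⟨r, hr, hle, h2⟩ := exists_homotopicRel_ripsIncl l.val_pos g g' _
    (dist_lt_of_mem_support_fineMap _ l) (by simp) h1
  obtain ⟨l', rfl⟩ : ∃ l : Scale.{u}, l.val = r := ⟨Scale.mk r hr, rfl⟩
  refine ⟨l', hle, ?_⟩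
  rw [verticesIn_empty, ← HTop.ofMap_eq_iff, ← HTop.ofMap_comp, ← HTop.ofMap_comp, hg, hg'] at h2
  rw [← cancel_mono e.hom, Category.assoc, Category.assoc]
  exact h2

lemma exists_ripsComplex_factor_pointed {x : X} {Q : HPTop.{u}} (hQ : HPPol Q)
    (h : HPTop.of X x ⟶ Q) :
    ∃ (l : Scale.{u}) (f : HPTop.of (Realization (ripsComplex X l.val)) (ripsVertex l x) ⟶ Q),
      HPTop.ofMap (fineMap Set.subsingleton_singleton l) (fineMap_apply_singleton x l) ≫ f = h := by
  obtain ⟨W, L, q, hq, ⟨e⟩⟩ := hQ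
  obtain ⟨g, hgx, hg⟩ := HPTop.exists_ofMap (h ≫ e.hom)
  obtain ⟨r, hr, φ, hφ⟩ := exists_isApprox g
  obtain ⟨l, rfl⟩ : ∃ l : Scale.{u}, l.val = r := ⟨Scale.mk r hr, rfl⟩
  have hgx' : (g x).1 = Finsupp.single q 1 := congrArg Subtype.val hgx
  refine ⟨l, HPTop.ofMap (realize φ hφ.isSimplicial)
    (realize_vertexPoint φ _ _ _ _ hq (hφ.apply_eq hr hgx')) ≫ e.inv, ?_⟩
  rw [← cancel_mono e.hom, Category.assoc, Category.assoc, Iso.inv_hom_id, Category.comp_id, ← hg]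
  refine (HPTop.ofMap_comp _ _ _ _).trans (HPTop.ofMap_eq_iff.2 ?_)
  refine hφ.comp_homotopicRel hr _ (fun z a ha => ?_) ?_
  · exact (dist_lt_of_mem_support_fineMap _ _ z a ha).trans (by linarith)
  · rintro _ rfl
    exact ⟨fineMap_apply _ _ rfl, q, hgx'⟩

lemma exists_ripsIncl_comp_eq_pointed {x : X} {Q : HPTop.{u}} (hQ : HPPol Q) (l : Scale.{u})
    (f f' : HPTop.of (Realization (ripsComplex X l.val)) (ripsVertex l x) ⟶ Q)
    (h : HPTop.ofMap (fineMap Set.subsingleton_singleton l) (fineMap_apply_singleton x l) ≫ f =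
      HPTop.ofMap (fineMap Set.subsingleton_singleton l) (fineMap_apply_singleton x l) ≫ f') :
    ∃ (l' : Scale.{u}) (hl : l ≤ l'),
      HPTop.ofMap (x := ripsVertex l' x) (ripsIncl (Scale.val_le hl))
          (Realization.ext (ripsIncl_val _ _)) ≫ f =
        HPTop.ofMap (ripsIncl (Scale.val_le hl)) (Realization.ext (ripsIncl_val _ _)) ≫ f' := by
  obtain ⟨W, L, q, hq, ⟨e⟩⟩ := hQ
  obtain ⟨g, hgx, hg⟩ := HPTop.exists_ofMap (f ≫ e.hom)
  obtain ⟨g', hgx', hg'⟩ := HPTop.exists_ofMap (f' ≫ e.hom)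
  have h1 : (g.comp (fineMap (Set.subsingleton_singleton (a := x)) l)).HomotopicRel
      (g'.comp (fineMap (Set.subsingleton_singleton (a := x)) l)) {x} := by
    refine HPTop.ofMap_eq_iff.1 (?_ : HPTop.ofMap _ (fineMap_apply_singleton x l) ≫
      HPTop.ofMap g hgx = HPTop.ofMap _ (fineMap_apply_singleton x l) ≫ HPTop.ofMap g' hgx')
    rw [hg, hg', ← Category.assoc, ← Category.assoc, h]
  obtain ⟨r, hr, hle, h2⟩ := exists_homotopicRel_ripsIncl l.val_pos g g' _
    (dist_lt_of_mem_support_fineMap _ l) (by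
      rintro _ rfl
      refine ⟨fineMap_apply _ _ rfl, q, ?_⟩
      rw [fineMap_apply_singleton]
      exact congrArg Subtype.val hgx) h1
  obtain ⟨l', rfl⟩ : ∃ l : Scale.{u}, l.val = r := ⟨Scale.mk r hr, rfl⟩
  refine ⟨l', hle, ?_⟩
  rw [verticesIn_singleton _ x (singleton_mem_ripsComplex l'.val_pos x)] at h2
  have h3 : HPTop.ofMap (ripsIncl hle) (Realization.ext (ripsIncl_val _ _)) ≫ HPTop.ofMap g hgx =
      HPTop.ofMap (x := ripsVertex l' x) (ripsIncl hle)
        (Realization.ext (ripsIncl_val _ _)) ≫ HPTop.ofMap g' hgx' := HPTop.ofMap_eq_iff.2 h2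
  rw [hg, hg'] at h3
  rw [← cancel_mono e.hom, Category.assoc, Category.assoc]
  exact h3

theorem isExpansion_ripsProj : IsExpansion HPol _ (ripsProj (X := X)) where
  sys_mem l := ⟨X, ripsComplex X l.val, ⟨Iso.refl _⟩⟩
  factor _ hQ h := exists_ripsComplex_factor hQ h
  unique _ hQ l f f' h := exists_ripsIncl_comp_eq hQ l f f' h

theorem isExpansion_pointedRipsProj (x : X) : IsExpansion HPPol _ (pointedRipsProj x) where
  sys_mem l := ⟨X, ripsComplex X l.val, x, singleton_mem_ripsComplex l.val_pos x, ⟨Iso.refl _⟩⟩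
  factor _ hQ h := exists_ripsComplex_factor_pointed hQ h
  unique _ hQ l f f' h := exists_ripsIncl_comp_eq_pointed hQ l f f' h

/-- The Vietoris–Rips expansion. -/
theorem nonempty_expansion : Nonempty (Expansion.{u} HPol.{u} (HTop.of X)) :=
  ⟨{  Idx := Scale.{u}
      sys := ripsSystem X
      proj := ripsProj
      sys_mem := isExpansion_ripsProj.sys_mem
      factor := isExpansion_ripsProj.factor
      unique := isExpansion_ripsProj.unique }⟩

/-- The pointed Vietoris–Rips expansion. -/
theorem nonempty_pointed_expansion (x : X) :
    Nonempty (Expansion.{u} HPPol.{u} (HPTop.of X x)) :=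
  ⟨{  Idx := Scale.{u}
      sys := pointedRipsSystem x
      proj := pointedRipsProj x
      sys_mem := (isExpansion_pointedRipsProj x).sys_mem
      factor := (isExpansion_pointedRipsProj x).factor
      unique := (isExpansion_pointedRipsProj x).unique }⟩

end

lemma Scale.le_mk {r : ℝ} {hr : 0 < r} {l : Scale.{u}} (h : r ≤ l.val) : l ≤ Scale.mk r hr := h

/-! ### Sequences of complexes interleaved with the Vietoris–Rips complexes -/

/-- An inverse sequence of simplicial complexes and simplicial maps. -/
structure SimplicialSequence (V : Type u) where
  complex : ℕ → PreAbstractSimplicialComplex V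
  vmap : ℕ → V → V
  isSimplicial : ∀ n, IsSimplicial (complex (n + 1)) (complex n) (vmap n)

namespace SimplicialSequence

variable {V : Type u} (K : SimplicialSequence V)

/-- The vertex map `K_{n+k} → K_n`. -/
def bondMap (n : ℕ) : ℕ → V → V
  | 0 => id
  | k + 1 => bondMap n k ∘ K.vmap (n + k)

lemma isSimplicial_bondMap (n k : ℕ) :
    IsSimplicial (K.complex (n + k)) (K.complex n) (K.bondMap n k) := by
  classical
  induction k with
  | zero => exact fun s hs => ⟨s, hs, by simp [bondMap]⟩
  | succ k ih =>
    refine isSimplicial_of_image_mem fun s hs => ?_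
    have := image_mem ih (image_mem (K.isSimplicial (n + k)) hs)
    rwa [Finset.image_image] at this

/-- The bonding map `|K_{n+1}| → |K_n|`. -/
def bond (n : ℕ) : C(Realization (K.complex (n + 1)), Realization (K.complex n)) :=
  realize (K.vmap n) (K.isSimplicial n)

/-- The map `|K_{n+k}| → |K_n|`. -/
def bonds (n k : ℕ) : C(Realization (K.complex (n + k)), Realization (K.complex n)) :=
  realize (K.bondMap n k) (K.isSimplicial_bondMap n k)

lemma bonds_zero (n : ℕ) : K.bonds n 0 = .id _ :=
  ContinuousMap.ext fun _ => Realization.ext Finsupp.mapDomain_id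

lemma bonds_succ (n k : ℕ) : K.bonds n (k + 1) = (K.bonds n k).comp (K.bond (n + k)) :=
  (realize_comp_realize _ _ _).symm

variable {X : Type u} [MetricSpace X]

/-- The points of `|K_n|` given by the base vertices. -/
def basePoints {P : Set X} (v : ℕ → P → V) (n : ℕ) : Set (Realization (K.complex n)) :=
  {c | ∃ p, c.1 = Finsupp.single (v n p) 1}

/-- Maps between the members of a sequence of complexes and the Vietoris–Rips complexes of `X`
whose composites are homotopic to the bonding maps, relative to the base points. -/
def Interleaved {P : Set X} (v : ℕ → P → V) : Prop :=
  ∃ (d : ℕ → Scale.{u})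
    (β : ∀ n, C(Realization (ripsComplex X (d n).val), Realization (K.complex n))),
    (∀ n (p : P) c, c.1 = Finsupp.single p.1 1 → (β n c).1 = Finsupp.single (v n p) 1) ∧
    (∀ n, ∃ (i : Scale.{u}) (h₁ : d n ≤ i) (h₂ : d (n + 1) ≤ i),
      ((K.bond n).comp ((β (n + 1)).comp (ripsIncl (Scale.val_le h₂)))).HomotopicRel
        ((β n).comp (ripsIncl (Scale.val_le h₁))) (verticesIn _ P)) ∧
    ∀ n i, ∀ hi : d n ≤ i, ∃ (k : ℕ)
      (α : C(Realization (K.complex (n + k)), Realization (ripsComplex X i.val))),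
      (∀ (p : P) c, c.1 = Finsupp.single (v (n + k) p) 1 → (α c).1 = Finsupp.single p.1 1) ∧
      ((β n).comp ((ripsIncl (Scale.val_le hi)).comp α)).HomotopicRel (K.bonds n k)
        (K.basePoints v (n + k)) ∧
      ∃ (j : Scale.{u}) (h₁ : d (n + k) ≤ j) (h₂ : i ≤ j),
        (α.comp ((β (n + k)).comp (ripsIncl (Scale.val_le h₁)))).HomotopicRel
          (ripsIncl (Scale.val_le h₂)) (verticesIn _ P)

/-- A criterion for being interleaved with the Vietoris–Rips complexes in terms of contiguity. -/
theorem interleaved_of_contiguous {P : Set X} (hP : P.Subsingleton) (v : ℕ → P → V)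
    (hv : ∀ n p, K.vmap n (v (n + 1) p) = v n p) (d : ℕ → Scale.{u})
    (β θ : ∀ n, C(Realization (ripsComplex X (d n).val), Realization (K.complex n)))
    (α : ℕ → V → X)
    (hβ : ∀ n (p : P) c, c.1 = Finsupp.single p.1 1 → (β n c).1 = Finsupp.single (v n p) 1)
    (hα : ∀ n p, α n (v n p) = p.1)
    (hβθ : ∀ n, Contiguous (β n) (θ n))
    (hbond : ∀ n, ∃ (i : Scale.{u}) (h₁ : d n ≤ i) (h₂ : d (n + 1) ≤ i),
      Contiguous ((K.bond n).comp ((β (n + 1)).comp (ripsIncl (Scale.val_le h₂))))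
        ((θ n).comp (ripsIncl (Scale.val_le h₁))))
    (hsmall : ∀ r > 0, ∃ l₀, ∀ l ≥ l₀, ∀ s ∈ (K.complex l).faces, ∀ a ∈ s, ∀ b ∈ s,
      dist (α l a) (α l b) < r)
    (hαβ : ∀ r > 0, ∃ l₀, ∀ l ≥ l₀, ∀ c, ∀ a ∈ (β l c).1.support, ∀ z ∈ c.1.support,
      dist (α l a) z < r)
    (hθα : ∀ n, ∃ k₀, ∀ k ≥ k₀,
      ∀ hs : IsSimplicial (K.complex (n + k)) (ripsComplex X (d n).val) (α (n + k)),
        Contiguous (K.bonds n k) ((θ n).comp (realize (α (n + k)) hs))) :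
    K.Interleaved v := by
  classical
  have hv' : ∀ n k p, K.bondMap n k (v (n + k) p) = v n p := by
    intro n k p
    induction k with
    | zero => rfl
    | succ k ih =>
      change K.bondMap n k (K.vmap (n + k) (v (n + k + 1) p)) = _
      rw [hv, ih]
  refine ⟨d, β, hβ, fun n => ?_, fun n i hi => ?_⟩
  · obtain ⟨i, h₁, h₂, h⟩ := hbond n
    -- The two sides need not be contiguous to each other, as `β` has prescribed values at the base
    -- point. Each is contiguous to `θ n`, and both send the base point to the same vertex.
    refine ⟨i, h₁, h₂, homotopicRel_of_contiguous_of_contiguous h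
      ((hβθ n).comp (ripsIncl (Scale.val_le h₁))) ?_⟩
    rintro c ⟨p, hp, hc⟩ c' ⟨p', hp', hc'⟩
    obtain rfl := hP hp hp'
    have e₁ : ∀ c : Realization (ripsComplex X i.val), c.1 = Finsupp.single p 1 →
        (K.bond n (β (n + 1) (ripsIncl (Scale.val_le h₂) c))).1 =
          Finsupp.single (v n ⟨p, hp⟩) 1 := fun c hc => by
      rw [← hv]
      exact realize_single (hf := K.isSimplicial n)
        (hβ (n + 1) ⟨p, hp⟩ _ ((ripsIncl_val _ c).trans hc))
    exact ⟨v n ⟨p, hp⟩, e₁ c hc, hβ n ⟨p, hp⟩ _ ((ripsIncl_val _ c).trans hc), e₁ c' hc'⟩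
  · have hi4 : 0 < i.val / 4 := by have := i.val_pos; positivity
    obtain ⟨l₁, hl₁⟩ := hsmall i.val i.val_pos
    obtain ⟨l₂, hl₂⟩ := hαβ (i.val / 4) hi4
    obtain ⟨k₀, hk₀⟩ := hθα n
    obtain ⟨k, h1, h2, h3⟩ : ∃ k, n + k ≥ l₁ ∧ n + k ≥ l₂ ∧ k ≥ k₀ :=
      ⟨l₁ + l₂ + k₀, by omega, by omega, by omega⟩
    have hs : IsSimplicial (K.complex (n + k)) (ripsComplex X i.val) (α (n + k)) := by
      refine isSimplicial_of_image_mem fun s hs => ?_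
      have hne := ((K.complex (n + k)).isRelLowerSet_faces hs).1
      refine (mem_ripsComplex (hne.image _)).2 fun a ha b hb => ?_
      obtain ⟨a', ha', rfl⟩ := Finset.mem_image.1 ha
      obtain ⟨b', hb', rfl⟩ := Finset.mem_image.1 hb
      exact hl₁ _ h1 s hs a' ha' b' hb'
    have hs' : IsSimplicial (K.complex (n + k)) (ripsComplex X (d n).val) (α (n + k)) :=
      fun s hs₀ =>
        let ⟨t, ht, hts⟩ := hs s hs₀
        ⟨t, ⟨ht.1, ht.2.trans_le (Scale.val_le hi)⟩, hts⟩
    refine ⟨k, realize (α (n + k)) hs, fun p c hc => ?_, ?_, ?_⟩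
    · rw [realize_single hc, hα]
    · rw [show (ripsIncl (Scale.val_le hi)).comp (realize (α (n + k)) hs) =
        realize (α (n + k)) hs' from realize_comp_realize _ _ _]
      refine homotopicRel_of_contiguous_of_contiguous (F := (β n).comp (realize (α (n + k)) hs'))
        (M := (θ n).comp (realize (α (n + k)) hs'))
        ((hβθ n).comp (realize (α (n + k)) hs')) (hk₀ k h3 hs') ?_
      rintro c ⟨p, hc⟩ c' ⟨p', hc'⟩
      obtain rfl : p = p' := Subtype.ext (hP p.2 p'.2)
      have e₁ : ∀ c : Realization (K.complex (n + k)), c.1 = Finsupp.single (v (n + k) p) 1 →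
          (β n (realize (α (n + k)) hs' c)).1 = Finsupp.single (v n p) 1 := fun c hc =>
        hβ n p _ ((realize_single hc).trans (by rw [hα]))
      refine ⟨v n p, e₁ c hc, ?_, e₁ c' hc'⟩
      rw [← hv' n k p]
      exact realize_single (hf := K.isSimplicial_bondMap n k) hc
    -- With the scale of `j` at most a quarter of that of `i`, the vertices of `c` and those of its
    -- image all lie within a quarter of the larger scale from any one vertex of `c`, so they span a
    -- simplex.
    · obtain ⟨j, hj, hij, hdj⟩ : ∃ j : Scale.{u}, j.val ≤ i.val / 4 ∧ i ≤ j ∧ d (n + k) ≤ j := by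
        refine ⟨Scale.mk (min (i.val / 4) (d (n + k)).val) (lt_min hi4 (Scale.val_pos _)),
          min_le_left _ _, Scale.le_mk ?_, Scale.le_mk (min_le_right _ _)⟩
        exact (min_le_left _ _).trans (by linarith)
      refine ⟨j, hdj, hij, Contiguous.homotopicRel (fun c => ?_) ?_⟩
      · have key : ∀ a ∈ (realize (α (n + k)) hs (β (n + k)
            (ripsIncl (Scale.val_le hdj) c))).1.support ∪ c.1.support,
            ∀ z ∈ c.1.support, dist a z < i.val / 4 := by
          intro a ha z hz
          rcases Finset.mem_union.1 ha with ha | ha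
          · obtain ⟨b, hb, rfl⟩ := mem_support_realize.1 ha
            exact hl₂ _ h2 _ b hb z (by rwa [ripsIncl_val])
          · exact (dist_lt_of_mem_support c ha hz).trans_le hj
        refine ⟨_, (mem_ripsComplex ((support_nonempty c).mono Finset.subset_union_right)).2
          fun a ha b hb => ?_, Finset.subset_union_left, ?_⟩
        · obtain ⟨z, hz⟩ := support_nonempty c
          have e1 := key a ha z hz
          have e2 := key b hb z hz
          have e3 := dist_triangle_right a b z
          linarith
        · rw [ripsIncl_val]
          exact Finset.subset_union_right
      · rintro c ⟨p, hp, hc⟩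
        refine Realization.ext ?_
        rw [ripsIncl_val, hc]
        have := hβ (n + k) ⟨p, hp⟩ (ripsIncl (Scale.val_le hdj) c) ((ripsIncl_val _ c).trans hc)
        refine (realize_single (hf := hs) this).trans ?_
        rw [hα]

/-- A criterion for being interleaved with the Vietoris–Rips complexes in terms of vertex maps. -/
theorem interleaved_of_vertexMaps [DecidableEq V] {P : Set X} (hP : P.Subsingleton) (v : ℕ → P → V)
    (hv : ∀ n p, K.vmap n (v (n + 1) p) = v n p) (δ : ℕ → ℝ) (hδ : ∀ n, 0 < δ n)
    (hδ0 : Filter.Tendsto δ Filter.atTop (𝓝 0))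
    (β θ : ℕ → X → V) (α : ℕ → V → X)
    (hβ : ∀ n (p : P), β n p = v n p) (hα : ∀ n p, α n (v n p) = p.1)
    (hβθ : ∀ n, ∀ s : Finset X, s.Nonempty → (∀ a ∈ s, ∀ b ∈ s, dist a b < δ n) →
      s.image (β n) ∪ s.image (θ n) ∈ (K.complex n).faces)
    (hbond : ∀ n, ∃ r > 0, ∀ s : Finset X, s.Nonempty → (∀ a ∈ s, ∀ b ∈ s, dist a b < r) →
      s.image (K.vmap n ∘ β (n + 1)) ∪ s.image (θ n) ∈ (K.complex n).faces)
    (hsmall : ∀ r > 0, ∃ l₀, ∀ l ≥ l₀, ∀ s ∈ (K.complex l).faces, ∀ a ∈ s, ∀ b ∈ s,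
      dist (α l a) (α l b) < r)
    (hαβ : ∀ r > 0, ∃ l₀, ∀ l ≥ l₀, ∀ z, dist (α l (β l z)) z < r)
    (hθα : ∀ n, ∃ k₀, ∀ k ≥ k₀, ∀ s ∈ (K.complex (n + k)).faces,
      s.image (K.bondMap n k) ∪ s.image (θ n ∘ α (n + k)) ∈ (K.complex n).faces) :
    K.Interleaved v := by
  classical
  obtain ⟨d, rfl⟩ : ∃ d : ℕ → Scale.{u}, δ = fun n => (d n).val :=
    ⟨fun n => Scale.mk (δ n) (hδ n), rfl⟩
  dsimp only at hδ hδ0 hβθ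
  have hsub : ∀ {n} {s t : Finset V}, s ∪ t ∈ (K.complex n).faces → s.Nonempty →
      s ∈ (K.complex n).faces := fun h hs => subset_mem_faces h Finset.subset_union_left hs
  have hβs : ∀ n, IsSimplicial (ripsComplex X (d n).val) (K.complex n) (β n) := fun n =>
    isSimplicial_of_image_mem fun s hs =>
      hsub (hβθ n s hs.1 ((mem_ripsComplex hs.1).1 hs)) (hs.1.image _)
  have hθs : ∀ n, IsSimplicial (ripsComplex X (d n).val) (K.complex n) (θ n) := fun n =>
    isSimplicial_of_image_mem fun s hs =>
      subset_mem_faces (hβθ n s hs.1 ((mem_ripsComplex hs.1).1 hs)) Finset.subset_union_right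
        (hs.1.image _)
  refine K.interleaved_of_contiguous hP v hv d (fun n => realize (β n) (hβs n))
    (fun n => realize (θ n) (hθs n)) α ?_ hα ?_ ?_ hsmall ?_ ?_
  · intro n p c hc
    rw [realize_single hc, hβ]
  · intro n c
    refine ⟨_, hβθ n c.1.support (support_nonempty c)
      fun a ha b hb => dist_lt_of_mem_support c ha hb, fun w hw => ?_, fun w hw => ?_⟩
    · obtain ⟨z, hz, rfl⟩ := mem_support_realize.1 hw
      exact Finset.mem_union_left _ (Finset.mem_image_of_mem _ hz)
    · obtain ⟨z, hz, rfl⟩ := mem_support_realize.1 hw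
      exact Finset.mem_union_right _ (Finset.mem_image_of_mem _ hz)
  · intro n
    obtain ⟨r, hr, h⟩ := hbond n
    refine ⟨Scale.mk (min r (min (d n).val (d (n + 1)).val))
      (lt_min hr (lt_min (hδ _) (hδ _))),
      Scale.le_mk ((min_le_right _ _).trans (min_le_left _ _)),
      Scale.le_mk ((min_le_right _ _).trans (min_le_right _ _)), fun c => ?_⟩
    refine ⟨_, h c.1.support (support_nonempty c) fun a ha b hb =>
      (dist_lt_of_mem_support c ha hb).trans_le (min_le_left _ _), fun w hw => ?_, fun w hw => ?_⟩
    · obtain ⟨y, hy, rfl⟩ := (mem_support_realize (hf := K.isSimplicial n)).1 hw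
      obtain ⟨z, hz, rfl⟩ := (mem_support_realize (hf := hβs (n + 1))).1 hy
      rw [ripsIncl_val] at hz
      exact Finset.mem_union_left _ (Finset.mem_image_of_mem (K.vmap n ∘ β (n + 1)) hz)
    · obtain ⟨z, hz, rfl⟩ := (mem_support_realize (hf := hθs n)).1 hw
      rw [ripsIncl_val] at hz
      exact Finset.mem_union_right _ (Finset.mem_image_of_mem _ hz)
  · intro r hr
    obtain ⟨l₁, h₁⟩ := hαβ (r / 2) (half_pos hr)
    obtain ⟨l₂, h₂⟩ := Filter.eventually_atTop.1 (hδ0.eventually_lt_const (half_pos hr))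
    refine ⟨max l₁ l₂, fun l hl c a ha z hz => ?_⟩
    obtain ⟨y, hy, rfl⟩ := (mem_support_realize (hf := hβs l)).1 ha
    have e1 := h₁ l (le_trans (le_max_left _ _) hl) y
    have e2 := h₂ l (le_trans (le_max_right _ _) hl)
    have e3 : dist y z < (d l).val := dist_lt_of_mem_support c hy hz
    have e4 := dist_triangle (α l (β l y)) y z
    linarith
  · intro n
    obtain ⟨k₀, h⟩ := hθα n
    refine ⟨k₀, fun k hk hs c => ⟨_, h k hk _ c.2.2.2, fun w hw => ?_, fun w hw => ?_⟩⟩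
    · obtain ⟨z, hz, rfl⟩ := (mem_support_realize (hf := K.isSimplicial_bondMap n k)).1 hw
      exact Finset.mem_union_left _ (Finset.mem_image_of_mem _ hz)
    · obtain ⟨y, hy, rfl⟩ := (mem_support_realize (hf := hθs n)).1 hw
      obtain ⟨z, hz, rfl⟩ := (mem_support_realize (hf := hs)).1 hy
      exact Finset.mem_union_right _ (Finset.mem_image_of_mem (θ n ∘ α (n + k)) hz)

end SimplicialSequence

/-! ### From interleavings to expansions, and from expansions to Čech homology and shape groups. -/

namespace PAS

variable {X : Type u} [MetricSpace X] (K : PAS X)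

/-- The sequence of complexes underlying a polyhedral approximative sequence. -/
def toSequence : SimplicialSequence (K.kind.Vertex X) where
  complex := K.complex
  vmap := K.vmap
  isSimplicial := K.isSimplicial_vmap

lemma system_map_succ (n : ℕ) :
    K.system.map (homOfLE n.le_succ).op = HTop.ofMap (K.toSequence.bond n) :=
  Functor.ofOpSequence_map_homOfLE_succ _ n

lemma system_map (n k : ℕ) :
    K.system.map (homOfLE (Nat.le_add_right n k)).op = HTop.ofMap (K.toSequence.bonds n k) := by
  induction k with
  | zero =>
    rw [SimplicialSequence.bonds_zero]
    exact (K.system.map_id _).trans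
      (CategoryTheory.Functor.map_id (CategoryTheory.Quotient.functor homotopyRel) _).symm
  | succ k ih =>
    rw [SimplicialSequence.bonds_succ, ← HTop.ofMap_comp]
    have h := IsExpansion.map_comp_map (sys := K.system) (Nat.le_add_right n k) (n + k).le_succ
    rw [ih, system_map_succ] at h
    exact h.symm

lemma pointedSystem_map_succ {x : X} (b : K.BaseThread x) (n : ℕ) :
    (K.pointedSystem b).map (homOfLE n.le_succ).op = HPTop.ofMap (K.bond n)
      (realize_vertexPoint (K.vmap n) (K.isSimplicial_vmap n) _ _ _ (b.mem n) (b.compat n)) :=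
  Functor.ofOpSequence_map_homOfLE_succ _ n

lemma bonds_vertexPoint {x : X} (b : K.BaseThread x) (n k : ℕ) :
    K.toSequence.bonds n k (vertexPoint (K.complex (n + k)) (b.vert (n + k)) (b.mem (n + k))) =
      vertexPoint (K.complex n) (b.vert n) (b.mem n) := by
  induction k with
  | zero =>
    rw [SimplicialSequence.bonds_zero]
    rfl
  | succ k ih =>
    rw [SimplicialSequence.bonds_succ]
    exact (congrArg (K.toSequence.bonds n k) (realize_vertexPoint (K.vmap (n + k))
      (K.isSimplicial_vmap (n + k)) _ _ _ (b.mem (n + k)) (b.compat (n + k)))).trans ih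

lemma pointedSystem_map {x : X} (b : K.BaseThread x) (n k : ℕ) :
    (K.pointedSystem b).map (homOfLE (Nat.le_add_right n k)).op =
      HPTop.ofMap (K.toSequence.bonds n k) (K.bonds_vertexPoint b n k) := by
  induction k with
  | zero =>
    refine ((K.pointedSystem b).map_id _).trans ?_
    refine (CategoryTheory.Functor.map_id
      (CategoryTheory.Quotient.functor pointedHomotopyRel) _).symm.trans ?_
    exact HPTop.ofMap_eq_iff (hf := rfl).2
      (homotopicRel_of_eq (K.toSequence.bonds_zero n).symm)
  | succ k ih =>
    have h := IsExpansion.map_comp_map (sys := K.pointedSystem b) (Nat.le_add_right n k)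
      (n + k).le_succ
    rw [ih, pointedSystem_map_succ] at h
    refine h.symm.trans (HPTop.ofMap_eq_iff.2 (homotopicRel_of_eq ?_))
    exact (K.toSequence.bonds_succ n k).symm

section compact

variable [CompactSpace X]

theorem exists_isExpansion_of_interleaved {v : ℕ → (∅ : Set X) → K.kind.Vertex X}
    (h : K.toSequence.Interleaved v) :
    ∃ proj, IsExpansion HPol.{u} (X := HTop.of X) K.system proj := by
  obtain ⟨d, β, -, h₂, h₃⟩ := h
  refine isExpansion_ripsProj.of_interleaving K.system
    (fun n => ⟨_, K.complex n, ⟨Iso.refl _⟩⟩) d (fun n => HTop.ofMap (β n)) (fun n => ?_)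
    fun n i hi => ?_
  · obtain ⟨i, hi, hi', e⟩ := h₂ n
    refine ⟨i, hi, hi', ?_⟩
    rw [system_map_succ]
    rw [verticesIn_empty] at e
    exact HTop.ofMap_eq_iff.2 e
  · obtain ⟨k, α, -, e, j, hj, hj', e'⟩ := h₃ n i hi
    refine ⟨n + k, Nat.le_add_right n k, HTop.ofMap α, ?_, j, hj, hj', ?_⟩
    · rw [system_map]
      have : K.toSequence.basePoints v (n + k) = ∅ :=
        Set.eq_empty_of_forall_notMem fun _ ⟨p, _⟩ => p.2
      rw [this] at e
      exact HTop.ofMap_eq_iff.2 e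
    · rw [verticesIn_empty] at e'
      exact HTop.ofMap_eq_iff.2 e'

theorem exists_isExpansion_pointed_of_interleaved {x : X} (b : K.BaseThread x)
    (h : K.toSequence.Interleaved fun n (_ : ({x} : Set X)) => b.vert n) :
    ∃ proj, IsExpansion HPPol.{u} (X := HPTop.of X x) (K.pointedSystem b) proj := by
  obtain ⟨d, β, h₁, h₂, h₃⟩ := h
  have hβ : ∀ n, β n (ripsVertex (d n) x) =
      vertexPoint (K.complex n) (b.vert n) (b.mem n) := fun n =>
    Realization.ext (h₁ n ⟨x, rfl⟩ _ rfl)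
  refine (isExpansion_pointedRipsProj x).of_interleaving (K.pointedSystem b)
    (fun n => ⟨_, K.complex n, b.vert n, b.mem n, ⟨Iso.refl _⟩⟩) d
    (fun n => HPTop.ofMap (β n) (hβ n)) (fun n => ?_) fun n i hi => ?_
  · obtain ⟨i, hi, hi', e⟩ := h₂ n
    refine ⟨i, hi, hi', ?_⟩
    rw [pointedSystem_map_succ]
    rw [verticesIn_singleton _ x (singleton_mem_ripsComplex i.val_pos x)] at e
    exact HPTop.ofMap_eq_iff.2 e
  · obtain ⟨k, α, hα, e, j, hj, hj', e'⟩ := h₃ n i hi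
    refine ⟨n + k, Nat.le_add_right n k, HPTop.ofMap α
      (Realization.ext (hα ⟨x, rfl⟩ _ rfl) : _ = ripsVertex i x), ?_, j, hj, hj', ?_⟩
    · rw [pointedSystem_map]
      have : K.toSequence.basePoints (P := {x}) (fun n _ => b.vert n) (n + k) =
          {vertexPoint (K.complex (n + k)) (b.vert (n + k)) (b.mem (n + k))} := by
        ext c
        constructor
        · rintro ⟨p, hc⟩
          exact Realization.ext hc
        · rintro rfl
          exact ⟨⟨x, rfl⟩, rfl⟩
      rw [this] at e
      exact HPTop.ofMap_eq_iff.2 e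
    · rw [verticesIn_singleton _ x (singleton_mem_ripsComplex j.val_pos x)] at e'
      exact HPTop.ofMap_eq_iff.2 e'

theorem isCechHomologyGroup_of_isExpansion
    (h : ∃ proj, IsExpansion HPol.{u} (X := HTop.of X) K.system proj) (G : AddCommGrpCat.{u})
    (p : ℕ) : IsCechHomologyGroup X G p (limit (K.system ⋙ homologyFunctor G p)) := by
  obtain ⟨proj, h⟩ := h
  exact ⟨nonempty_expansion, fun E => h.nonempty_limit_iso E.isExpansion _⟩

theorem isShapeGroup_of_isExpansion {x : X} (b : K.BaseThread x)
    (h : ∃ proj, IsExpansion HPPol.{u} (X := HPTop.of X x) (K.pointedSystem b) proj) (p : ℕ) :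
    IsShapeGroup X x p (limit (K.pointedSystem b ⋙ homotopyFunctor p)) := by
  obtain ⟨proj, h⟩ := h
  exact ⟨nonempty_pointed_expansion x, fun E => h.nonempty_limit_iso E.isExpansion _⟩

end compact

/-- On the empty space every sequence of empty complexes is an expansion. -/
theorem exists_isExpansion_of_isEmpty [IsEmpty X]
    (hK : ∀ n, IsEmpty (Realization (K.complex n))) :
    ∃ proj, IsExpansion HPol.{u} (X := HTop.of X) K.system proj := by
  have hsub : ∀ {Y Z : Type u} [TopologicalSpace Y] [TopologicalSpace Z] [IsEmpty Y]
      (f g : HTop.of Y ⟶ HTop.of Z), f = g := by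
    intro Y Z _ _ _ f g
    obtain ⟨f, rfl⟩ := HTop.exists_ofMap f
    obtain ⟨g, rfl⟩ := HTop.exists_ofMap g
    exact congrArg HTop.ofMap (ContinuousMap.ext fun y => isEmptyElim y)
  have hmap : ∀ {Y Z : Type u} [TopologicalSpace Y] [TopologicalSpace Z] [IsEmpty Y],
      Nonempty (HTop.of Y ⟶ HTop.of Z) := fun {Y Z} _ _ _ =>
    ⟨HTop.ofMap ⟨fun y => isEmptyElim y, continuous_of_const fun y => isEmptyElim y⟩⟩
  let proj : (Functor.const ℕᵒᵖ).obj (HTop.of X) ⟶ K.system :=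
    { app := fun n => (hmap (Y := X) (Z := Realization (K.complex n.unop))).some
      naturality := fun n m f => hsub (Y := X) (Z := Realization (K.complex m.unop)) _ _ }
  refine ⟨proj, fun n => ⟨_, K.complex n, ⟨Iso.refl _⟩⟩, ?_, ?_⟩
  · rintro Q ⟨W, L, ⟨e⟩⟩ h
    refine ⟨0, (hmap (Y := Realization (K.complex 0)) (Z := Realization L)).some ≫ e.inv, ?_⟩
    rw [← cancel_mono e.hom]
    exact hsub _ _
  · rintro Q ⟨W, L, ⟨e⟩⟩ n f f' -
    refine ⟨n, le_rfl, congrArg _ ?_⟩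
    rw [← cancel_mono e.hom]
    exact hsub (Y := Realization (K.complex n)) _ _

end PAS

/-! ### Scales of an adjusted approximative sequence -/

namespace AdjustedSequence

variable {X : Type u} [MetricSpace X] (S : AdjustedSequence X)

lemma two_mul_succ_lt (n : ℕ) : 2 * S.ε (n + 1) < S.ε n := by
  linarith [S.adjusted' n, S.γ_nonneg n]

lemma γ_lt (n : ℕ) : S.γ n < S.ε n := by
  linarith [S.adjusted' n, S.pos (n + 1)]

lemma exists_nearest (n : ℕ) : ∃ q : X → X, ∀ z, q z ∈ S.nearest n z :=
  ⟨fun z => (S.nearest_nonempty n z).choose, fun z => (S.nearest_nonempty n z).choose_spec⟩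

lemma eventually_lt (C : ℝ) {r : ℝ} (hr : 0 < r) : ∃ l₀, ∀ l ≥ l₀, C * S.ε l < r := by
  have h := (S.tendsto_zero.const_mul C)
  rw [mul_zero] at h
  exact Filter.eventually_atTop.1 (h.eventually (gt_mem_nhds hr))

end AdjustedSequence

/-- A choice of points for the vertices must return the base point on the base vertex. As `P` has at
most one element this prescription is unambiguous, and `hQ` shows that it respects `Q`. -/
lemma exists_based_choice {V : Type*} {X : Type*} [Nonempty X] {P : Set X}
    (hP : P.Subsingleton) (v : P → V) (Q : V → X → Prop) (hQ : ∀ p, Q (v p) p.1) :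
    ∃ α : V → X, (∀ p, α (v p) = p.1) ∧ ∀ u, (∃ y, Q u y) → Q u (α u) := by
  classical
  refine ⟨fun u => if h : ∃ p, v p = u then h.choose.1 else
    if h : ∃ y, Q u y then h.choose else Classical.arbitrary X, fun p => ?_, fun u hu => ?_⟩
  · have h : ∃ p', v p' = v p := ⟨p, rfl⟩
    dsimp only
    rw [dif_pos h]
    exact hP h.choose.2 p.2
  · dsimp only
    by_cases h : ∃ p, v p = u
    · rw [dif_pos h]
      have := hQ h.choose
      rwa [h.choose_spec] at this
    · rw [dif_neg h, dif_pos hu]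
      exact hu.choose_spec

/-! ### Interleavings from the nearness of vertices to points. -/

namespace SimplicialSequence

variable {V : Type u} (K : SimplicialSequence V) {X : Type u} [MetricSpace X]

/-- A criterion for being interleaved with the Vietoris–Rips complexes: `M n u z` says that the
vertex `u` may be joined with the vertices `θ n b` for `b` close to `z`, and `Q n u y` that the
vertex `u` may be mapped to the point `y`. -/
theorem interleaved_of_near [Nonempty X] [DecidableEq V] (S : AdjustedSequence X) {P : Set X}
    (hP : P.Subsingleton) (v : ℕ → P → V) (hv : ∀ n p, K.vmap n (v (n + 1) p) = v n p)
    (hvK : ∀ n p, {v n p} ∈ (K.complex n).faces)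
    (M Q : ℕ → V → X → Prop) (θ : ℕ → X → V) (r : ℕ → ℝ) (hr : ∀ n, 0 < r n)
    (hadd : ∀ n (T : Finset V) (s : Finset X) z, T ∈ (K.complex n).faces → (∀ u ∈ T, M n u z) →
      (∀ b ∈ s, dist b z < r n) → T ∪ s.image (θ n) ∈ (K.complex n).faces)
    (hMv : ∀ n p, M n (v n p) p.1)
    (hM : ∀ n z, ∃ u, {u} ∈ (K.complex n).faces ∧ M n u z)
    (hMθ : ∀ n, ∃ r' > 0, ∀ b z, dist b z < r' → M n (K.vmap n (θ (n + 1) b)) z)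
    (hQv : ∀ n p, Q n (v n p) p.1) (hQ : ∀ n u, {u} ∈ (K.complex n).faces → ∃ y, Q n u y)
    (hsmall : ∀ n u w y y', {u, w} ∈ (K.complex n).faces → Q n u y → Q n w y' →
      dist y y' < 8 * S.ε n)
    (hQθ : ∀ n z y, Q n (θ n z) y → dist y z < 8 * S.ε n)
    (hbonds : ∀ n, ∃ k₀, ∀ k ≥ k₀, ∀ s ∈ (K.complex (n + k)).faces, ∀ α : V → X,
      (∀ u ∈ s, Q (n + k) u (α u)) →
        ∃ z, ∀ u ∈ s, M n (K.bondMap n k u) z ∧ dist (α u) z < r n) :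
    K.Interleaved v := by
  classical
  have hone : ∀ {n} {s : Finset V} {u}, s ∈ (K.complex n).faces → u ∈ s →
      {u} ∈ (K.complex n).faces := fun hs hu =>
    subset_mem_faces hs (Finset.singleton_subset_iff.2 hu) (Finset.singleton_nonempty _)
  -- `β` is `θ` corrected at the base point, so that it takes the base vertex as value there.
  obtain ⟨β, hβv, hβθ⟩ : ∃ β : ℕ → X → V, (∀ n (p : P), β n p = v n p) ∧
      ∀ n z, z ∉ P → β n z = θ n z :=
    ⟨fun n z => if h : z ∈ P then v n ⟨z, h⟩ else θ n z, fun n p => by simp,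
      fun n z h => by simp [h]⟩
  choose α hαv hα using fun n => exists_based_choice hP (v n) (Q n) (hQv n)
  have hαs : ∀ {n} {s : Finset V}, s ∈ (K.complex n).faces → ∀ u ∈ s, Q n u (α n u) :=
    fun hs u hu => hα _ u (hQ _ u (hone hs hu))
  have hδ : ∀ n, 0 < min (r n) (S.ε n) := fun n => lt_min (hr n) (S.pos n)
  have hunion : ∀ n (s : Finset X), s.Nonempty → (∀ a ∈ s, ∀ b ∈ s, dist a b < r n) →
      s.image (β n) ∪ s.image (θ n) ∈ (K.complex n).faces := by
    intro n s hs hd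
    -- The centre `z` is the base point if `s` contains it, for the base vertex is only known to be
    -- near that point. Otherwise any point of `s` will do, and the vertex from `hM` serves merely
    -- to make `T` nonempty.
    obtain ⟨z, hz, T, hT, hTM, hsub⟩ : ∃ z ∈ s, ∃ T ∈ (K.complex n).faces,
        (∀ u ∈ T, M n u z) ∧ s.image (β n) ⊆ T ∪ s.image (θ n) := by
      by_cases hp : ∃ p ∈ s, p ∈ P
      · obtain ⟨p, hps, hpP⟩ := hp
        refine ⟨p, hps, {v n ⟨p, hpP⟩}, hvK n _, fun u hu => ?_, fun u hu => ?_⟩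
        · rw [Finset.mem_singleton.1 hu]
          exact hMv n _
        · obtain ⟨b, hb, rfl⟩ := Finset.mem_image.1 hu
          by_cases hbP : b ∈ P
          · obtain rfl := hP hbP hpP
            exact Finset.mem_union_left _ (Finset.mem_singleton.2 (hβv n ⟨b, hbP⟩))
          · rw [hβθ n b hbP]
            exact Finset.mem_union_right _ (Finset.mem_image_of_mem _ hb)
      · obtain ⟨z, hz⟩ := hs
        obtain ⟨u, hu, huM⟩ := hM n z
        refine ⟨z, hz, {u}, hu, fun w hw => ?_, fun w hw => ?_⟩
        · rwa [Finset.mem_singleton.1 hw]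
        · obtain ⟨b, hb, rfl⟩ := Finset.mem_image.1 hw
          rw [hβθ n b fun h => hp ⟨b, hb, h⟩]
          exact Finset.mem_union_right _ (Finset.mem_image_of_mem _ hb)
    exact subset_mem_faces (hadd n T s z hT hTM fun b hb => hd b hb z hz)
      (Finset.union_subset hsub Finset.subset_union_right)
      ((hs.image _).mono Finset.subset_union_left)
  refine K.interleaved_of_vertexMaps hP v hv (fun n => min (r n) (S.ε n)) hδ
    (squeeze_zero (fun n => (hδ n).le) (fun n => min_le_right _ _) S.tendsto_zero) β θ α hβv hαv
    (fun n s hs hd => hunion n s hs fun a ha b hb => (hd a ha b hb).trans_le (min_le_left _ _))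
    (fun n => ?_) (fun ρ hρ => ?_) (fun ρ hρ => ?_) fun n => ?_
  · obtain ⟨r', hr', h⟩ := hMθ n
    refine ⟨min r' (min (r n) (r (n + 1))), lt_min hr' (lt_min (hr _) (hr _)), fun s hs hd => ?_⟩
    have hT : s.image (K.vmap n ∘ β (n + 1)) ∈ (K.complex n).faces := by
      have := hunion (n + 1) s hs fun a ha b hb => (hd a ha b hb).trans_le
        ((min_le_right _ _).trans (min_le_right _ _))
      rw [← Finset.image_image]
      exact image_mem (K.isSimplicial n)
        (subset_mem_faces this Finset.subset_union_left (hs.image _))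
    -- The centre is again the base point when it occurs in `s`. There `K.vmap n` takes the base
    -- vertex to the base vertex, which `hMv` handles; elsewhere `β` is `θ`.
    obtain ⟨z, hz, hz'⟩ : ∃ z ∈ s, ∀ p ∈ s, p ∈ P → p = z := by
      by_cases hp : ∃ p ∈ s, p ∈ P
      · obtain ⟨p, hps, hpP⟩ := hp
        exact ⟨p, hps, fun _ _ h => hP h hpP⟩
      · obtain ⟨z, hz⟩ := hs
        exact ⟨z, hz, fun p hps hpP => (hp ⟨p, hps, hpP⟩).elim⟩
    refine hadd n _ s z hT (fun u hu => ?_) fun b hb => (hd b hb z hz).trans_le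
        ((min_le_right _ _).trans (min_le_left _ _))
    obtain ⟨b, hb, rfl⟩ := Finset.mem_image.1 hu
    by_cases hbP : b ∈ P
    · obtain rfl := hz' b hb hbP
      have h₁ := hMv n ⟨b, hbP⟩
      rwa [← hv, ← hβv] at h₁
    · rw [Function.comp_apply, hβθ _ b hbP]
      exact h b z ((hd b hb z hz).trans_le (min_le_left _ _))
  -- The constant 8 is only slack: what matters is that the bound tends to 0.
  · obtain ⟨l₀, hl₀⟩ := S.eventually_lt 8 hρ
    refine ⟨l₀, fun l hl s hs a ha b hb => (hsmall l a b _ _ ?_ (hαs hs a ha)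
      (hαs hs b hb)).trans (hl₀ l hl)⟩
    exact subset_mem_faces hs (by simp [Finset.insert_subset_iff, ha, hb])
      (Finset.insert_nonempty _ _)
  · obtain ⟨l₀, hl₀⟩ := S.eventually_lt 8 hρ
    refine ⟨l₀, fun l hl z => ?_⟩
    by_cases hz : z ∈ P
    · have h₁ := hαv l ⟨z, hz⟩
      rw [← hβv] at h₁
      simpa only [h₁, dist_self] using hρ
    · rw [hβθ l z hz]
      refine (hQθ l z _ (hα l _ (hQ l _ ?_))).trans (hl₀ l hl)
      have := hunion l {z} (Finset.singleton_nonempty z) fun a ha b hb => by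
        rw [Finset.mem_singleton.1 ha, Finset.mem_singleton.1 hb, dist_self]
        exact hr l
      exact hone this (by simp)
  · obtain ⟨k₀, hk₀⟩ := hbonds n
    refine ⟨k₀, fun k hk s hs => ?_⟩
    obtain ⟨z, hz⟩ := hk₀ k hk s hs (α (n + k)) (hαs hs)
    rw [← Finset.image_image]
    refine hadd n _ _ z (image_mem (K.isSimplicial_bondMap n k) hs) (fun u hu => ?_) fun b hb => ?_
    · obtain ⟨w, hw, rfl⟩ := Finset.mem_image.1 hu
      exact (hz w hw).1
    · obtain ⟨w, hw, rfl⟩ := Finset.mem_image.1 hb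
      exact (hz w hw).2

end SimplicialSequence

namespace AdjustedSequence

variable {X : Type u} [MetricSpace X] (S : AdjustedSequence X)

lemma four_mul_le {n m : ℕ} (h : n + 2 ≤ m) : 4 * S.ε m ≤ S.ε n := by
  linarith [S.anti h, S.two_mul_succ_lt n, S.two_mul_succ_lt (n + 1)]

/-- The points of `A_n` that are close to `z`, where close means a bit more than
`γ_n + ε_{n+1}`. -/
def cluster (n : ℕ) (z : X) : Finset X :=
  open Classical in
  (S.A n).filter fun a => dist a z ≤ S.γ n + S.ε (n + 1) + S.ε (n + 2) + S.ε (n + 3)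

lemma mem_cluster {n : ℕ} {z a : X} : a ∈ S.cluster n z ↔
    a ∈ S.A n ∧ dist a z ≤ S.γ n + S.ε (n + 1) + S.ε (n + 2) + S.ε (n + 3) := by
  classical exact Finset.mem_filter

lemma nearest_subset_cluster (n : ℕ) (z : X) : S.nearest n z ⊆ S.cluster n z := fun a ha => by
  refine S.mem_cluster.2 ⟨S.nearest_subset n z ha, ?_⟩
  have := S.dist_le_of_mem_nearest ha
  rw [dist_comm]
  linarith [S.pos (n + 1), S.pos (n + 2), S.pos (n + 3)]

lemma isSmall_of_forall_dist_lt {n : ℕ} {C : Finset X} {z : X} (hne : C.Nonempty)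
    (hC : ∀ a ∈ C, a ∈ S.A n ∧ dist a z < S.ε n) : S.IsSmall n C := by
  refine ⟨hne, fun a ha => (hC a ha).1, (diam_lt_iff hne).2
    fun a ha b hb => ?_⟩
  linarith [(hC a ha).2, (hC b hb).2, dist_triangle_right a b z]

end AdjustedSequence

/-! ### Complexes on points, on balls and on clusters of points. -/

namespace SimplicialSequence

variable {X : Type u} [MetricSpace X] [Nonempty X] (S : AdjustedSequence X)

section points

variable (K : SimplicialSequence X)

-- The displacements telescope: the step into level `m > n` costs at most `γ_m < ε_m - ε_{m+1}`, so
-- all steps but the last add up to at most `ε_{n+1} - ε_{n+k+1}`, and the last one costs `γ_n`.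
omit [Nonempty X] in
lemma dist_bondMap_le (h : ∀ n a, {a} ∈ (K.complex (n + 1)).faces →
      dist a (K.vmap n a) ≤ S.γ n) (n k : ℕ) (a : X)
    (ha : {a} ∈ (K.complex (n + (k + 1))).faces) :
    dist a (K.bondMap n (k + 1) a) ≤ S.γ n + S.ε (n + 1) - S.ε (n + (k + 1)) := by
  classical
  induction k generalizing a with
  | zero =>
    have := h n a ha
    change dist a (K.vmap n a) ≤ S.γ n + S.ε (n + 1) - S.ε (n + 1)
    linarith
  | succ k ih =>
    have h₁ := h (n + (k + 1)) a ha
    have h₂ := ih (K.vmap (n + (k + 1)) a) (by simpa using image_mem (K.isSimplicial _) ha)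
    have h₃ := dist_triangle a (K.vmap (n + (k + 1)) a)
      (K.bondMap n (k + 1) (K.vmap (n + (k + 1)) a))
    have h₄ := S.adjusted' (n + (k + 1))
    have h₅ := S.pos (n + (k + 1) + 1)
    change dist a (K.bondMap n (k + 1) (K.vmap (n + (k + 1)) a)) ≤
      S.γ n + S.ε (n + 1) - S.ε (n + (k + 1) + 1)
    linarith

/-- The Rips, Vietoris and witness complexes share two properties that suffice: simplices have
diameter below `2 ε_n`, and nonempty sets of admissible points in an open ball of radius `ε_n` are
simplices. `θ` chooses nearest points, and the radius `ε_{n+1}` is allowed because `γ_n + ε_{n+1} <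
ε_n`. -/
theorem interleaved_of_points (A : ℕ → Set X) (hA : ∀ n, (S.A n : Set X) ⊆ A n)
    (hKA : ∀ n, ∀ s ∈ (K.complex n).faces, ∀ a ∈ s, a ∈ A n)
    (hdist : ∀ n, ∀ s ∈ (K.complex n).faces, ∀ a ∈ s, ∀ b ∈ s, dist a b < 2 * S.ε n)
    (hK : ∀ n (s : Finset X) z, s.Nonempty → (∀ a ∈ s, a ∈ A n ∧ dist a z < S.ε n) →
      s ∈ (K.complex n).faces)
    (hvmap : ∀ n a, {a} ∈ (K.complex (n + 1)).faces → dist a (K.vmap n a) ≤ S.γ n)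
    {P : Set X} (hP : P.Subsingleton) (v : ℕ → P → X)
    (hv : ∀ n p, K.vmap n (v (n + 1) p) = v n p)
    (hvK : ∀ n p, {v n p} ∈ (K.complex n).faces) (hvP : ∀ n p, dist (v n p) p < S.ε n) :
    K.Interleaved v := by
  classical
  have hone : ∀ {n} {s : Finset X} {u}, s ∈ (K.complex n).faces → u ∈ s →
      {u} ∈ (K.complex n).faces := fun hs hu =>
    subset_mem_faces hs (Finset.singleton_subset_iff.2 hu) (Finset.singleton_nonempty _)
  choose θ hθ using S.exists_nearest
  have hθd : ∀ n z, dist (θ n z) z ≤ S.γ n := fun n z => by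
    rw [dist_comm]
    exact S.dist_le_of_mem_nearest (hθ n z)
  have hθA : ∀ n z, θ n z ∈ A n := fun n z => hA n (S.nearest_subset n z (hθ n z))
  have hθK : ∀ n z, {θ n z} ∈ (K.complex n).faces := fun n z =>
    hK n _ z (Finset.singleton_nonempty _) fun a ha => by
      rw [Finset.mem_singleton.1 ha]
      exact ⟨hθA n z, (hθd n z).trans_lt (S.γ_lt n)⟩
  have hmem : ∀ {n a}, {a} ∈ (K.complex n).faces → a ∈ A n := fun h =>
    hKA _ _ h _ (Finset.mem_singleton_self _)
  have hvmapK : ∀ {n a}, {a} ∈ (K.complex (n + 1)).faces →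
      {K.vmap n a} ∈ (K.complex n).faces := fun h => by
    simpa using image_mem (K.isSimplicial _) h
  refine K.interleaved_of_near S hP v hv hvK (fun n a z => a ∈ A n ∧ dist a z < S.ε n)
    (fun n a z => dist a z < S.ε n) θ (fun n => S.ε (n + 1)) (fun n => S.pos _)
    (fun n T s z hT hM hs => ?_) (fun n p => ⟨hmem (hvK n p), hvP n p⟩)
    (fun n z => ⟨θ n z, hθK n z, hθA n z, (hθd n z).trans_lt (S.γ_lt n)⟩)
    (fun n => ⟨S.ε (n + 1) - S.γ (n + 1), by linarith [S.γ_lt (n + 1)], fun b z hb =>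
      ⟨hmem (hvmapK (hθK _ b)), ?_⟩⟩) hvP
    (fun n u _ => ⟨u, by rw [dist_self]; exact S.pos n⟩)
    (fun n u w y y' h hy hy' => ?_) (fun n z y hy => ?_)
    fun n => ⟨3, fun k hk s hs α hα => ?_⟩
  · refine hK n _ z (((K.complex n).isRelLowerSet_faces hT).1.mono
      Finset.subset_union_left) fun a ha => ?_
    rcases Finset.mem_union.1 ha with ha | ha
    · exact hM a ha
    · obtain ⟨b, hb, rfl⟩ := Finset.mem_image.1 ha
      refine ⟨hθA n b, ?_⟩
      linarith [hθd n b, hs b hb, dist_triangle (θ n b) b z, S.adjusted' n, S.pos (n + 1)]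
  · have h₁ := hvmap n (θ (n + 1) b) (hθK _ b)
    rw [dist_comm] at h₁
    linarith [hθd (n + 1) b, dist_triangle4 (K.vmap n (θ (n + 1) b)) (θ (n + 1) b) b z,
      S.adjusted' n, S.pos (n + 1)]
  · have h₁ := hdist n _ h u (by simp) w (by simp)
    rw [dist_comm] at hy
    linarith [dist_triangle4 y u w y', S.pos n]
  · rw [dist_comm] at hy
    linarith [dist_triangle y (θ n z) z, hθd n z, S.γ_lt n, S.pos n]
  · obtain ⟨k, rfl⟩ : ∃ i, k = i + 1 := ⟨k - 1, by omega⟩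
    obtain ⟨z, hz⟩ := ((K.complex _).isRelLowerSet_faces hs).1
    -- The simplex has diameter below `2 ε_{n+k+1}` and `α` moves its vertices by less than
    -- `ε_{n+k+1}`. The total of `3 ε_{n+k+1}` stays below `ε_{n+1}`.
    have h₀ : 4 * S.ε (n + (k + 1)) ≤ S.ε (n + 1) := S.four_mul_le (by omega)
    have h₀' := S.pos (n + (k + 1))
    refine ⟨z, fun a ha => ⟨⟨?_, ?_⟩, ?_⟩⟩
    · exact hKA n _ (image_mem (K.isSimplicial_bondMap n (k + 1)) hs) _
        (Finset.mem_image_of_mem _ ha)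
    · have h₁ := K.dist_bondMap_le S hvmap n k a (hone hs ha)
      rw [dist_comm] at h₁
      linarith [dist_triangle (K.bondMap n (k + 1) a) a z, hdist _ s hs a ha z hz, S.adjusted' n]
    · have h₁ := hα a ha
      rw [dist_comm] at h₁
      linarith [dist_triangle (α a) a z, hdist _ s hs a ha z hz]

end points

/-- Vertices are balls as sets, which need not determine their centres, so a ball may be sent to any
of its points. A common point of a simplex stays in the images under the bonding maps, which only
enlarge the sets. The radius `ε_n - γ_n` is what keeps `z` in the ball chosen for a nearby point. -/
theorem interleaved_of_balls (K : SimplicialSequence (Set X))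
    (hK : ∀ n, K.complex n = cechComplex S n)
    (hvmap : ∀ n U, {U} ∈ (K.complex (n + 1)).faces → U ⊆ K.vmap n U)
    {P : Set X} (hP : P.Subsingleton) (v : ℕ → P → Set X)
    (hv : ∀ n p, K.vmap n (v (n + 1) p) = v n p)
    (hvK : ∀ n p, {v n p} ∈ (K.complex n).faces) (hvP : ∀ n p, p.1 ∈ v n p) :
    K.Interleaved v := by
  classical
  have hone : ∀ {n} {s : Finset (Set X)} {u}, s ∈ (K.complex n).faces → u ∈ s →
      {u} ∈ (K.complex n).faces := fun hs hu =>
    subset_mem_faces hs (Finset.singleton_subset_iff.2 hu) (Finset.singleton_nonempty _)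
  have hbonds : ∀ n k U, {U} ∈ (K.complex (n + k)).faces → U ⊆ K.bondMap n k U := by
    intro n k
    induction k with
    | zero => exact fun U _ => subset_rfl
    | succ k ih =>
      exact fun U hU => (hvmap (n + k) U hU).trans
        (ih _ (by simpa using image_mem (K.isSimplicial _) hU))
  choose q hq using S.exists_nearest
  have hball : ∀ n U, {U} ∈ (K.complex n).faces → S.IsBall n U := fun n U hU => by
    rw [hK] at hU
    exact hU.2.1 U (Finset.mem_singleton_self U)
  have hdist : ∀ n U, {U} ∈ (K.complex n).faces → ∀ a ∈ U, ∀ b ∈ U, dist a b < 2 * S.ε n := by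
    intro n U hU a ha b hb
    obtain ⟨c, -, rfl⟩ := hball n U hU
    linarith [Metric.mem_ball.1 ha, Metric.mem_ball.1 hb, dist_triangle_right a b c]
  obtain ⟨θ, hθ⟩ : ∃ θ : ℕ → X → Set X, ∀ n z, θ n z = Metric.ball (q n z) (S.ε n) :=
    ⟨_, fun _ _ => rfl⟩
  have hθball : ∀ n z, S.IsBall n (θ n z) := fun n z =>
    ⟨q n z, S.nearest_subset n z (hq n z), hθ n z⟩
  have hθmem : ∀ n z b, dist b z < S.ε n - S.γ n → z ∈ θ n b := fun n z b hb => by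
    rw [hθ, Metric.mem_ball, dist_comm]
    have h₁ := S.dist_le_of_mem_nearest (hq n b)
    rw [dist_comm] at h₁
    linarith [dist_triangle (q n b) b z]
  have hγ : ∀ n, 0 < S.ε n - S.γ n := fun n => sub_pos.2 (S.γ_lt n)
  have hθself : ∀ n z, z ∈ θ n z := fun n z => hθmem n z z (by rw [dist_self]; exact hγ n)
  have hθK : ∀ n z, {θ n z} ∈ (K.complex n).faces := fun n z => by
    rw [hK]
    exact ⟨Finset.singleton_nonempty _, by simpa using hθball n z, z, by simpa using hθself n z⟩
  refine K.interleaved_of_near S hP v hv hvK (fun n U z => z ∈ U)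
    (fun n U z => z ∈ U) θ (fun n => S.ε n - S.γ n) hγ
    (fun n T s z hT hM hs => ?_) hvP
    (fun n z => ⟨θ n z, hθK n z, hθself n z⟩)
    (fun n => ⟨_, hγ (n + 1), fun b z hb => hvmap n _ (hθK _ b) (hθmem _ z b hb)⟩) hvP
    (fun n U hU => ?_)
    (fun n U W y y' h hy hy' => ?_) (fun n z y hy => ?_)
    fun n => ?_
  · rw [hK] at hT ⊢
    refine ⟨hT.1.mono Finset.subset_union_left, fun U hU => ?_, z, fun U hU => ?_⟩
    · rcases Finset.mem_union.1 hU with hU | hU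
      · exact hT.2.1 U hU
      · obtain ⟨b, hb, rfl⟩ := Finset.mem_image.1 hU
        exact hθball n b
    · rcases Finset.mem_union.1 hU with hU | hU
      · exact hM U hU
      · obtain ⟨b, hb, rfl⟩ := Finset.mem_image.1 hU
        exact hθmem n z b (hs b hb)
  · rw [hK] at hU
    obtain ⟨-, -, x, hx⟩ := hU
    exact ⟨x, hx U (Finset.mem_singleton_self U)⟩
  · have h₁ := h
    rw [hK] at h₁
    obtain ⟨-, -, x, hx⟩ := h₁
    have h₂ := hdist n U (hone h (by simp)) y hy x (hx U (by simp))
    have h₃ := hdist n W (hone h (by simp)) x (hx W (by simp)) y' hy'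
    linarith [dist_triangle y x y', S.pos n]
  · linarith [hdist n _ (hθK n z) y hy z (hθself n z), S.pos n]
  · obtain ⟨l₀, hl₀⟩ := S.eventually_lt 2 (hγ n)
    refine ⟨l₀, fun k hk s hs α hα => ?_⟩
    have h₁ := hs
    rw [hK] at h₁
    obtain ⟨-, -, x, hx⟩ := h₁
    exact ⟨x, fun U hU => ⟨hbonds n k U (hone hs hU) (hx U hU),
      (hdist _ U (hone hs hU) _ (hα U hU) x (hx U hU)).trans (hl₀ _ (by omega))⟩⟩

section clusters

variable (K : SimplicialSequence (Finset X))

-- The telescoping estimate again, along one chain of successive nearest points.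
omit [Nonempty X] in
lemma exists_dist_bondMap_le
    (hvmap : ∀ n C, {C} ∈ (K.complex (n + 1)).faces → K.vmap n C = S.push n C) (n k : ℕ)
    (C : Finset X) (hC : {C} ∈ (K.complex (n + (k + 1))).faces) :
    ∀ a ∈ K.bondMap n (k + 1) C,
      ∃ c ∈ C, dist c a ≤ S.γ n + S.ε (n + 1) - S.ε (n + (k + 1)) := by
  classical
  have hpush : ∀ n C, {C} ∈ (K.complex (n + 1)).faces → ∀ a ∈ K.vmap n C,
      ∃ c ∈ C, dist c a ≤ S.γ n := fun n C hC a ha => by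
    rw [hvmap n C hC] at ha
    obtain ⟨c, hc, ha⟩ := S.mem_push.1 ha
    exact ⟨c, hc, S.dist_le_of_mem_nearest ha⟩
  induction k generalizing C with
  | zero =>
    intro a ha
    obtain ⟨c, hc, h⟩ := hpush n C hC a ha
    refine ⟨c, hc, ?_⟩
    change _ ≤ S.γ n + S.ε (n + 1) - S.ε (n + 1)
    linarith
  | succ k ih =>
    intro a ha
    obtain ⟨b, hb, h₁⟩ := ih (K.vmap (n + (k + 1)) C)
      (by simpa using image_mem (K.isSimplicial _) hC) a ha
    obtain ⟨c, hc, h₂⟩ := hpush (n + (k + 1)) C hC b hb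
    refine ⟨c, hc, ?_⟩
    change _ ≤ S.γ n + S.ε (n + 1) - S.ε (n + (k + 1) + 1)
    linarith [dist_triangle c b a, S.adjusted' (n + (k + 1)), S.pos (n + (k + 1) + 1)]

/-- `θ` takes whole clusters, large enough to contain every set that `M` declares close to a nearby
point. Hence an element below a lower Dowker simplex is also below the clusters joined to it; for
upper Dowker simplices it matters that everything stays within `ε_n` of one point. -/
theorem interleaved_of_clusters
    (hsmall : ∀ n, ∀ s ∈ (K.complex n).faces, ∀ C ∈ s, S.IsSmall n C)
    (hdist : ∀ n, ∀ s ∈ (K.complex n).faces, ∀ C ∈ s, ∀ D ∈ s, ∀ c ∈ C, ∀ d ∈ D,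
      dist c d < 4 * S.ε n)
    (hone : ∀ n C, S.IsSmall n C → {C} ∈ (K.complex n).faces)
    (hadd : ∀ n, ∀ s ∈ (K.complex n).faces, ∀ t : Finset (Finset X), ∀ z,
      (∀ C ∈ s, ∀ a ∈ C, dist a z < S.ε n) → (∀ C ∈ t, ∀ a ∈ C, a ∈ S.A n ∧ dist a z < S.ε n) →
      (∀ C ∈ s, ∀ D ∈ t, C ⊆ D) → ∀ r : Finset (Finset X), (∀ C, C ∈ r ↔ C ∈ s ∨ C ∈ t) →
      r ∈ (K.complex n).faces)
    (hvmap : ∀ n C, {C} ∈ (K.complex (n + 1)).faces → K.vmap n C = S.push n C)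
    {P : Set X} (hP : P.Subsingleton) (v : ℕ → P → Finset X)
    (hv : ∀ n p, K.vmap n (v (n + 1) p) = v n p)
    (hvK : ∀ n p, {v n p} ∈ (K.complex n).faces)
    (hvP : ∀ n (p : P), ∀ c ∈ v n p, dist c p < S.ε n) :
    K.Interleaved v := by
  classical
  have hone' : ∀ {n} {s : Finset (Finset X)} {u}, s ∈ (K.complex n).faces → u ∈ s →
      {u} ∈ (K.complex n).faces := fun hs hu =>
    subset_mem_faces hs (Finset.singleton_subset_iff.2 hu) (Finset.singleton_nonempty _)
  have hsm : ∀ {n C}, {C} ∈ (K.complex n).faces → S.IsSmall n C := fun h =>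
    hsmall _ _ h _ (Finset.mem_singleton_self _)
  have hε : ∀ n, S.γ n + S.ε (n + 1) + S.ε (n + 2) + S.ε (n + 3) + S.ε (n + 3) < S.ε n := by
    intro n
    linarith [S.adjusted' n, S.two_mul_succ_lt (n + 1), S.two_mul_succ_lt (n + 2), S.pos (n + 1)]
  have hcl : ∀ n z b, dist b z < S.ε (n + 3) → ∀ a ∈ S.cluster n b, a ∈ S.A n ∧
      dist a z < S.ε n := by
    intro n z b hb a ha
    obtain ⟨ha, ha'⟩ := S.mem_cluster.1 ha
    exact ⟨ha, by linarith [dist_triangle a b z, hε n]⟩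
  have hne : ∀ n z, (S.cluster n z).Nonempty := fun n z =>
    (S.nearest_nonempty n z).mono (S.nearest_subset_cluster n z)
  have hself : ∀ n (z : X), dist z z < S.ε (n + 3) := fun n z => by
    rw [dist_self]
    exact S.pos _
  have hclK : ∀ n z, {S.cluster n z} ∈ (K.complex n).faces := fun n z =>
    hone n _ (S.isSmall_of_forall_dist_lt (hne n z) (hcl n z z (hself n z)))
  have hnear : ∀ n z, ∀ a ∈ S.nearest n z, a ∈ S.A n ∧ dist a z ≤ S.γ n := fun n z a ha => by
    rw [dist_comm]
    exact ⟨S.nearest_subset n z ha, S.dist_le_of_mem_nearest ha⟩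
  have hvmapK : ∀ {n C}, {C} ∈ (K.complex (n + 1)).faces →
      {K.vmap n C} ∈ (K.complex n).faces := fun h => by
    simpa using image_mem (K.isSimplicial _) h
  have hvmapd : ∀ {n C z r}, {C} ∈ (K.complex (n + 1)).faces → (∀ c ∈ C, dist c z < r) →
      ∀ a ∈ K.vmap n C, dist a z ≤ S.γ n + r := fun {n C z r} hC hr a ha => by
    rw [hvmap n C hC] at ha
    obtain ⟨c, hc, ha⟩ := S.mem_push.1 ha
    linarith [(hnear n c a ha).2, hr c hc, dist_triangle a c z]
  refine K.interleaved_of_near S hP v hv hvK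
    (fun n C z => ∀ a ∈ C, dist a z ≤ S.γ n + S.ε (n + 1) + S.ε (n + 2))
    (fun n C z => ∃ c ∈ C, dist c z < S.ε n) S.cluster (fun n => S.ε (n + 3)) (fun n => S.pos _)
    (fun n T s z hT hM hs => ?_) (fun n p a ha => ?_)
    (fun n z => ⟨S.nearest n z, hone n _ (S.isSmall_of_forall_dist_lt (S.nearest_nonempty n z)
      fun a ha => ⟨(hnear n z a ha).1, (hnear n z a ha).2.trans_lt (S.γ_lt n)⟩),
      fun a ha => ?_⟩)
    (fun n => ⟨S.ε (n + 1 + 3), S.pos _, fun b z hb a ha => ?_⟩) (fun n p => ?_)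
    (fun n C hC => ?_)
    (fun n C D y y' h hy hy' => ?_) (fun n z y hy => ?_)
    fun n => ⟨6, fun k hk s hs α hα => ?_⟩
  · refine hadd n T hT (s.image (S.cluster n)) z (fun C hC a ha => ?_) (fun C hC => ?_)
      (fun C hC D hD a ha => ?_) _ fun C => Finset.mem_union
    · linarith [hM C hC a ha, hε n, S.pos (n + 3)]
    · obtain ⟨b, hb, rfl⟩ := Finset.mem_image.1 hC
      exact hcl n z b (hs b hb)
    · obtain ⟨b, hb, rfl⟩ := Finset.mem_image.1 hD
      refine S.mem_cluster.2 ⟨(hsmall n T hT C hC).2.1 ha, ?_⟩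
      -- The summand `ε_{n+3}` in the radius of a cluster absorbs the passage from `z` to `b`.
      linarith [hM C hC a ha, hs b hb, dist_triangle_right a b z]
  -- Nearness of the base vertex gives only `ε_n`. Writing it as the image of the next base vertex
  -- improves this to `γ_n + ε_{n+1}`.
  · rw [← hv] at ha
    linarith [hvmapd (hvK (n + 1) p) (hvP (n + 1) p) a ha, S.pos (n + 2)]
  · linarith [(hnear n z a ha).2, S.pos (n + 1), S.pos (n + 2)]
  · linarith [hvmapd (hclK (n + 1) b) (fun c hc => (hcl (n + 1) z b hb c hc).2) a ha,
      S.pos (n + 2)]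
  · obtain ⟨c, hc⟩ := (hsm (hvK n p)).1
    exact ⟨c, hc, hvP n p c hc⟩
  · obtain ⟨c, hc⟩ := (hsm hC).1
    exact ⟨c, c, hc, by rw [dist_self]; exact S.pos n⟩
  · obtain ⟨c, hc, hcy⟩ := hy
    obtain ⟨d, hd, hdy⟩ := hy'
    rw [dist_comm] at hcy
    linarith [hdist n _ h C (by simp) D (by simp) c hc d hd, dist_triangle4 y c d y', S.pos n]
  · obtain ⟨c, hc, hcy⟩ := hy
    rw [dist_comm] at hcy
    linarith [dist_triangle y c z, (hcl n z z (hself n z) c hc).2, S.pos n]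
  · obtain ⟨k, rfl⟩ : ∃ i, k = i + 1 := ⟨k - 1, by omega⟩
    obtain ⟨C₀, hC₀⟩ := ((K.complex _).isRelLowerSet_faces hs).1
    obtain ⟨z, hz⟩ := (hsmall _ s hs C₀ hC₀).1
    -- Points of vertices of one simplex are less than `4 ε_{n+k+1}` apart, and `α` costs one more
    -- `ε_{n+k+1}`. The sum `5 ε_{n+k+1}` must stay below `ε_{n+3}`.
    have h₀ : 4 * S.ε (n + (k + 1)) ≤ S.ε (n + 4) := S.four_mul_le (by omega)
    have h₀' := S.two_mul_succ_lt (n + 3)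
    have h₀'' := S.two_mul_succ_lt (n + 2)
    have h₁ := S.pos (n + (k + 1))
    refine ⟨z, fun C hC => ⟨fun a ha => ?_, ?_⟩⟩
    · obtain ⟨c, hc, h₂⟩ := K.exists_dist_bondMap_le S hvmap n k C (hone' hs hC) a ha
      rw [dist_comm] at h₂
      linarith [dist_triangle a c z, hdist _ s hs C hC C₀ hC₀ c hc z hz, S.pos (n + 3)]
    · obtain ⟨c, hc, h₂⟩ := hα C hC
      rw [dist_comm] at h₂
      linarith [dist_triangle (α C) c z, hdist _ s hs C hC C₀ hC₀ c hc z hz]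

end clusters

end SimplicialSequence

/-! ### Maps to complexes of chains of finite sets -/

section levels

variable {X : Type u}

open Classical in
/-- A weight on the subsets of the finite set `A` that is supported by the superlevel sets of the
function `w`. -/
def levelWeight (A : Finset X) (w : X → ℝ) (C : Finset X) : ℝ :=
  ∏ a ∈ C, (w a * ∏ b ∈ A \ C, max (w a - w b) 0)

lemma levelWeight_nonneg {A : Finset X} {w : X → ℝ} (hw : ∀ a, 0 ≤ w a) (C : Finset X) :
    0 ≤ levelWeight A w C :=
  Finset.prod_nonneg fun a _ => mul_nonneg (hw a) (Finset.prod_nonneg fun _ _ => le_max_right _ _)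

lemma levelWeight_ne_zero_iff {A : Finset X} {w : X → ℝ} {C : Finset X} :
    levelWeight A w C ≠ 0 ↔ ∀ a ∈ C, w a ≠ 0 ∧ ∀ b ∈ A, b ∉ C → w b < w a := by
  classical
  have : ∀ x : ℝ, max x 0 ≠ 0 ↔ 0 < x := fun x => by
    rw [← (le_max_right x 0).lt_iff_ne', lt_max_iff]
    simp
  simp [levelWeight, Finset.prod_ne_zero_iff, this]

lemma continuous_levelWeight {T : Type*} [TopologicalSpace T] {A : Finset X} {w : T → X → ℝ}
    (hw : ∀ a, Continuous fun t => w t a) (C : Finset X) :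
    Continuous fun t => levelWeight A (w t) C :=
  continuous_finsetProd _ fun a _ => (hw a).mul
    (continuous_finsetProd _ fun b _ => ((hw a).sub (hw b)).max continuous_const)

/-- Superlevel sets of one function are nested: incomparable sets would contain points each of
larger value than the other. -/
lemma levelWeight_chain {A : Finset X} {w : X → ℝ} {C D : Finset X} (hC : C ⊆ A) (hD : D ⊆ A)
    (hCw : levelWeight A w C ≠ 0) (hDw : levelWeight A w D ≠ 0) : C ⊆ D ∨ D ⊆ C := by
  rw [levelWeight_ne_zero_iff] at hCw hDw
  by_contra! h
  obtain ⟨c, hc, hc'⟩ := Finset.not_subset.1 h.1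
  obtain ⟨d, hd, hd'⟩ := Finset.not_subset.1 h.2
  exact ((hCw c hc).2 d (hD hd) hd').asymm ((hDw d hd).2 c (hC hc) hc')

variable {L : PreAbstractSimplicialComplex X} {K : PreAbstractSimplicialComplex (Finset X)}

/-- Finite sets associated with the vertices of `L` give a map from `|L|` to a complex of chains of
finite sets. -/
theorem exists_chainMap (A : Finset X) (B : X → Finset X) (hBA : ∀ z, B z ⊆ A)
    (hB : ∀ z, (B z).Nonempty)
    (hK : ∀ s ∈ L.faces, ∀ T : Finset (Finset X), T.Nonempty →
      (∀ C ∈ T, C.Nonempty ∧ ∀ a ∈ C, ∃ z ∈ s, a ∈ B z) →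
      (∀ C ∈ T, ∀ D ∈ T, C ⊆ D ∨ D ⊆ C) → T ∈ K.faces) :
    ∃ J : C(Realization L, Realization K), ∀ y, ∀ C ∈ (J y).1.support,
      (∀ a ∈ C, ∃ z ∈ y.1.support, a ∈ B z) ∧ ∀ a, (∀ z ∈ y.1.support, a ∈ B z) → a ∈ C := by
  classical
  obtain ⟨l, hl⟩ : ∃ l : X → X → ℝ, ∀ a z, l a z = if a ∈ B z then 1 else 0 := ⟨_, fun _ _ => rfl⟩
  have hl0 : ∀ a z, 0 ≤ l a z := fun a z => by rw [hl]; split_ifs <;> simp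
  have hl1 : ∀ a z, l a z ≤ 1 := fun a z => by rw [hl]; split_ifs <;> simp
  -- `w y a` is the total mass that `y` gives to the vertices `z` with `a ∈ B z`. Its superlevel
  -- sets form a chain that varies continuously with `y`, whereas the sets `B z` need not be
  -- comparable.
  obtain ⟨w, hw⟩ : ∃ w : Realization L → X → ℝ,
      ∀ y a, w y a = ∑ z ∈ y.1.support, y.1 z * l a z := ⟨_, fun _ _ => rfl⟩
  have hsum : ∀ y : Realization L, ∑ z ∈ y.1.support, y.1 z = 1 := fun y => y.2.2.1
  have hw0 : ∀ y a, 0 ≤ w y a := fun y a => by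
    rw [hw]
    exact Finset.sum_nonneg fun z _ => mul_nonneg (y.2.1 z) (hl0 a z)
  have hw1 : ∀ y a, w y a ≤ 1 := fun y a => by
    rw [hw]
    exact (Finset.sum_le_sum fun z _ => mul_le_of_le_one_right (y.2.1 z) (hl1 a z)).trans_eq
      (hsum y)
  have hwB : ∀ y a, w y a ≠ 0 → ∃ z ∈ y.1.support, a ∈ B z := fun y a h => by
    rw [hw] at h
    obtain ⟨z, hz, h⟩ := Finset.exists_ne_zero_of_sum_ne_zero h
    refine ⟨z, hz, by_contra fun h' => h ?_⟩
    rw [hl, if_neg h', mul_zero]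
  have hwall : ∀ y a, (∀ z ∈ y.1.support, a ∈ B z) → w y a = 1 := fun y a h => by
    rw [hw]
    exact (Finset.sum_congr rfl fun z hz => by rw [hl, if_pos (h z hz), mul_one]).trans (hsum y)
  have hwc : ∀ a, Continuous fun y => w y a := fun a => by
    refine (continuous_linearCombination (K := L) (l a)).congr fun y => ?_
    rw [hw, linearCombination_eq_sum subset_rfl]
  obtain ⟨S, hS⟩ : ∃ S : Finset (Finset X), ∀ C, C ∈ S ↔ C ⊆ A ∧ C.Nonempty :=
    ⟨A.powerset.filter fun C => C.Nonempty, fun C => by simp⟩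
  have hpos : ∀ y, 0 < ∑ C ∈ S, levelWeight A (w y) C := by
    intro y
    obtain ⟨z, hz⟩ := support_nonempty y
    have hA : A.Nonempty := (hB z).mono (hBA z)
    -- The set of all maximizers of `w y` in `A` is a superlevel set with positive weight.
    obtain ⟨m, hmA, hm⟩ := A.exists_max_image (w y) hA
    have hm0 : w y m ≠ 0 := by
      obtain ⟨b, hb⟩ := hB z
      have h₁ : 0 < w y b := by
        rw [hw]
        refine Finset.sum_pos' (fun z _ => mul_nonneg (y.2.1 z) (hl0 b z)) ⟨z, hz, ?_⟩
        rw [hl, if_pos hb, mul_one]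
        exact lt_of_le_of_ne (y.2.1 z) (Ne.symm (Finsupp.mem_support_iff.1 hz))
      exact (h₁.trans_le (hm b (hBA z hb))).ne'
    refine Finset.sum_pos' (fun C _ => levelWeight_nonneg (hw0 y) C)
      ⟨A.filter fun a => w y a = w y m, (hS _).2 ⟨Finset.filter_subset _ _,
        m, Finset.mem_filter.2 ⟨hmA, rfl⟩⟩,
        (levelWeight_nonneg (hw0 y) _).lt_of_ne' (levelWeight_ne_zero_iff.2 fun a ha => ?_)⟩
    rw [(Finset.mem_filter.1 ha).2]
    exact ⟨hm0, fun b hb hb' => (hm b hb).lt_of_ne fun h => hb' (Finset.mem_filter.2 ⟨hb, h⟩)⟩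
  have hface : ∀ y, ∃ T ∈ K.faces, ∀ C ∈ S, levelWeight A (w y) C ≠ 0 → C ∈ T := by
    intro y
    refine ⟨S.filter fun C => levelWeight A (w y) C ≠ 0, hK _ y.2.2.2 _ ?_ (fun C hC => ?_)
      fun C hC D hD => ?_, fun C hC h => Finset.mem_filter.2 ⟨hC, h⟩⟩
    · obtain ⟨C, hC, h⟩ := Finset.exists_ne_zero_of_sum_ne_zero (hpos y).ne'
      exact ⟨C, Finset.mem_filter.2 ⟨hC, h⟩⟩
    · obtain ⟨hC, h⟩ := Finset.mem_filter.1 hC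
      exact ⟨((hS C).1 hC).2, fun a ha => hwB y a (levelWeight_ne_zero_iff.1 h a ha).1⟩
    · obtain ⟨hC, h⟩ := Finset.mem_filter.1 hC
      obtain ⟨hD, h'⟩ := Finset.mem_filter.1 hD
      exact levelWeight_chain ((hS C).1 hC).1 ((hS D).1 hD).1 h h'
  refine ⟨⟨fun y => ofWeights S (levelWeight A (w y)) (fun C _ => levelWeight_nonneg (hw0 y) C)
    (hpos y) (hface y), continuous_ofWeights S (fun y => levelWeight A (w y))
    (fun y C _ => levelWeight_nonneg (hw0 y) C) hpos hface
    fun C _ => continuous_levelWeight hwc C⟩, fun y C hC => ?_⟩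
  obtain ⟨hCS, h⟩ := (mem_support_ofWeights (h0 := fun C _ => levelWeight_nonneg (hw0 y) C)
    (hpos := hpos y) (hf := hface y)).1 hC
  obtain ⟨-, c, hc⟩ := (hS C).1 hCS
  rw [levelWeight_ne_zero_iff] at h
  -- A point common to all `B z` has the largest possible value 1, so no nonempty superlevel set can
  -- omit it.
  refine ⟨fun a ha => hwB y a (h a ha).1, fun a ha => by_contra fun h' => ?_⟩
  obtain ⟨z, hz⟩ := support_nonempty y
  have h₁ := (h c hc).2 a (hBA z (ha z hz)) h'
  rw [hwall y a ha] at h₁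
  exact (hw1 y c).not_gt h₁

end levels

/-! ### The Alexandroff–McCord complexes. -/

namespace SimplicialSequence

variable {X : Type u} [MetricSpace X] [Nonempty X] (S : AdjustedSequence X)
  (K : SimplicialSequence (Finset X))

-- A chain all of whose members lie below those of another chain forms a chain with it.
omit [Nonempty X] in
lemma contiguous_of_forall_subset {T : Type*} [TopologicalSpace T] {n : ℕ}
    (hK : K.complex n = mcCordComplex S n) {F G : C(T, Realization (K.complex n))}
    (h : ∀ t, ∀ C ∈ (F t).1.support, ∀ D ∈ (G t).1.support, C ⊆ D) : Contiguous F G := by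
  classical
  have key : ∀ s ∈ (K.complex n).faces, ∀ t ∈ (K.complex n).faces,
      (∀ C ∈ s, ∀ D ∈ t, C ⊆ D) → s ∪ t ∈ (K.complex n).faces := by
    intro s hs t ht h
    rw [hK] at hs ht ⊢
    refine ⟨hs.1.mono Finset.subset_union_left, fun C hC => ?_, fun C hC D hD => ?_⟩
    · exact (Finset.mem_union.1 hC).elim (hs.2.1 C) (ht.2.1 C)
    · rcases Finset.mem_union.1 hC with hC | hC <;> rcases Finset.mem_union.1 hD with hD | hD
      · exact hs.2.2 C hC D hD
      · exact .inl (h C hC D hD)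
      · exact .inr (h D hD C hC)
      · exact ht.2.2 C hC D hD
  exact fun t => ⟨_, key _ (F t).2.2.2 _ (G t).2.2.2 (h t), Finset.subset_union_left,
    Finset.subset_union_right⟩

/-- Both `β` and `θ` come from `exists_chainMap`, applied to nearest points (or the base vertex) and
to clusters respectively. Sets in the carrier of `θ y` contain the intersection of the clusters
about the vertices of `y`, so each contiguity reduces to showing that certain points lie in all
these clusters. -/
theorem interleaved_of_chains (hK : ∀ n, K.complex n = mcCordComplex S n)
    (hvmap : ∀ n C, {C} ∈ (K.complex (n + 1)).faces → K.vmap n C = S.push n C)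
    {P : Set X} (hP : P.Subsingleton) (v : ℕ → P → Finset X)
    (hv : ∀ n p, K.vmap n (v (n + 1) p) = v n p)
    (hvK : ∀ n p, {v n p} ∈ (K.complex n).faces)
    (hvP : ∀ n (p : P), ∀ c ∈ v n p, dist c p < S.ε n) :
    K.Interleaved v := by
  classical
  have hsmall : ∀ n, ∀ s ∈ (K.complex n).faces, ∀ C ∈ s, S.IsSmall n C := fun n s hs => by
    rw [hK] at hs
    exact hs.2.1
  have hone : ∀ {n} {s : Finset (Finset X)} {u}, s ∈ (K.complex n).faces → u ∈ s →
      {u} ∈ (K.complex n).faces := fun hs hu =>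
    subset_mem_faces hs (Finset.singleton_subset_iff.2 hu) (Finset.singleton_nonempty _)
  have hdist : ∀ n, ∀ s ∈ (K.complex n).faces, ∀ C ∈ s, ∀ D ∈ s, ∀ c ∈ C, ∀ d ∈ D,
      dist c d < 2 * S.ε n := by
    intro n s hs C hC D hD c hc d hd
    rw [hK] at hs
    rcases hs.2.2 C hC D hD with h | h
    · exact (diam_lt_iff (hs.2.1 D hD).1).1 (hs.2.1 D hD).2.2 c (h hc) d hd
    · exact (diam_lt_iff (hs.2.1 C hC).1).1 (hs.2.1 C hC).2.2 c hc d (h hd)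
  have hsm : ∀ {n C}, {C} ∈ (K.complex n).faces → S.IsSmall n C := fun h =>
    hsmall _ _ h _ (Finset.mem_singleton_self _)
  have hε : ∀ n, S.γ n + S.ε (n + 1) + S.ε (n + 2) + S.ε (n + 3) + S.ε (n + 3) < S.ε n := by
    intro n
    linarith [S.adjusted' n, S.two_mul_succ_lt (n + 1), S.two_mul_succ_lt (n + 2), S.pos (n + 1)]
  have hnear : ∀ n z, ∀ a ∈ S.nearest n z, a ∈ S.A n ∧ dist a z ≤ S.γ n := fun n z a ha => by
    rw [dist_comm]
    exact ⟨S.nearest_subset n z ha, S.dist_le_of_mem_nearest ha⟩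
  have hvmapd : ∀ {n C}, {C} ∈ (K.complex (n + 1)).faces →
      ∀ a ∈ K.vmap n C, a ∈ S.A n ∧ ∃ c ∈ C, dist a c ≤ S.γ n := fun {n C} hC a ha => by
    rw [hvmap n C hC] at ha
    obtain ⟨c, hc, ha⟩ := S.mem_push.1 ha
    exact ⟨(hnear n c a ha).1, c, hc, (hnear n c a ha).2⟩
  obtain ⟨B, hBv, hBd⟩ : ∃ B : ℕ → X → Finset X, (∀ n (p : P), B n p = v n p) ∧
      ∀ n z, (B n z).Nonempty ∧ ∀ a ∈ B n z, a ∈ S.A n ∧ dist a z ≤ S.γ n + S.ε (n + 1) := by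
    refine ⟨fun n z => if h : z ∈ P then v n ⟨z, h⟩ else S.nearest n z, fun n p => by simp,
      fun n z => ?_⟩
    dsimp only
    split_ifs with h
    · refine ⟨(hsm (hvK n _)).1, fun a ha => ?_⟩
      -- As for the Dowker complexes, the base vertex is viewed as the image of the next one to get
      -- the bound `γ_n + ε_{n+1}`.
      rw [← hv] at ha
      obtain ⟨ha, c, hc, hac⟩ := hvmapd (hvK (n + 1) _) a ha
      exact ⟨ha, by linarith [dist_triangle a c z, hvP (n + 1) ⟨z, h⟩ c hc]⟩
    · exact ⟨S.nearest_nonempty n z, fun a ha => ⟨(hnear n z a ha).1, by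
        linarith [(hnear n z a ha).2, S.pos (n + 1)]⟩⟩
  choose α hαv hα using fun n => exists_based_choice hP (v n)
    (fun C y => ∃ c ∈ C, dist c y < S.ε n) fun p => by
      obtain ⟨c, hc⟩ := (hsm (hvK n p)).1
      exact ⟨c, hc, hvP n p c hc⟩
  have hαs : ∀ {n} {s : Finset (Finset X)}, s ∈ (K.complex n).faces → ∀ C ∈ s,
      ∃ c ∈ C, dist c (α n C) < S.ε n := fun {n} s hs C hC => by
    obtain ⟨c, hc⟩ := (hsm (hone hs hC)).1
    exact hα n C ⟨c, c, hc, by rw [dist_self]; exact S.pos n⟩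
  obtain ⟨d, hd⟩ : ∃ d : ℕ → Scale.{u}, ∀ n, (d n).val = S.ε (n + 3) :=
    ⟨fun n => Scale.mk _ (S.pos (n + 3)), fun n => rfl⟩
  have hchain : ∀ n (B : X → Finset X), (∀ z, (B z).Nonempty ∧
      ∀ a ∈ B z, a ∈ S.A n ∧ dist a z ≤ S.γ n + S.ε (n + 1) + S.ε (n + 2) + S.ε (n + 3)) →
      ∃ J : C(Realization (ripsComplex X (d n).val), Realization (K.complex n)),
        ∀ y, ∀ C ∈ (J y).1.support,
      (∀ a ∈ C, ∃ z ∈ y.1.support, a ∈ B z) ∧ ∀ a, (∀ z ∈ y.1.support, a ∈ B z) → a ∈ C := by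
    refine fun n B hB => exists_chainMap (S.A n) B (fun z a ha => ((hB z).2 a ha).1)
      (fun z => (hB z).1) fun s hs T hT hTs hch => ?_
    rw [hK]
    refine ⟨hT, fun C hC => ?_, hch⟩
    obtain ⟨z₀, hz₀⟩ := hs.1
    refine S.isSmall_of_forall_dist_lt (z := z₀) (hTs C hC).1 fun a ha => ?_
    obtain ⟨z, hz, haz⟩ := (hTs C hC).2 a ha
    have h₁ := (mem_ripsComplex hs.1).1 hs z hz z₀ hz₀
    rw [hd] at h₁
    exact ⟨((hB z).2 a haz).1, by linarith [((hB z).2 a haz).2, hε n, dist_triangle a z z₀]⟩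
  choose β hβ using fun n => hchain n (B n) fun z => ⟨(hBd n z).1, fun a ha =>
    ⟨((hBd n z).2 a ha).1, by linarith [((hBd n z).2 a ha).2, S.pos (n + 2), S.pos (n + 3)]⟩⟩
  choose θ hθ using fun n => hchain n (S.cluster n) fun z =>
    ⟨(S.nearest_nonempty n z).mono (S.nearest_subset_cluster n z), fun a ha => S.mem_cluster.1 ha⟩
  have hyd : ∀ {n} (y : Realization (ripsComplex X (d n).val)), ∀ z ∈ y.1.support,
      ∀ z' ∈ y.1.support, dist z z' < S.ε (n + 3) := fun {n} y z hz z' hz' =>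
    (dist_lt_of_mem_support y hz hz').trans_eq (hd n)
  have hanti : ∀ n, d n ≤ d (n + 1) := fun n => by
    change (d (n + 1)).val ≤ (d n).val
    rw [hd, hd]
    exact S.anti (by omega)
  refine K.interleaved_of_contiguous hP v hv d β θ α (fun n p y hy => ?_) hαv
    (fun n => K.contiguous_of_forall_subset S (hK n) fun y C hC D hD a ha => ?_)
    (fun n => ⟨d (n + 1), hanti n, le_rfl,
      K.contiguous_of_forall_subset S (hK n) fun y C hC D hD a ha => ?_⟩)
    (fun r hr => ?_) (fun r hr => ?_) fun n => ⟨6, fun k hk hs =>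
      K.contiguous_of_forall_subset S (hK n) fun y C hC D hD a ha => ?_⟩
  -- Over a single vertex the lower and upper bounds of `exists_chainMap` coincide, so the value
  -- there is exactly the base vertex.
  · refine eq_single_of_support_subset fun C hC => Finset.mem_singleton.2 ?_
    obtain ⟨h₁, h₂⟩ := hβ n y C hC
    have h₃ : ∀ z, z ∈ y.1.support ↔ z = p.1 := fun z => by
      rw [hy, Finsupp.support_single _ one_ne_zero, Finset.mem_singleton]
    simp only [h₃, exists_eq_left, forall_eq, hBv] at h₁ h₂
    exact Finset.Subset.antisymm h₁ h₂
  · obtain ⟨z, hz, haz⟩ := (hβ n y C hC).1 a ha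
    obtain ⟨haA, had⟩ := (hBd n z).2 a haz
    refine (hθ n y D hD).2 a fun z' hz' => S.mem_cluster.2 ⟨haA, ?_⟩
    linarith [dist_triangle a z z', hyd y z hz z' hz', S.pos (n + 2)]
  · obtain ⟨C', hC', rfl⟩ := (mem_support_realize (hf := K.isSimplicial n)).1 hC
    have hC'K := hone ((β (n + 1)) (ripsIncl (Scale.val_le le_rfl) y)).2.2.2 hC'
    obtain ⟨haA, c, hc, hac⟩ := hvmapd hC'K a ha
    obtain ⟨z, hz, hcz⟩ := (hβ (n + 1) _ C' hC').1 c hc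
    rw [ripsIncl_val] at hz
    refine (hθ n _ D hD).2 a fun z' hz' => S.mem_cluster.2 ⟨haA, ?_⟩
    rw [ripsIncl_val] at hz'
    linarith [dist_triangle4 a c z z', hyd y z hz z' hz', ((hBd (n + 1) z).2 c hcz).2,
      S.adjusted' (n + 1), S.pos (n + 2), S.pos (n + 3), S.anti (show n + 2 ≤ n + 1 + 3 by omega)]
  · obtain ⟨l₀, hl₀⟩ := S.eventually_lt 4 hr
    refine ⟨l₀, fun l hl s hs C hC D hD => ?_⟩
    obtain ⟨c, hc, h₁⟩ := hαs hs C hC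
    obtain ⟨c', hc', h₂⟩ := hαs hs D hD
    rw [dist_comm] at h₁
    linarith [hl₀ l hl, dist_triangle4 (α l C) c c' (α l D), hdist l s hs C hC D hD c hc c' hc']
  · obtain ⟨l₀, hl₀⟩ := S.eventually_lt 4 hr
    refine ⟨l₀, fun l hl y C hC z hz => ?_⟩
    obtain ⟨c, hc, h₁⟩ := hαs (β l y).2.2.2 C hC
    obtain ⟨z', hz', hcz'⟩ := (hβ l y C hC).1 c hc
    rw [dist_comm] at h₁
    linarith [hl₀ l hl, dist_triangle4 (α l C) c z' z, hyd y z' hz' z hz,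
      ((hBd l z').2 c hcz').2, S.adjusted' l, S.pos (l + 1), S.pos l,
      S.anti (show l ≤ l + 3 by omega)]
  · obtain ⟨k, rfl⟩ : ∃ i, k = i + 1 := ⟨k - 1, by omega⟩
    obtain ⟨C', hC', rfl⟩ := (mem_support_realize (hf := K.isSimplicial_bondMap n (k + 1))).1 hC
    have h₀ : 4 * S.ε (n + (k + 1)) ≤ S.ε (n + 4) := S.four_mul_le (by omega)
    have h₀' := S.two_mul_succ_lt (n + 3)
    have h₀'' := S.two_mul_succ_lt (n + 2)
    have hC'K := hone y.2.2.2 hC'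
    refine (hθ n _ D hD).2 a fun z hz => S.mem_cluster.2 ⟨?_, ?_⟩
    · have := image_mem (K.isSimplicial_bondMap n (k + 1)) hC'K
      rw [Finset.image_singleton] at this
      exact (hsm this).2.1 ha
    · obtain ⟨E, hE, rfl⟩ := (mem_support_realize (hf := hs)).1 hz
      obtain ⟨c, hc, h₁⟩ := K.exists_dist_bondMap_le S hvmap n k C' hC'K a ha
      obtain ⟨e, he, h₂⟩ := hαs y.2.2.2 E hE
      rw [dist_comm] at h₁
      linarith [dist_triangle4 a c e (α (n + (k + 1)) E),
        hdist _ _ y.2.2.2 C' hC' E hE c hc e he, S.pos (n + (k + 1)), S.pos (n + 3)]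

end SimplicialSequence

/-- Kőnig's lemma for a sequence of finite nonempty sets. -/
lemma exists_thread {V : Type u} (T : ℕ → Set V) (f : ℕ → V → V) (hfin : ∀ n, (T n).Finite)
    (hne : ∀ n, (T n).Nonempty) (hf : ∀ n, Set.MapsTo (f n) (T (n + 1)) (T n)) :
    ∃ v : ℕ → V, ∀ n, v n ∈ T n ∧ f n (v (n + 1)) = v n := by
  let F : ℕᵒᵖ ⥤ Type u := Functor.ofOpSequence (X := fun n => (T n : Type u))
    fun n => TypeCat.ofHom (hf n).restrict
  have (j : ℕᵒᵖ) : Finite (F.obj j) := (hfin j.unop).to_subtype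
  have (j : ℕᵒᵖ) : Nonempty (F.obj j) := (hne j.unop).to_subtype
  obtain ⟨s, hs⟩ := nonempty_sections_of_finite_inverse_system F
  let t : ∀ n, T n := fun n => s (op n)
  refine ⟨fun n => (t n).1, fun n => ⟨(t n).2, ?_⟩⟩
  have h := hs (homOfLE n.le_succ).op
  rw [Functor.ofOpSequence_map_homOfLE_succ] at h
  exact congrArg (fun a : T n => a.1) h

/-! ### Existence of compatible base vertices. -/

namespace SimplicialSequence

variable {X : Type u} [MetricSpace X] (S : AdjustedSequence X)

/-- Kőnig's lemma applies to the points of `A_n` at distance less than `ε_n` from `x`; the bonding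
maps preserve them because `ε_{n+1} + γ_n < ε_n`. -/
lemma exists_thread_of_points (K : SimplicialSequence X)
    (hK : ∀ n, ∀ a ∈ S.A n, {a} ∈ (K.complex n).faces)
    (hvmap : ∀ n a, {a} ∈ (K.complex (n + 1)).faces → K.vmap n a ∈ S.nearest n a) (x : X) :
    ∃ v : ℕ → X, ∀ n, ({v n} ∈ (K.complex n).faces ∧ dist x (v n) < S.ε n) ∧
      K.vmap n (v (n + 1)) = v n := by
  obtain ⟨v, hv⟩ := exists_thread (fun n => {a | a ∈ S.A n ∧ dist x a < S.ε n}) K.vmap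
    (fun n => (S.A n).finite_toSet.subset fun a ha => ha.1)
    (fun n => S.approx n x) fun n a ha => by
      have h := hvmap n a (hK _ a ha.1)
      refine ⟨S.nearest_subset n a h, ?_⟩
      linarith [S.dist_le_of_mem_nearest h, ha.2, dist_triangle x a (K.vmap n a),
        S.adjusted' n, S.pos (n + 1)]
  exact ⟨v, fun n => ⟨⟨hK n _ (hv n).1.1, (hv n).1.2⟩, (hv n).2⟩⟩

lemma exists_thread_of_balls (K : SimplicialSequence (Set X))
    (hK : ∀ n, K.complex n = cechComplex S n)
    (hvmap : ∀ n U, {U} ∈ (K.complex (n + 1)).faces → U ⊆ K.vmap n U) (x : X) :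
    ∃ v : ℕ → Set X, ∀ n, ({v n} ∈ (K.complex n).faces ∧ x ∈ v n) ∧
      K.vmap n (v (n + 1)) = v n := by
  classical
  have hT : ∀ n U, S.IsBall n U → x ∈ U → {U} ∈ (K.complex n).faces := fun n U hU hx => by
    rw [hK]
    exact ⟨Finset.singleton_nonempty U, by simpa using hU, x, by simpa using hx⟩
  obtain ⟨v, hv⟩ := exists_thread (fun n => {U | S.IsBall n U ∧ x ∈ U}) K.vmap
    (fun n => ((S.A n).finite_toSet.image fun a => Metric.ball a (S.ε n)).subset
      fun U ⟨⟨a, ha, h⟩, _⟩ => ⟨a, ha, h.symm⟩)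
    (fun n => by
      obtain ⟨a, ha, h⟩ := S.approx n x
      exact ⟨_, ⟨a, ha, rfl⟩, h⟩) fun n U hU => by
      have h := hT _ U hU.1 hU.2
      have h' := image_mem (K.isSimplicial n) h
      rw [hK] at h'
      exact ⟨h'.2.1 _ (by simp), hvmap n U h hU.2⟩
  exact ⟨v, fun n => ⟨⟨hT n _ (hv n).1.1 (hv n).1.2, (hv n).1.2⟩, (hv n).2⟩⟩

lemma exists_thread_of_sets (K : SimplicialSequence (Finset X))
    (hK : ∀ n C, S.IsSmall n C → {C} ∈ (K.complex n).faces)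
    (hvmap : ∀ n C, {C} ∈ (K.complex (n + 1)).faces → K.vmap n C = S.push n C) (x : X) :
    ∃ v : ℕ → Finset X, ∀ n, ({v n} ∈ (K.complex n).faces ∧ ∀ c ∈ v n, dist x c < S.ε n) ∧
      K.vmap n (v (n + 1)) = v n := by
  have hT : ∀ n (C : Finset X), C.Nonempty ∧ (∀ c ∈ C, c ∈ S.A n ∧ dist x c < S.ε n) →
      {C} ∈ (K.complex n).faces := fun n C hC => hK n C <|
    S.isSmall_of_forall_dist_lt (z := x) hC.1 fun c hc => by
      rw [dist_comm]
      exact hC.2 c hc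
  obtain ⟨v, hv⟩ := exists_thread
    (fun n => {C : Finset X | C.Nonempty ∧ ∀ c ∈ C, c ∈ S.A n ∧ dist x c < S.ε n}) K.vmap
    (fun n => (S.A n).powerset.finite_toSet.subset
      fun C hC => Finset.mem_coe.2 (Finset.mem_powerset.2 fun c hc => (hC.2 c hc).1))
    (fun n => ⟨S.nearest n x, S.nearest_nonempty n x, fun c hc => ⟨S.nearest_subset n x hc,
      (S.dist_le_of_mem_nearest hc).trans_lt (S.γ_lt n)⟩⟩) fun n C hC => by
      rw [hvmap n C (hT _ C hC)]
      obtain ⟨c, hc⟩ := hC.1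
      obtain ⟨b, hb⟩ := S.nearest_nonempty n c
      refine ⟨⟨b, S.mem_push.2 ⟨c, hc, hb⟩⟩, fun a ha => ⟨S.push_subset n C ha, ?_⟩⟩
      obtain ⟨d, hd, ha⟩ := S.mem_push.1 ha
      linarith [S.dist_le_of_mem_nearest ha, (hC.2 d hd).2, dist_triangle x d a,
        S.adjusted' n, S.pos (n + 1)]
  exact ⟨v, fun n => ⟨⟨hT n _ (hv n).1, fun c hc => ((hv n).1.2 c hc).2⟩, (hv n).2⟩⟩

end SimplicialSequence

/-! ### Metric properties of witness and Dowker simplices. -/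

section complexes

variable {X : Type u} [MetricSpace X] (S : AdjustedSequence X) {n : ℕ}

lemma mem_witnessComplex_of_forall_dist_lt {s : Finset X} {z : X} (hs : s.Nonempty)
    (h : ∀ a ∈ s, a ∈ S.A n ∧ dist a z < S.ε n) : s ∈ (witnessComplex S n).faces := by
  refine ⟨hs, fun a ha => (h a ha).1, fun t hts ht => ⟨z, ?_⟩⟩
  rw [← nsmul_eq_mul, ← Finset.sum_const]
  refine Finset.sum_lt_sum_of_nonempty ht fun a ha => ?_
  rw [dist_comm]
  exact (h a (hts ha)).2

/-- The witness condition for the pair `{a, b}` bounds the sum of the distances of `a` and `b` from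
one point by `2 ε_n`. -/
lemma dist_lt_of_mem_witnessComplex {s : Finset X} (hs : s ∈ (witnessComplex S n).faces) {a b : X}
    (ha : a ∈ s) (hb : b ∈ s) : dist a b < 2 * S.ε n := by
  classical
  by_cases hab : a = b
  · rw [hab, dist_self]
    linarith [S.pos n]
  · obtain ⟨x, hx⟩ := hs.2.2 {a, b} (by simp [Finset.insert_subset_iff, ha, hb])
      (Finset.insert_nonempty _ _)
    rw [Finset.sum_pair hab, Finset.card_pair hab] at hx
    push_cast at hx
    linarith [dist_triangle_left a b x]

/-- The points of `A_n` within `ε_n` of `z` form a common upper bound of diameter below `2 ε_n`. -/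
lemma mem_upperDowkerComplex_of_forall_dist_lt {s t r : Finset (Finset X)} {z : X}
    (hs : s ∈ (upperDowkerComplex S n).faces) (hsz : ∀ C ∈ s, ∀ a ∈ C, dist a z < S.ε n)
    (htz : ∀ C ∈ t, C.Nonempty ∧ ∀ a ∈ C, a ∈ S.A n ∧ dist a z < S.ε n)
    (hr : ∀ C, C ∈ r ↔ C ∈ s ∨ C ∈ t) : r ∈ (upperDowkerComplex S n).faces := by
  classical
  obtain ⟨C₀, hC₀⟩ := hs.1
  have hC : ∀ C ∈ r, C.Nonempty ∧ ∀ a ∈ C, a ∈ S.A n ∧ dist a z < S.ε n := fun C hC =>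
    ((hr C).1 hC).elim (fun h => ⟨(hs.2.1 C h).1, fun a ha => ⟨(hs.2.1 C h).2.1 ha, hsz C h a ha⟩⟩)
      (htz C)
  refine ⟨⟨C₀, (hr C₀).2 (.inl hC₀)⟩, fun C h => S.isSmall_of_forall_dist_lt (hC C h).1 (hC C h).2,
    (S.A n).filter fun a => dist a z < S.ε n,
    S.isSmall_of_forall_dist_lt (z := z) ?_ fun a ha => Finset.mem_filter.1 ha,
    fun C h a ha => Finset.mem_filter.2 ((hC C h).2 a ha)⟩
  obtain ⟨a, ha⟩ := (hs.2.1 C₀ hC₀).1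
  exact ⟨a, Finset.mem_filter.2 ⟨(hs.2.1 C₀ hC₀).2.1 ha, hsz C₀ hC₀ a ha⟩⟩

/-- A lower bound of `s` lies below some member of `s`, hence below all of `t`. -/
lemma mem_lowerDowkerComplex_of_forall_subset {s t r : Finset (Finset X)}
    (hs : s ∈ (lowerDowkerComplex S n).faces) (ht : ∀ C ∈ t, S.IsSmall n C)
    (hst : ∀ C ∈ s, ∀ D ∈ t, C ⊆ D)
    (hr : ∀ C, C ∈ r ↔ C ∈ s ∨ C ∈ t) : r ∈ (lowerDowkerComplex S n).faces := by
  obtain ⟨⟨C₀, hC₀⟩, hsm, C, hC, hCs⟩ := hs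
  exact ⟨⟨C₀, (hr C₀).2 (.inl hC₀)⟩, fun D h => ((hr D).1 h).elim (hsm D) (ht D), C, hC, fun D h =>
    ((hr D).1 h).elim (hCs D) fun h => (hCs C₀ hC₀).trans (hst C₀ hC₀ D h)⟩

lemma dist_lt_of_isSmall {C : Finset X} (hC : S.IsSmall n C) {a b : X} (ha : a ∈ C) (hb : b ∈ C) :
    dist a b < 2 * S.ε n := (diam_lt_iff hC.1).1 hC.2.2 a ha b hb

end complexes

/-! ### Verification for each kind of sequence. -/

namespace PAS

variable {X : Type u} [MetricSpace X] (K : PAS X)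

theorem interleaved [Nonempty X] {P : Set X} (hP : P.Subsingleton) (v : ℕ → P → K.kind.Vertex X)
    (hv : ∀ n p, K.vmap n (v (n + 1) p) = v n p)
    (hvK : ∀ n p, {v n p} ∈ (K.complex n).faces)
    (hvP : ∀ n (p : P), IsNear K.seq K.kind n (v n p) p.1) : K.toSequence.Interleaved v := by
  obtain ⟨S, kind, vmap, hadm⟩ := K
  cases kind with
  | alexandroffMcCord =>
    exact SimplicialSequence.interleaved_of_chains (X := X) S
      (PAS.toSequence ⟨S, .alexandroffMcCord, vmap, hadm⟩) (fun n => rfl) hadm hP v hv hvK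
      fun n p c hc => by
        rw [dist_comm]
        exact hvP n p c hc
  | finiteRips =>
    refine SimplicialSequence.interleaved_of_points (X := X) S
      (PAS.toSequence ⟨S, .finiteRips, vmap, hadm⟩) (fun n => S.A n) (fun n => subset_rfl)
      (fun n s hs a ha => hs.2.1 ha) (fun n s hs => (diam_lt_iff hs.1).1 hs.2.2)
      (fun n s z hs h => S.isSmall_of_forall_dist_lt hs h)
      (fun n a ha => S.dist_le_of_mem_nearest (hadm n a ha)) hP v hv hvK fun n p => ?_
    exact (dist_comm _ _).trans_lt (hvP n p)
  | vietoris =>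
    refine SimplicialSequence.interleaved_of_points (X := X) S
      (PAS.toSequence ⟨S, .vietoris, vmap, hadm⟩) (fun n => Set.univ) (fun n => Set.subset_univ _)
      (fun n s hs a ha => Set.mem_univ a) (fun n s hs => (diam_lt_iff hs.1).1 hs.2)
      (fun n s z hs h => ⟨hs, (diam_lt_iff hs).2 fun a ha b hb => by
        linarith [(h a ha).2, (h b hb).2, dist_triangle_right a b z]⟩)
      (fun n a ha => ?_) hP v hv hvK fun n p => ?_
    · exact ((dist_eq_zero (γ := X)).2 (hadm n a ha).symm).trans_le (S.γ_nonneg n)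
    · exact (dist_comm _ _).trans_lt (hvP n p)
  | cech =>
    refine SimplicialSequence.interleaved_of_balls (X := X) S
      (PAS.toSequence ⟨S, .cech, vmap, hadm⟩) (fun n => rfl) (fun n U hU => ?_) hP v hv hvK hvP
    obtain ⟨a, -, b, hb, h, h'⟩ := hadm n U hU
    exact h.trans_subset ((ball_subset_ball_of_mem_nearest S hb).trans_eq h'.symm)
  | cechRefinement =>
    exact SimplicialSequence.interleaved_of_balls (X := X) S
      (PAS.toSequence ⟨S, .cechRefinement, vmap, hadm⟩) (fun n => rfl)
      (fun n U hU => (hadm n U hU).2) hP v hv hvK hvP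
  | witness =>
    refine SimplicialSequence.interleaved_of_points (X := X) S
      (PAS.toSequence ⟨S, .witness, vmap, hadm⟩) (fun n => S.A n) (fun n => subset_rfl)
      (fun n s hs a ha => hs.2.1 ha)
      (fun n s hs a ha b hb => dist_lt_of_mem_witnessComplex S hs ha hb)
      (fun n s z hs h => mem_witnessComplex_of_forall_dist_lt S hs h)
      (fun n a ha => S.dist_le_of_mem_nearest (hadm n a ha)) hP v hv hvK fun n p => ?_
    exact (dist_comm _ _).trans_lt (hvP n p)
  | upperDowker =>
    refine SimplicialSequence.interleaved_of_clusters (X := X) S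
      (PAS.toSequence ⟨S, .upperDowker, vmap, hadm⟩) (fun n s hs => hs.2.1)
      (fun n s hs C hC D hD c hc d hd => ?_)
      (fun n C hC => ⟨Finset.singleton_nonempty C, by simpa using hC, C, hC, by simp⟩)
      (fun n s hs t z hsz htz hst r hr => ?_) hadm hP v hv hvK
      fun n p c hc => by
        rw [dist_comm]
        exact hvP n p c hc
    · obtain ⟨-, -, E, hE, h⟩ := hs
      linarith [dist_lt_of_isSmall S hE (h C hC hc) (h D hD hd), S.pos n]
    · obtain ⟨C, hC⟩ := hs.1
      exact mem_upperDowkerComplex_of_forall_dist_lt S hs hsz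
        (fun D hD => ⟨(hs.2.1 C hC).1.mono (hst C hC D hD), htz D hD⟩) hr
  | lowerDowker =>
    refine SimplicialSequence.interleaved_of_clusters (X := X) S
      (PAS.toSequence ⟨S, .lowerDowker, vmap, hadm⟩) (fun n s hs => hs.2.1)
      (fun n s hs C hC D hD c hc d hd => ?_)
      (fun n C hC => ⟨Finset.singleton_nonempty C, by simpa using hC, C, hC, by simp⟩)
      (fun n s hs t z hsz htz hst r hr => ?_) hadm hP v hv hvK
      fun n p c hc => by
        rw [dist_comm]
        exact hvP n p c hc
    · obtain ⟨-, hsm, E, ⟨⟨e, he⟩, -⟩, h⟩ := hs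
      linarith [dist_lt_of_isSmall S (hsm C hC) hc (h C hC he),
        dist_lt_of_isSmall S (hsm D hD) (h D hD he) hd, dist_triangle c e d]
    · obtain ⟨C, hC⟩ := hs.1
      exact mem_lowerDowkerComplex_of_forall_subset S hs (fun D hD =>
        S.isSmall_of_forall_dist_lt ((hs.2.1 C hC).1.mono (hst C hC D hD)) (htz D hD)) hst hr

theorem nonempty_baseThread (x : X) : Nonempty (K.BaseThread x) := by
  suffices ∃ v : ℕ → K.kind.Vertex X, ∀ n,
      ({v n} ∈ (K.complex n).faces ∧ IsNear K.seq K.kind n (v n) x) ∧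
        K.vmap n (v (n + 1)) = v n by
    obtain ⟨v, hv⟩ := this
    exact ⟨⟨v, fun n => (hv n).1.1, fun n => (hv n).2, fun n => (hv n).1.2⟩⟩
  obtain ⟨S, kind, vmap, hadm⟩ := K
  have hsing : ∀ n, ∀ a ∈ S.A n, S.IsSmall n {a} := fun n a ha =>
    S.isSmall_of_forall_dist_lt (z := a) (Finset.singleton_nonempty a) (by simp [ha, S.pos n])
  cases kind with
  | alexandroffMcCord =>
    exact SimplicialSequence.exists_thread_of_sets (X := X) S
      (PAS.toSequence ⟨S, .alexandroffMcCord, vmap, hadm⟩)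
      (fun n C hC => ⟨Finset.singleton_nonempty C, by simpa using hC, by simp⟩) hadm x
  | finiteRips =>
    exact SimplicialSequence.exists_thread_of_points (X := X) S
      (PAS.toSequence ⟨S, .finiteRips, vmap, hadm⟩) hsing hadm x
  | vietoris =>
    -- Here the vertices near `x` may be infinite in number, but `x` itself is a vertex at every
    -- level and gives a constant thread.
    have hx : ∀ n, {x} ∈ (vietorisComplex S n).faces := fun n =>
      ⟨Finset.singleton_nonempty x, by simp [S.pos n]⟩
    refine ⟨fun _ => x, fun n => ⟨⟨hx n, ?_⟩, hadm n x (hx (n + 1))⟩⟩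
    exact (dist_self x).trans_lt (S.pos n)
  | cech =>
    refine SimplicialSequence.exists_thread_of_balls (X := X) S
      (PAS.toSequence ⟨S, .cech, vmap, hadm⟩) (fun n => rfl) (fun n U hU => ?_) x
    obtain ⟨a, -, b, hb, h, h'⟩ := hadm n U hU
    exact h.trans_subset ((ball_subset_ball_of_mem_nearest S hb).trans_eq h'.symm)
  | cechRefinement =>
    exact SimplicialSequence.exists_thread_of_balls (X := X) S
      (PAS.toSequence ⟨S, .cechRefinement, vmap, hadm⟩) (fun n => rfl)
      (fun n U hU => (hadm n U hU).2) x
  | witness =>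
    exact SimplicialSequence.exists_thread_of_points (X := X) S
      (PAS.toSequence ⟨S, .witness, vmap, hadm⟩)
      (fun n a ha => mem_witnessComplex_of_forall_dist_lt S (z := a)
        (Finset.singleton_nonempty a) (by simp [ha, S.pos n])) hadm x
  | upperDowker =>
    exact SimplicialSequence.exists_thread_of_sets (X := X) S
      (PAS.toSequence ⟨S, .upperDowker, vmap, hadm⟩)
      (fun n C hC => ⟨Finset.singleton_nonempty C, by simpa using hC, C, hC, by simp⟩) hadm x
  | lowerDowker =>
    exact SimplicialSequence.exists_thread_of_sets (X := X) S
      (PAS.toSequence ⟨S, .lowerDowker, vmap, hadm⟩)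
      (fun n C hC => ⟨Finset.singleton_nonempty C, by simpa using hC, C, hC, by simp⟩) hadm x

lemma isEmpty_realization [IsEmpty X] (n : ℕ) : IsEmpty (Realization (K.complex n)) := by
  refine ⟨fun c => ?_⟩
  have hc : c.1.support ∈ (K.complex n).faces := c.2.2.2
  obtain ⟨S, kind, vmap, hadm⟩ := K
  have hsmall : ∀ C : Finset X, ¬ S.IsSmall n C := fun C hC => isEmptyElim hC.1.choose
  cases kind with
  | alexandroffMcCord => exact hsmall _ (hc.2.1 _ hc.1.choose_spec)
  | finiteRips => exact IsEmpty.false (α := X) hc.1.choose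
  | vietoris => exact IsEmpty.false (α := X) hc.1.choose
  | cech => exact IsEmpty.false (α := X) hc.2.2.choose
  | cechRefinement => exact IsEmpty.false (α := X) hc.2.2.choose
  | witness => exact IsEmpty.false (α := X) hc.1.choose
  | upperDowker => exact hsmall _ (hc.2.1 _ hc.1.choose_spec)
  | lowerDowker => exact hsmall _ (hc.2.1 _ hc.1.choose_spec)

end PAS

end

end ShapeTheory

theorem mainTheorem2 {X : Type u} [MetricSpace X] [CompactSpace X] (K : ShapeTheory.PAS X) :
    (∀ (G : AddCommGrpCat.{u}) (p : ℕ),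
      ShapeTheory.IsCechHomologyGroup X G p
        (limit (K.system ⋙ ShapeTheory.homologyFunctor G p))) ∧
    (∀ (p : ℕ) (x : X),
      Nonempty (K.BaseThread x) ∧
      ∀ b : K.BaseThread x,
        ShapeTheory.IsShapeGroup X x p
          (limit (K.pointedSystem b ⋙ ShapeTheory.homotopyFunctor p))) := by
  refine ⟨K.isCechHomologyGroup_of_isExpansion ?_, fun p x => ⟨K.nonempty_baseThread x, fun b =>
    K.isShapeGroup_of_isExpansion b (K.exists_isExpansion_pointed_of_interleaved b ?_) p⟩⟩
  -- The interleaving needs maps from vertices to points of `X`. If `X` is empty all complexes are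
  -- empty, and the expansion property is immediate.
  · rcases isEmpty_or_nonempty X with hX | hX
    · exact K.exists_isExpansion_of_isEmpty K.isEmpty_realization
    · exact K.exists_isExpansion_of_interleaved (v := fun _ p => p.2.elim)
        (K.interleaved Set.subsingleton_empty _ (fun _ p => p.2.elim) (fun _ p => p.2.elim)
          fun _ p => p.2.elim)
  · have : Nonempty X := ⟨x⟩
    refine K.interleaved Set.subsingleton_singleton _ (fun n _ => b.compat n)
      (fun n _ => b.mem n) ?_
    rintro n ⟨p, rfl⟩
    exact b.near n
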